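/- **Conventions.** Use the ordered alphabets $\ell<c<r$ (unimodal) and $L<A<M<B<R<C<U$ (bimodal data use $L,A,M,B,R$ only), with signs $\epsilon(\ell)=\epsilon(L)=\epsilon(R)=1$, $\epsilon(r)=\epsilon(M)=\epsilon(U)=-1$, $\epsilon(c)=\epsilon(A)=\epsilon(B)=\epsilon(C)=0$. Sequences $S=S_0S_1\dots$ are ordered by $S<T$ iff for some $j$: $S_i=T_i$ for all $i<j$ and $\big(\prod_{i<j}\epsilon(S_i)\big)S_j<\big(\prod_{i<j}\epsilon(S_i)\big)T_j$ (a factor $-1$ reverses the order of symbols, a factor $0$ makes them equal). $\sigma$ is the shift, $w^\infty$ the periodic repetition of a word $w$, and a word is called odd or even according to its number of letters $M$. The word $\overline P$ arises from $P$ by exchanging $L$ and $R$. *Transition matrices.* Given the turning symbols and their kneading sequences $K_c$, the partition points are all $\sigma^n(cK_c)$, $n\ge 0$; ordered as $z_0<\dots<z_N$ they bound $N$ intervals, and the transition matrix is the $N\times N$ matrix over $\{0,1\}$ with $(i,j)$ entry $1$ iff $[z_j,z_{j+1}]$ lies between $\sigma z_i$ and $\sigma z_{i+1}$. *First factors.*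 $\mathcal D$ is the set of symmetric data $V=(PA,\overline PB)$ ("pair", $K_A=(PA)^\infty$, $K_B=(\overline PB)^\infty$) or $V=PB\overline PA$ ("doubly stable", $K_A=(PB\overline PA)^\infty$, $K_B=(\overline PAPB)^\infty$), with $P=P_1\dots P_{p-1}$, $P_i\in\{L,M,R\}$, $p\ge1$, such that $K_A,K_B$ are the itineraries of the images of the turning points $c_1,c_2$ of some continuous bimodal interval map (strictly increasing, decreasing, increasing). $A_V$ is the transition matrix of $(K_A,K_B)$. *Second factors.* $\mathcal U$ is the set of words $X=x_1\dots x_{k-1}c$, $k\ge2$, $x_i\in\{\ell,r\}$, such that $X^\infty$ is the kneading sequence of some continuous unimodal interval map (increasing, then decreasing); $A_X$ is its transition matrix. Each $X\in\mathcal U$ gives two second factors $W\in\mathcal G$: (1) the pair $(X,X)$, with $A_W=(A_X,A_X)$; (2) for $k$ odd the word obtained from $XX$, and for $k$ even the pair of words obtained from $(X,\sigma X)$ ($\sigma X=x_2\dots x_{k-1}cx_1$), by grouping letters in twos and translating $\ell\ell\to L$, $\ell c\to A$, $\ell r\to M$, $cr\to B$, $rr\to R$, $rc\to C$, $r\ell\to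 U$. In case (2), $A_W$ is the transition matrix of the trimodal data with turning symbols $A,B,C$: for $k$ odd, $K_A=K_C=W^\infty$ and $K_B$ is the part of $W^\infty$ after its first $B$; for $k$ even and $W=(u,v)$, $K_A=K_C=u^\infty$ and $K_B=v^\infty$. *Star product.* For $V=(PA,\overline PB)$ and $W=(X,X)$, $V\star W=(Pa(x_1)\dots Pa(x_{k-1})PA,\ \overline Pb(x_1)\dots\overline Pb(x_{k-1})\overline PB)$, where $a(r)=b(r)=M$, $a(\ell)=L$, $b(\ell)=R$ if $P$ is even and $a(\ell)=b(\ell)=M$, $a(r)=L$, $b(r)=R$ if $P$ is odd. For $V=PB\overline PA$ and $W$ as in (2), let $(\beta(Z),\alpha(Z))$, for $Z=L,A,M,B,R,C,U$, be $(M,M),(M,A),(M,L),(B,L),(R,L),(R,A),(R,M)$ if $P$ is even and $(R,L),(R,A),(R,M),(B,M),(M,M),(M,A),(M,L)$ if $P$ is odd. Put $P\star Z_1\dots Z_n=P\beta(Z_1)\overline P\alpha(Z_1)\dots P\beta(Z_n)\overline P\alpha(Z_n)$. If $k$ is odd, $V\star W=P\star W$ (doubly stable data). If $k$ is even and $W=(u,\,Y_1\dots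 Y_{n-1}B)$, then $V\star W$ is the pair with first word $P\star u$ and second word obtained from $\beta(B)\overline P\alpha(B)P\,\beta(Y_1)\overline P\alpha(Y_1)P\dots\beta(Y_{n-1})\overline P\alpha(Y_{n-1})P$ by moving its first letter $\beta(B)=B$ to the end. $A_{V\star W}$ is the transition matrix of the resulting bimodal data (for $k$ odd, $K_B$ starts just after the letter $B$). **Theorem 2.** There is a matrix product $\otimes$, i.e. an operation depending only on the matrices $A_V$ and $A_W$, such that for all $V\in\mathcal D$ and $W\in\mathcal G$ for which $V\star W$ is defined $$A_{V\star W}=A_V\otimes A_W .$$ Here $A_V$ is $(2p-1)$-square, $A_{V\star W}$ is $(2pk-1)$-square, and $A_V\otimes A_W$ is the following block matrix, whose block pattern is determined by $A_V$ alone and whose inner blocks are determined by $A_W$ alone. The matrix $A_V$ determines the map $\nu$ on $\{0,\dots,2p-1\}$ given by $\sigma z_i=z_{\nu(i)}$ on the partition points of $V$, the first symbol $s_i$ of each $z_i$, and a sign: "reversed" if $V$ is a pair with $P$ odd or doubly stable with $P$ even, "direct" otherwise. The matrix $A_W$ determines the $(k-1)$-square matrix $\mathsf B=A_X$. The $2pk-1$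 indices are arranged as $2p$ groups of $k-1$ inner indices, group $i$ and group $i+1$ being separated by one outer index $i$ ($0\le i\le 2p-2$). Then: 1. The (outer, outer) entries form the matrix $A_V$; the (inner, outer) entries are $0$. 2. The (group $i$, group $j$) block is $0$ unless $j=\nu(i)$. For $j=\nu(i)$ it is the identity if $s_i\in\{L,R\}$, the anti-identity if $s_i=M$; if $s_i=A$ it is $\mathsf B$, with rows in reverse order in the reversed case; if $s_i=B$ it is $\mathsf B$ with columns in reverse order, and rows in reverse order too in the direct case. 3. In outer row $i$, let $a$ and $b$ be the entries in the outer columns just before and just after group $j$ (an absent one counts as $0$). If $a=b$, all entries in the columns of group $j$ equal $a$. If $a\ne b$, they are $0$, except for the entries needed for continuity: let $i'=i$ if $j=\nu(i)$, and $i'=i+1$ if $j=\nu(i+1)$. If $s_{i'}=A$ and either $i'=i$ in the reversed case or $i'=i+1$ in the direct case, then the entry in the $t$-th column of group $j$ is $1$ whenever the $t$-th column of $\mathsf B$ contains exactly one $1$. If $s_{i'}=B$ and either $i'=i$ in the direct case or $i'=i+1$ in the reversed case, the same holds with the columns of $\mathsf B$ counted from the right. -/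

import Mathlib

namespace SymBimodal

/-! ### Symbols, itineraries, the order on symbolic sequences -/

/-- Symbols of unimodal maps: left lap, turning point, right lap. -/
inductive USym
  | l | c | r
  deriving DecidableEq

/-- Symbols, in increasing order. Bimodal maps use `L, A, M, B, R`;
trimodal data use all seven; `A`, `B`, `C` are the turning points. -/
inductive Sym
  | L | A | M | B | R | C | U
  deriving DecidableEq

/-- Position of a symbol on the line, and its sign: `1` on increasing laps, `-1` on decreasing
laps, `0` at turning points. -/
class LapAlphabet (α : Type) where
  rank : α → ℤ
  eps : α → ℤ

instance : LapAlphabet USym where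
  rank
    | .l => 0 | .c => 1 | .r => 2
  eps
    | .l => 1 | .c => 0 | .r => -1

instance : LapAlphabet Sym where
  rank
    | .L => 0 | .A => 1 | .M => 2 | .B => 3 | .R => 4 | .C => 5 | .U => 6
  eps
    | .L => 1 | .A => 0 | .M => -1 | .B => 0 | .R => 1 | .C => 0 | .U => -1

section Sequences

variable {α : Type}

/-- The shift. -/
def shift (S : ℕ → α) : ℕ → α := fun n => S (n + 1)

/-- The sequence `a S₀ S₁ S₂ …`. -/
def consSeq (a : α) (S : ℕ → α) : ℕ → α
  | 0 => a
  | n + 1 => S n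

/-- The periodic sequence `w w w …` (constant `d` if `w` is empty). -/
def periodic (d : α) (w : List α) : ℕ → α := fun n => w.getD (n % w.length) d

/-- The strict order on sequences: lexicographic order of `θ_j = ε(S_0) ⋯ ε(S_{j-1}) S_j`. -/
def SeqLT [LapAlphabet α] (S T : ℕ → α) : Prop :=
  ∃ j, (∀ i < j, S i = T i) ∧
    (∏ i ∈ Finset.range j, LapAlphabet.eps (S i)) * LapAlphabet.rank (S j) <
      (∏ i ∈ Finset.range j, LapAlphabet.eps (S i)) * LapAlphabet.rank (T j)

/-- Kneading data: the list of all turning points `c` with their kneading sequences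
(the itinerary of the image of `c`). -/
abbrev KneadingData (α : Type) := List (α × (ℕ → α))

/-- The points of the Markov partition, coded by their itineraries: the turning points and all
their iterates. -/
def points (D : KneadingData α) : Set (ℕ → α) :=
  {z | ∃ cK ∈ D, ∃ n, z = shift^[n] (consSeq cK.1 cK.2)}

/-- The position of `z` among the partition points, counted from `0`. -/
noncomputable def pos [LapAlphabet α] (D : KneadingData α) (z : ℕ → α) : ℕ :=
  {y ∈ points D | SeqLT y z}.ncard

/-- Interval `i` lies between the consecutive partition points of positions `i` and `i + 1`. Both
endpoints are in one closed lap, so its image is the interval between the images of its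
endpoints; `Covers D i j` says that this image contains interval `j`. -/
def Covers [LapAlphabet α] (D : KneadingData α) (i j : ℕ) : Prop :=
  ∃ z ∈ points D, ∃ z' ∈ points D, pos D z = i ∧ pos D z' = i + 1 ∧
    min (pos D (shift z)) (pos D (shift z')) ≤ j ∧
    j < max (pos D (shift z)) (pos D (shift z'))

end Sequences

/-- Square matrices of arbitrary size. -/
abbrev SqMat := Σ n : ℕ, Matrix (Fin n) (Fin n) ℕ

open Classical in
/-- The Markov transition matrix of kneading data. -/
noncomputable def markov {α : Type} [LapAlphabet α] (D : KneadingData α) : SqMat :=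
  ⟨(points D).ncard - 1, Matrix.of fun i j => if Covers D i j then 1 else 0⟩

/-! ### Unimodal kneading sequences -/

/-- Unimodal maps of `[c₀, c₂]` with maximum at `c₁`. -/
structure IsUnimodalMap (f : ℝ → ℝ) (c₀ c₁ c₂ : ℝ) : Prop where
  lt₀₁ : c₀ < c₁
  lt₁₂ : c₁ < c₂
  mapsTo : Set.MapsTo f (Set.Icc c₀ c₂) (Set.Icc c₀ c₂)
  continuousOn : ContinuousOn f (Set.Icc c₀ c₂)
  left : StrictMonoOn f (Set.Icc c₀ c₁)
  right : StrictAntiOn f (Set.Icc c₁ c₂)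

open Classical in
noncomputable def addressU (c₁ x : ℝ) : USym :=
  if x < c₁ then .l else if x = c₁ then .c else .r

/-- `𝒰`: the words `x₁ ⋯ x_{k-1} c`, `k ≥ 2`, `xᵢ ∈ {ℓ, r}`, whose periodic repetition is the
kneading sequence of a unimodal map. -/
def IsUnimodalWord (X : List USym) : Prop :=
  (∃ w : List USym, w ≠ [] ∧ (∀ x ∈ w, x ≠ .c) ∧ X = w ++ [.c]) ∧
  ∃ (f : ℝ → ℝ) (c₀ c₁ c₂ : ℝ), IsUnimodalMap f c₀ c₁ c₂ ∧
    ∀ n, addressU c₁ (f^[n + 1] c₁) = periodic .c X n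

/-- The transition matrix of a unimodal word. -/
noncomputable def markovU (X : List USym) : SqMat := markov [(USym.c, periodic .c X)]

/-! ### Bimodal kneading data and the set `𝒟` -/

/-- Bimodal maps of `[c₀, c₃]`: increasing, decreasing, increasing. -/
structure IsBimodalMap (f : ℝ → ℝ) (c₀ c₁ c₂ c₃ : ℝ) : Prop where
  lt₀₁ : c₀ < c₁
  lt₁₂ : c₁ < c₂
  lt₂₃ : c₂ < c₃
  mapsTo : Set.MapsTo f (Set.Icc c₀ c₃) (Set.Icc c₀ c₃)
  continuousOn : ContinuousOn f (Set.Icc c₀ c₃)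
  left : StrictMonoOn f (Set.Icc c₀ c₁)
  middle : StrictAntiOn f (Set.Icc c₁ c₂)
  right : StrictMonoOn f (Set.Icc c₂ c₃)

open Classical in
noncomputable def addressB (c₁ c₂ x : ℝ) : Sym :=
  if x < c₁ then .L else if x = c₁ then .A else if x < c₂ then .M else if x = c₂ then .B else .R

/-- Periodic data written as in symbolic dynamics: a pair of periodic blocks (the turning points
`A` and `B` have separate orbits), or one block ending in `A` and containing `B`
(both turning points are on one orbit). -/
inductive BlockData
  | pair (P Q : List Sym)
  | doubly (S : List Sym)

/-- Kneading sequence of `A`. -/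
def BlockData.seqA : BlockData → (ℕ → Sym)
  | .pair P _ => periodic .A P
  | .doubly S => periodic .A S

/-- Kneading sequence of `B`; on a doubly stable orbit it starts just after the symbol `B`. -/
def BlockData.seqB : BlockData → (ℕ → Sym)
  | .pair _ Q => periodic .B Q
  | .doubly S => shift^[S.idxOf .B + 1] (periodic .A S)

/-- The transition matrix of bimodal data. -/
noncomputable def BlockData.markovB (S : BlockData) : SqMat :=
  markov [(Sym.A, S.seqA), (Sym.B, S.seqB)]

/-- Conjugation of symbols. -/
def conj : Sym → Sym
  | .L => .R | .R => .L | .A => .B | .B => .A | x => x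

/-- Conjugation of words. -/
def bar (P : List Sym) : List Sym := P.map conj

/-- Symmetric data, given by the word `P = P₁ ⋯ P_{p-1}`: the pair `(P A, P̄ B)`, or the doubly
stable orbit `P B P̄ A`. -/
inductive SymData
  | pair (P : List Sym)
  | doubly (P : List Sym)

def SymData.word : SymData → List Sym
  | .pair P => P
  | .doubly P => P

/-- The number `p`. -/
def SymData.p (V : SymData) : ℕ := V.word.length + 1

def SymData.blocks : SymData → BlockData
  | .pair P => .pair (P ++ [.A]) (bar P ++ [.B])
  | .doubly P => .doubly (P ++ [.B] ++ bar P ++ [.A])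

/-- The set `𝒟`: symmetric data, with letters of `P` in `{L, M, R}`, whose two sequences are the
kneading sequences of a bimodal map. -/
def SymData.InD (V : SymData) : Prop :=
  (∀ x ∈ V.word, x = .L ∨ x = .M ∨ x = .R) ∧
  ∃ (f : ℝ → ℝ) (c₀ c₁ c₂ c₃ : ℝ), IsBimodalMap f c₀ c₁ c₂ c₃ ∧
    (∀ n, addressB c₁ c₂ (f^[n + 1] c₁) = V.blocks.seqA n) ∧
    (∀ n, addressB c₁ c₂ (f^[n + 1] c₂) = V.blocks.seqB n)

noncomputable def SymData.markovV (V : SymData) : SqMat := V.blocks.markovB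

/-- Odd `M`-parity. -/
def oddM (P : List Sym) : Bool := P.count .M % 2 = 1

/-! ### Second factors -/

/-- The translation rules for pairs of unimodal symbols. The pairs `cℓ` and `cc` do not occur,
as every word of `𝒰` starts with `r`. -/
def pairCode : USym → USym → Sym
  | .l, .l => .L
  | .l, .c => .A
  | .l, .r => .M
  | .c, _ => .B
  | .r, .r => .R
  | .r, .c => .C
  | .r, .l => .U

def translate : List USym → List Sym
  | a :: b :: t => pairCode a b :: translate t
  | _ => []

/-- Second factors: a pair `(X, X)` of unimodal words; one block (elements of `𝒢⁻`);
a pair of blocks (elements of `𝒢⁺`). -/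
inductive Factor
  | twin (X : List USym)
  | minus (w : List Sym)
  | plus (u v : List Sym)

/-- `W.Over X`: the second factor `W` comes from the unimodal word `X`, either as `(X, X)`, or by
translating `X X` (odd length) or `(X, σ X)` (even length). -/
inductive Factor.Over (X : List USym) : Factor → Prop
  | twin : Factor.Over X (.twin X)
  | minus : Odd X.length → Factor.Over X (.minus (translate (X ++ X)))
  | plus : Even X.length → Factor.Over X (.plus (translate X) (translate (X.rotate 1)))

/-- The number `k`. -/
def Factor.k : Factor → ℕ
  | .twin X => X.length
  | .minus w => w.length
  | .plus u v => u.length + v.length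

/-- Trimodal data with equal images of the two maxima `A` and `C`. -/
def trimodal (K K' : ℕ → Sym) : KneadingData Sym := [(.A, K), (.B, K'), (.C, K)]

/-- Matrices of second factors: a pair of unimodal matrices, or one trimodal matrix. -/
abbrev FactorMat := (SqMat × SqMat) ⊕ SqMat

noncomputable def Factor.markovW : Factor → FactorMat
  | .twin X => .inl (markovU X, markovU X)
  | .minus w =>
      .inr (markov (trimodal (periodic .A w) (shift^[w.idxOf .B + 1] (periodic .A w))))
  | .plus u v => .inr (markov (trimodal (periodic .A u) (periodic .B v)))

/-! ### The star product -/

/-- The symbols `A_i^±` that replace `A` in the product with `(X, X)`. -/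
def slotA (odd : Bool) : USym → Sym
  | .r => if odd then .L else .M
  | .c => .A
  | .l => if odd then .M else .L

/-- The symbols `B_i^±` that replace `B` in the product with `(X, X)`. -/
def slotB (odd : Bool) : USym → Sym
  | .r => if odd then .R else .M
  | .c => .B
  | .l => if odd then .M else .R

/-- The two symbols `(B_i^±, A_i^±)` in the products with elements of `𝒢`. -/
def slots (odd : Bool) : Sym → Sym × Sym
  | .L => if odd then (.R, .L) else (.M, .M)
  | .A => if odd then (.R, .A) else (.M, .A)
  | .M => if odd then (.R, .M) else (.M, .L)
  | .B => if odd then (.B, .M) else (.B, .L)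
  | .R => if odd then (.M, .M) else (.R, .L)
  | .C => if odd then (.M, .A) else (.R, .A)
  | .U => if odd then (.M, .L) else (.R, .M)

/-- `P B_1^± P̄ A_1^± P B_2^± P̄ A_2^± ⋯`. -/
def starWord (P w : List Sym) : List Sym :=
  w.flatMap fun z => P ++ [(slots (oddM P) z).1] ++ bar P ++ [(slots (oddM P) z).2]

/-- `B_1^± P̄ A_1^± P B_2^± P̄ A_2^± P ⋯`. -/
def starWord' (P w : List Sym) : List Sym :=
  w.flatMap fun z => [(slots (oddM P) z).1] ++ bar P ++ [(slots (oddM P) z).2] ++ P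

/-- The product `V ⋆ W`. It is defined when `V` is a pair and `W = (X, X)`, and when `V` is doubly
stable and `W` has the form of an element of `𝒢`. In the last case the second block
`Y_1 ⋯ Y_{n-1} B` of `W` is first rotated to `B Y_1 ⋯ Y_{n-1}`, and the result is shifted once. -/
def star : SymData → Factor → Option BlockData
  | .pair P, .twin X => some (.pair
      (X.flatMap fun x => P ++ [slotA (oddM P) x])
      (X.flatMap fun x => bar P ++ [slotB (oddM (bar P)) x]))
  | .doubly P, .minus w => some (.doubly (starWord P w))
  | .doubly P, .plus u v => some (.pair (starWord P u)
      ((starWord' P (v.rotate (v.length - 1))).rotate 1))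
  | _, _ => none

/-! ### Block matrices -/

/-- Data of a block pattern: the map `next` induced on the positions of the partition points, the
symbols of these points, and the orientation `rev` of the block over the turning point `A`. -/
structure BlockPattern where
  next : ℕ → ℕ
  sym : ℕ → Sym
  rev : Bool

/-- `π` is the block pattern of `V`. -/
def SymData.IsPattern (V : SymData) (π : BlockPattern) : Prop :=
  (∀ z ∈ points [(Sym.A, V.blocks.seqA), (Sym.B, V.blocks.seqB)],
    π.next (pos [(Sym.A, V.blocks.seqA), (Sym.B, V.blocks.seqB)] z) =
      pos [(Sym.A, V.blocks.seqA), (Sym.B, V.blocks.seqB)] (shift z) ∧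
    π.sym (pos [(Sym.A, V.blocks.seqA), (Sym.B, V.blocks.seqB)] z) = z 0) ∧
  π.rev = match V with
    | .pair P => oddM P
    | .doubly P => !oddM P

/-- Entries of a square matrix, `0` out of range. -/
def entry (A : SqMat) (i j : ℕ) : ℕ :=
  if h : i < A.1 ∧ j < A.1 then A.2 ⟨i, h.1⟩ ⟨j, h.2⟩ else 0

/-- The nonzero inner block in the block row of the point `i`: an identity over increasing laps, an
anti-identity over the decreasing lap, and `B` with rows or columns possibly reversed over the
turning points. -/
def innerBlock (π : BlockPattern) (B : SqMat) (i s t : ℕ) : ℕ :=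
  match π.sym i with
  | .A => entry B (if π.rev then B.1 - 1 - s else s) t
  | .B => entry B (if π.rev then s else B.1 - 1 - s) (B.1 - 1 - t)
  | .M => if s + t = B.1 - 1 then 1 else 0
  | _ => if s = t then 1 else 0

/-- Column `t` of `B` has exactly one `1`. -/
def single (B : SqMat) (t : ℕ) : Bool := ∑ s ∈ Finset.range B.1, entry B s t = 1

/-- The entries needed for continuity next to a turning point. `contEntry π B i right t` concerns
the interval to the right (`right = true`) or to the left of the block of the point `i`. -/
def contEntry (π : BlockPattern) (B : SqMat) (i : ℕ) (right : Bool) (t : ℕ) : Bool :=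
  match π.sym i with
  | .A => right == π.rev && single B t
  | .B => right == !π.rev && single B (B.1 - 1 - t)
  | _ => false

/-- The block matrix with `n + 1` groups of `m` inner indices, separated by `n` outer indices,
where `n`, `m` are the sizes of `A`, `B`. Index `i (m + 1) + s` is inner index `s` of group `i` if
`s < m`, and outer index `i` if `s = m`. -/
def blockProduct (A : SqMat) (π : BlockPattern) (B : SqMat) : SqMat :=
  ⟨(A.1 + 1) * (B.1 + 1) - 1, Matrix.of fun a b =>
    let i := a.1 / (B.1 + 1)
    let s := a.1 % (B.1 + 1)
    let j := b.1 / (B.1 + 1)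
    let t := b.1 % (B.1 + 1)
    if s < B.1 then
      -- inner row
      if t < B.1 ∧ j = π.next i then innerBlock π B i s t else 0
    else if t < B.1 then
      -- outer row, inner column: `before` and `after` are the entries in the adjacent outer columns
      let before := if j = 0 then 0 else entry A i (j - 1)
      let after := entry A i j
      if before = after then before
      else if (j = π.next i ∧ contEntry π B i true t) ∨
          (j = π.next (i + 1) ∧ contEntry π B (i + 1) false t) then 1
      else 0
    else entry A i j⟩

end SymBimodal

namespace SymBimodal

/-! ### Symbolic sequences and periodic words -/

section Sequences

variable {α : Type}

/-! Everything is reduced to maps of finite ordered sets. Suppose a map `ν` of {0, …, N-1}, strictly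
monotone on its laps, realizes the kneading data, every position lies on the orbit of a turning
point, and every orbit meets a turning point. Then the order of positions is the order of
itineraries, so the transition matrix of the data is `matOf N ν` (`Realizes.markov_eq`). Numbering
the turning orbits of an interval map from left to right gives such a model `ν` on 2p positions for
V and a model `μ` on k positions for X.

The star product is then a skew product. Order the pairs (i, s) lexicographically and send (i, s) to
(ν i, g_i(s)), where g_i is the identity over increasing laps, the reversal over the decreasing lap,
and a suitably reflected copy of `μ` over the two turning points. This map is again bimodal
(`IsBModel.prod_model`). After p steps the fibre over a turning point returns to such a fibre, and
the sign of V is exactly what makes the return map equal to `μ`. The symbols read on the way spell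
the words of V ⋆ W (`step_overA`, `step_overB`), so the matrix of V ⋆ W is that of the skew product
(`markovB_star`).

Cutting this matrix along the groups gives the block matrix (`blockProduct_matOf`). An interval
inside a group maps into a single group, by the fibre map. An interval between two groups maps like
an interval of `ν`, except that its image may also contain part of an end group. Such a part is
nonempty only if the relevant fibre value is a copy of `μ 0`, and the columns of A_X with a single 1
are exactly those below `μ 0` (`single_matOf`).

It remains to see that pattern and inner blocks depend on the matrices alone. A transition matrix
gives the unordered pairs {ν i, ν (i+1)}; the direction of the last lap then fixes `ν`
(`map_eq_of_matOf_eq`), hence the turning points and the itineraries. So A_V determines V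
(`IsBModel.unique`). In case (2), A_W is the matrix of the second iterate of the unimodal map, a
trimodal map that likewise determines X (`markovU_eq_of_markovW_eq`). -/

lemma SeqLT.asymm [LapAlphabet α] {S T : ℕ → α} (h : SeqLT S T) : ¬ SeqLT T S := by
  rintro ⟨j, hj, hlt⟩
  obtain ⟨i, hi, hlt'⟩ := h
  rcases lt_trichotomy i j with hij | rfl | hij
  · rw [hj i hij] at hlt'
    exact lt_irrefl _ hlt'
  · rw [Finset.prod_congr rfl fun n hn => by rw [hj n (Finset.mem_range.1 hn)]] at hlt
    exact lt_asymm hlt hlt'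
  · rw [hi j hij] at hlt
    exact lt_irrefl _ hlt

lemma SeqLT.irrefl [LapAlphabet α] (S : ℕ → α) : ¬ SeqLT S S := fun h => h.asymm h

/-- The sequence that starts with the word `w` and goes on with `T`. -/
def appendSeq (w : List α) (T : ℕ → α) : ℕ → α := w.foldr consSeq T

@[simp] lemma appendSeq_nil (T : ℕ → α) : appendSeq [] T = T := rfl

@[simp] lemma appendSeq_cons (x : α) (w : List α) (T : ℕ → α) :
    appendSeq (x :: w) T = consSeq x (appendSeq w T) := rfl

lemma appendSeq_append (u v : List α) (T : ℕ → α) :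
    appendSeq (u ++ v) T = appendSeq u (appendSeq v T) := by
  simp [appendSeq, List.foldr_append]

lemma appendSeq_of_lt (w : List α) (T : ℕ → α) (d : α) {n : ℕ} (hn : n < w.length) :
    appendSeq w T n = w.getD n d := by
  induction w generalizing n with
  | nil => simp at hn
  | cons x w ih =>
    cases n with
    | zero => rfl
    | succ n => simpa [consSeq] using ih (by simpa using hn)

lemma appendSeq_length_add (w : List α) (T : ℕ → α) (n : ℕ) :
    appendSeq w T (w.length + n) = T n := by
  induction w with
  | nil => simp
  | cons x w ih =>
    rw [List.length_cons, Nat.add_right_comm]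
    exact ih

/-- A sequence that reproduces itself behind `w` is the repetition of `w`; the default `d` plays no
role because `w` is nonempty. -/
lemma eq_periodic {w : List α} (hw : w ≠ []) (d : α) {T : ℕ → α} (h : T = appendSeq w T) :
    T = periodic d w := by
  have hpos : 0 < w.length := List.length_pos_iff.2 hw
  funext n
  induction n using Nat.strong_induction_on with
  | _ n ih =>
    rcases lt_or_ge n w.length with hn | hn
    · rw [h, appendSeq_of_lt w T d hn, periodic, Nat.mod_eq_of_lt hn]
    · obtain ⟨m, rfl⟩ := Nat.exists_eq_add_of_le hn
      rw [h, appendSeq_length_add, ih m (by omega)]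
      simp [periodic]

lemma periodic_mem {w : List α} (hw : w ≠ []) (d : α) (n : ℕ) : periodic d w n ∈ w := by
  have h : n % w.length < w.length := Nat.mod_lt _ (List.length_pos_iff.2 hw)
  rw [periodic, List.getD_eq_getElem _ _ h]
  exact List.getElem_mem h

lemma periodic_of_lt (d : α) {w : List α} {n : ℕ} (hn : n < w.length) :
    periodic d w n = w[n] := by
  rw [periodic, Nat.mod_eq_of_lt hn, List.getD_eq_getElem _ _ hn]

lemma periodic_add_length (d : α) (w : List α) (n : ℕ) :
    periodic d w (n + w.length) = periodic d w n := by
  simp [periodic]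

lemma periodic_rotate_one (d e : α) {w : List α} (hw : w ≠ []) :
    periodic d (w.rotate 1) = shift (periodic e w) := by
  have hpos : 0 < w.length := List.length_pos_iff.2 hw
  funext n
  have h1 : n % w.length < (w.rotate 1).length := by
    rw [List.length_rotate]; exact Nat.mod_lt _ hpos
  have h2 : (n + 1) % w.length < w.length := Nat.mod_lt _ hpos
  simp only [periodic, shift, List.length_rotate]
  rw [List.getD_eq_getElem _ _ h1, List.getD_eq_getElem _ _ h2, List.getElem_rotate]
  simp

lemma list_eq_map_range_periodic (d : α) (w : List α) :
    w = (List.range w.length).map (periodic d w) := by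
  apply List.ext_getElem (by simp)
  intro n h1 h2
  simp [periodic_of_lt d h1]

lemma shift_iterate (S : ℕ → α) (n m : ℕ) : shift^[n] S m = S (m + n) := by
  induction n generalizing S with
  | zero => rfl
  | succ n ih => rw [Function.iterate_succ_apply, ih]; simp [shift, Nat.add_assoc]

@[simp] lemma shift_consSeq (x : α) (S : ℕ → α) : shift (consSeq x S) = S := rfl

lemma consSeq_shift (S : ℕ → α) : consSeq (S 0) (shift S) = S := by
  funext n; cases n <;> rfl

end Sequences

/-! ### Combinatorial models of Markov maps -/

section Models

variable {α : Type}

/-- The itinerary of the position `i` under `ν`, with addresses `sy`. -/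
def itin (ν : ℕ → ℕ) (sy : ℕ → α) (i : ℕ) : ℕ → α := fun n => sy (ν^[n] i)

lemma shift_itin (ν : ℕ → ℕ) (sy : ℕ → α) (i : ℕ) :
    shift (itin ν sy i) = itin ν sy (ν i) := rfl

lemma shift_iterate_itin (ν : ℕ → ℕ) (sy : ℕ → α) (i n : ℕ) :
    shift^[n] (itin ν sy i) = itin ν sy (ν^[n] i) := by
  funext m
  rw [shift_iterate, itin, itin, Function.iterate_add_apply]

lemma itin_eq_consSeq (ν : ℕ → ℕ) (sy : ℕ → α) (i : ℕ) :
    itin ν sy i = consSeq (sy i) (itin ν sy (ν i)) := (consSeq_shift _).symm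

lemma iterate_lt {N : ℕ} {ν : ℕ → ℕ} (h : ∀ i < N, ν i < N) {i : ℕ} (hi : i < N) (n : ℕ) :
    ν^[n] i < N := by
  induction n with
  | zero => exact hi
  | succ n ih => rw [Function.iterate_succ_apply']; exact h _ ih

/-- A piecewise monotone map `ν` of `{0, …, N - 1}` with addresses `sy`: turning symbols have at
most one position, and every orbit meets one of them. -/
structure IsModel [LapAlphabet α] (N : ℕ) (ν : ℕ → ℕ) (sy : ℕ → α) : Prop where
  maps : ∀ i < N, ν i < N
  mono : ∀ i j, i < j → j < N →
    sy i = sy j ∨ LapAlphabet.rank (sy i) < LapAlphabet.rank (sy j)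
  lap : ∀ i j, i < j → j < N → sy i = sy j →
    (LapAlphabet.eps (sy i) = 1 ∧ ν i < ν j) ∨ (LapAlphabet.eps (sy i) = -1 ∧ ν j < ν i)
  turn : ∀ i < N, ∃ n, LapAlphabet.eps (sy (ν^[n] i)) = 0

variable [LapAlphabet α] {N : ℕ} {ν : ℕ → ℕ} {sy : ℕ → α}

namespace IsModel

/-- As long as two itineraries agree, both orbits run through the same laps, so the product of signs
records whether their order has been kept or reversed. -/
lemma sign_order (h : IsModel N ν sy) {i j : ℕ} (hij : i < j) (hj : j < N) (m : ℕ)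
    (heq : ∀ n < m, itin ν sy i n = itin ν sy j n) :
    (∏ n ∈ Finset.range m, LapAlphabet.eps (itin ν sy i n) = 1 ∧ ν^[m] i < ν^[m] j) ∨
    (∏ n ∈ Finset.range m, LapAlphabet.eps (itin ν sy i n) = -1 ∧ ν^[m] j < ν^[m] i) := by
  induction m with
  | zero => left; simpa using hij
  | succ m ih =>
    have hm : sy (ν^[m] i) = sy (ν^[m] j) := heq m (by omega)
    have hi' : ν^[m] i < N := iterate_lt h.maps (hij.trans hj) m
    have hj' : ν^[m] j < N := iterate_lt h.maps hj m
    rw [Finset.prod_range_succ, Function.iterate_succ_apply', Function.iterate_succ_apply']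
    have hs : LapAlphabet.eps (itin ν sy i m) = LapAlphabet.eps (sy (ν^[m] i)) := rfl
    rcases ih fun n hn => heq n (by omega) with ⟨h1, h2⟩ | ⟨h1, h2⟩
    · rcases h.lap _ _ h2 hj' hm with ⟨h3, h4⟩ | ⟨h3, h4⟩
      · left; simp [h1, hs, h3, h4]
      · right; simp [h1, hs, h3, h4]
    · rcases h.lap _ _ h2 hi' hm.symm with ⟨h3, h4⟩ | ⟨h3, h4⟩
      · right; simp [h1, hs, hm, h3, h4]
      · left; simp [h1, hs, hm, h3, h4]

lemma itin_lt (h : IsModel N ν sy) {i j : ℕ} (hij : i < j) (hj : j < N) :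
    SeqLT (itin ν sy i) (itin ν sy j) := by
  classical
  -- Equal itineraries would put two distinct positions on the same turning symbol at some time, but
  -- `lap` allows positions to share a symbol only if its sign is 1 or -1.
  have hex : ∃ m, itin ν sy i m ≠ itin ν sy j m := by
    by_contra! hall
    obtain ⟨n, hn⟩ := h.turn i (hij.trans hj)
    have hn' : sy (ν^[n] i) = sy (ν^[n] j) := hall n
    rcases h.sign_order hij hj n fun m _ => hall m with ⟨-, h2⟩ | ⟨-, h2⟩
    · rcases h.lap _ _ h2 (iterate_lt h.maps hj n) hn' with ⟨h3, -⟩ | ⟨h3, -⟩ <;> omega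
    · rcases h.lap _ _ h2 (iterate_lt h.maps (hij.trans hj) n) hn'.symm with ⟨h3, -⟩ | ⟨h3, -⟩ <;>
        rw [← hn'] at h3 <;> omega
  have hne := Nat.find_spec hex
  have heq : ∀ n < Nat.find hex, itin ν sy i n = itin ν sy j n := fun n hn =>
    not_not.1 (Nat.find_min hex hn)
  refine ⟨Nat.find hex, heq, ?_⟩
  rcases h.sign_order hij hj _ heq with ⟨h1, h2⟩ | ⟨h1, h2⟩
  · rw [h1, one_mul, one_mul]
    exact (h.mono _ _ h2 (iterate_lt h.maps hj _)).resolve_left hne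
  · rw [h1, neg_one_mul, neg_one_mul, neg_lt_neg_iff]
    exact (h.mono _ _ h2 (iterate_lt h.maps (hij.trans hj) _)).resolve_left (Ne.symm hne)

lemma itin_lt_iff (h : IsModel N ν sy) {i j : ℕ} (hi : i < N) (hj : j < N) :
    SeqLT (itin ν sy i) (itin ν sy j) ↔ i < j := by
  refine ⟨fun hlt => ?_, fun hij => h.itin_lt hij hj⟩
  rcases lt_trichotomy i j with hij | rfl | hij
  · exact hij
  · exact absurd hlt (SeqLT.irrefl _)
  · exact absurd hlt (h.itin_lt hij hi).asymm

lemma itin_injOn (h : IsModel N ν sy) : Set.InjOn (itin ν sy) (Set.Iio N) := by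
  intro i hi j hj hij
  rcases lt_trichotomy i j with hlt | rfl | hlt
  · exact absurd (hij ▸ h.itin_lt hlt hj) (SeqLT.irrefl _)
  · rfl
  · exact absurd (hij ▸ h.itin_lt hlt hi) (SeqLT.irrefl _)

end IsModel

/-- The model `(N, ν, sy)` realizes the kneading data `D`. -/
structure Realizes (D : KneadingData α) (N : ℕ) (ν : ℕ → ℕ) (sy : ℕ → α) : Prop
    extends IsModel N ν sy where
  start : ∀ cK ∈ D, ∃ t < N, consSeq cK.1 cK.2 = itin ν sy t
  cover : ∀ i < N, ∃ cK ∈ D, ∃ t n, consSeq cK.1 cK.2 = itin ν sy t ∧ i = ν^[n] t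

/-- `t` lies in the interval between `x` and `y`. -/
def Btw (x y t : ℕ) : Prop := (x ≤ t ∧ t < y) ∨ (y ≤ t ∧ t < x)

instance (x y t : ℕ) : Decidable (Btw x y t) := by unfold Btw; infer_instance

/-- The transition matrix of a map `ν` of `{0, …, N - 1}`. -/
def matOf (N : ℕ) (ν : ℕ → ℕ) : SqMat :=
  ⟨N - 1, Matrix.of fun i j => if Btw (ν i) (ν (i + 1)) j then 1 else 0⟩

namespace Realizes

variable {D : KneadingData α}

lemma points_eq (h : Realizes D N ν sy) : points D = itin ν sy '' Set.Iio N := by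
  ext z
  constructor
  · rintro ⟨cK, hcK, n, rfl⟩
    obtain ⟨t, ht, hK⟩ := h.start cK hcK
    exact ⟨ν^[n] t, iterate_lt h.maps ht n, by rw [hK, shift_iterate_itin]⟩
  · rintro ⟨i, hi, rfl⟩
    obtain ⟨cK, hcK, t, n, hK, rfl⟩ := h.cover i hi
    exact ⟨cK, hcK, n, by rw [hK, shift_iterate_itin]⟩

/-- The itinerary map is an order embedding of the positions onto the partition points, so exactly
the `i` smaller positions lie below. -/
lemma pos_itin (h : Realizes D N ν sy) {i : ℕ} (hi : i < N) : pos D (itin ν sy i) = i := by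
  have : {y ∈ points D | SeqLT y (itin ν sy i)} = itin ν sy '' Set.Iio i := by
    rw [h.points_eq]
    ext y
    constructor
    · rintro ⟨⟨j, hj, rfl⟩, hlt⟩
      exact ⟨j, (h.itin_lt_iff hj hi).1 hlt, rfl⟩
    · rintro ⟨j, hj, rfl⟩
      exact ⟨⟨j, lt_trans hj hi, rfl⟩, h.itin_lt hj hi⟩
  rw [pos, this, (h.itin_injOn.mono (Set.Iio_subset_Iio hi.le)).ncard_image]
  simp [Set.ncard_eq_toFinset_card']

lemma ncard_points (h : Realizes D N ν sy) : (points D).ncard = N := by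
  rw [h.points_eq, h.itin_injOn.ncard_image]
  simp [Set.ncard_eq_toFinset_card']

lemma covers_iff (h : Realizes D N ν sy) {i j : ℕ} (hi : i + 1 < N) :
    Covers D i j ↔ Btw (ν i) (ν (i + 1)) j := by
  have key : min (ν i) (ν (i + 1)) ≤ j ∧ j < max (ν i) (ν (i + 1)) ↔ Btw (ν i) (ν (i + 1)) j := by
    unfold Btw; omega
  rw [← key]
  have hp : ∀ x < N, pos D (shift (itin ν sy x)) = ν x := fun x hx => by
    rw [shift_itin, h.pos_itin (h.maps x hx)]
  constructor
  · rintro ⟨z, hz, z', hz', h1, h2, h3⟩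
    rw [h.points_eq] at hz hz'
    obtain ⟨x, hx, rfl⟩ := hz
    obtain ⟨x', hx', rfl⟩ := hz'
    rw [h.pos_itin hx] at h1
    rw [h.pos_itin hx'] at h2
    rw [hp x hx, hp x' hx', h1, h2] at h3
    exact h3
  · intro h3
    have hi' : i < N := by omega
    refine ⟨itin ν sy i, ?_, itin ν sy (i + 1), ?_, h.pos_itin hi', h.pos_itin hi, ?_⟩
    · rw [h.points_eq]; exact ⟨i, hi', rfl⟩
    · rw [h.points_eq]; exact ⟨i + 1, hi, rfl⟩
    · rw [hp _ hi', hp _ hi]; exact h3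

lemma markov_eq (h : Realizes D N ν sy) : markov D = matOf N ν := by
  unfold markov matOf
  rw [h.ncard_points]
  congr 1
  ext i j
  simp only [Matrix.of_apply]
  have := h.covers_iff (i := i) (j := j) (by have := i.2; omega)
  by_cases hb : Btw (ν i) (ν (i + 1)) j
  · rw [if_pos (this.2 hb), if_pos hb]
  · rw [if_neg fun hc => hb (this.1 hc), if_neg hb]

end Realizes

lemma entry_matOf (h : ∀ i < N, ν i < N) (i j : ℕ) :
    entry (matOf N ν) i j = if i + 1 < N ∧ Btw (ν i) (ν (i + 1)) j then 1 else 0 := by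
  unfold entry
  by_cases hi : i + 1 < N
  · have h1 := h i (by omega)
    have h2 := h (i + 1) hi
    by_cases hb : Btw (ν i) (ν (i + 1)) j
    · have : i < (matOf N ν).1 ∧ j < (matOf N ν).1 := by
        unfold Btw at hb; simp only [matOf]; omega
      rw [dif_pos this, if_pos ⟨hi, hb⟩]
      simp [matOf, hb]
    · rw [if_neg fun h => hb h.2]
      split_ifs
      · simp [matOf, hb]
      · rfl
  · rw [if_neg fun h => hi h.1, dif_neg]
    simp only [matOf]; omega

lemma sqMat_ext {A B : SqMat} (h : A.1 = B.1)
    (he : ∀ i < A.1, ∀ j < A.1, entry A i j = entry B i j) : A = B := by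
  obtain ⟨n, A⟩ := A
  obtain ⟨m, B⟩ := B
  obtain rfl : n = m := h
  congr 1
  ext i j
  simpa [entry] using he i i.2 j j.2

/-- Equal transition matrices have equal unordered pairs of images of endpoints. -/
lemma pair_eq_of_matOf_eq {N : ℕ} {ν ν' : ℕ → ℕ} (h : ∀ i < N, ν i < N) (h' : ∀ i < N, ν' i < N)
    (heq : matOf N ν = matOf N ν') {i : ℕ} (hi : i + 1 < N)
    (hne' : ν' i ≠ ν' (i + 1)) :
    (ν i = ν' i ∧ ν (i + 1) = ν' (i + 1)) ∨ (ν i = ν' (i + 1) ∧ ν (i + 1) = ν' i) := by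
  have key : ∀ j, Btw (ν i) (ν (i + 1)) j ↔ Btw (ν' i) (ν' (i + 1)) j := by
    intro j
    have := entry_matOf h i j
    rw [heq, entry_matOf h' i j] at this
    simp only [hi, true_and] at this
    split_ifs at this <;> simp_all
  -- Both rows are indicators of half-open integer intervals; testing the four endpoints and their
  -- predecessors pins the intervals down.
  have k1 := key (ν i)
  have k2 := key (ν (i + 1))
  have k3 := key (ν' i)
  have k4 := key (ν' (i + 1))
  have k5 := key (ν i - 1)
  have k6 := key (ν (i + 1) - 1)
  have k7 := key (ν' i - 1)
  have k8 := key (ν' (i + 1) - 1)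
  unfold Btw at *
  omega

end Models

/-! ### Unimodal, bimodal and trimodal models -/

/-- The symbol of the position `i` if `κ` is the turning point. -/
def usym (κ i : ℕ) : USym := if i < κ then .l else if i = κ then .c else .r

/-- The symbol of the position `i` if `a < b` are the turning points. -/
def bsym (a b i : ℕ) : Sym :=
  if i < a then .L else if i = a then .A else if i < b then .M else if i = b then .B else .R

/-- The symbol of the position `i` if `a < b < c` are the turning points. -/
def tsym (a b c i : ℕ) : Sym :=
  if i < a then .L else if i = a then .A else if i < b then .M else if i = b then .B
  else if i < c then .R else if i = c then .C else .U

lemma usym_eq_c {κ i : ℕ} : usym κ i = .c ↔ i = κ := by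
  unfold usym; split_ifs <;> simp <;> omega

lemma usym_eq_r {κ i : ℕ} : usym κ i = .r ↔ κ < i := by
  unfold usym; split_ifs <;> simp <;> omega

lemma bsym_eq_A {a b i : ℕ} : bsym a b i = .A ↔ i = a := by
  unfold bsym; split_ifs <;> simp <;> omega

lemma bsym_eq_B {a b i : ℕ} (hab : a < b) : bsym a b i = .B ↔ i = b := by
  unfold bsym; split_ifs <;> simp <;> omega

lemma bsym_eq_R {a b i : ℕ} (hab : a < b) : bsym a b i = .R ↔ b < i := by
  unfold bsym; split_ifs <;> simp <;> omega

lemma bsym_eq_L {a b i : ℕ} : bsym a b i = .L ↔ i < a := by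
  unfold bsym; split_ifs <;> simp <;> omega

lemma tsym_eq_B {a b c i : ℕ} (hab : a < b) : tsym a b c i = .B ↔ i = b := by
  unfold tsym; split_ifs <;> simp <;> omega

/-- A unimodal map of `{0, …, k - 1}` with turning point `κ`, whose orbit is everything. -/
structure UnimodalModel (k κ : ℕ) (μ : ℕ → ℕ) : Prop where
  lt : κ < k
  maps : ∀ i < k, μ i < k
  left : ∀ i j, i < j → j ≤ κ → μ i < μ j
  right : ∀ i j, κ ≤ i → i < j → j < k → μ j < μ i
  turn : ∀ i < k, ∃ n, μ^[n] i = κ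
  cover : ∀ i < k, ∃ n, i = μ^[n] κ

/-- A bimodal map of `{0, …, N - 1}` with turning points `a`, `b`, whose orbits are everything. -/
structure BimodalModel (N a b : ℕ) (ν : ℕ → ℕ) : Prop where
  ab : a < b
  bN : b < N
  maps : ∀ i < N, ν i < N
  left : ∀ i j, i < j → j ≤ a → ν i < ν j
  middle : ∀ i j, a ≤ i → i < j → j ≤ b → ν j < ν i
  right : ∀ i j, b ≤ i → i < j → j < N → ν i < ν j
  turn : ∀ i < N, ∃ n, ν^[n] i = a ∨ ν^[n] i = b
  cover : ∀ i < N, ∃ n, i = ν^[n] a ∨ i = ν^[n] b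

/-- A trimodal map of `{0, …, N - 1}` with turning points `a`, `b`, `c`, whose orbits are
everything, with equal values at the maxima. -/
structure TrimodalModel (N a b c : ℕ) (ν : ℕ → ℕ) : Prop where
  ab : a < b
  bc : b < c
  cN : c < N
  maps : ∀ i < N, ν i < N
  lap₁ : ∀ i j, i < j → j ≤ a → ν i < ν j
  lap₂ : ∀ i j, a ≤ i → i < j → j ≤ b → ν j < ν i
  lap₃ : ∀ i j, b ≤ i → i < j → j ≤ c → ν i < ν j
  lap₄ : ∀ i j, c ≤ i → i < j → j < N → ν j < ν i
  top : ν a = ν c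
  turn : ∀ i < N, ∃ n, ν^[n] i = a ∨ ν^[n] i = b ∨ ν^[n] i = c
  cover : ∀ i < N, ∃ n, i = ν^[n] a ∨ i = ν^[n] b ∨ i = ν^[n] c

lemma UnimodalModel.realizes {k κ : ℕ} {μ : ℕ → ℕ} (h : UnimodalModel k κ μ) {K : ℕ → USym}
    (hK : consSeq .c K = itin μ (usym κ) κ) : Realizes [(.c, K)] k μ (usym κ) where
  maps := h.maps
  mono i j hij hj := by
    unfold usym
    split_ifs <;> first | omega | simp [LapAlphabet.rank]
  lap i j hij hj heq := by
    have h1 := h.left i j hij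
    have h2 := h.right i j
    unfold usym at heq ⊢
    split_ifs at heq ⊢ <;> first | omega | (simp [LapAlphabet.eps]; omega)
  turn i hi := by
    obtain ⟨n, hn⟩ := h.turn i hi
    exact ⟨n, by rw [hn, usym_eq_c.2 rfl]; rfl⟩
  start := by simpa using ⟨κ, h.lt, hK⟩
  cover i hi := by
    obtain ⟨n, hn⟩ := h.cover i hi
    exact ⟨_, List.mem_singleton_self _, κ, n, hK, hn⟩

lemma BimodalModel.realizes {N a b : ℕ} {ν : ℕ → ℕ} (h : BimodalModel N a b ν) {K K' : ℕ → Sym}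
    (hK : consSeq .A K = itin ν (bsym a b) a) (hK' : consSeq .B K' = itin ν (bsym a b) b) :
    Realizes [(.A, K), (.B, K')] N ν (bsym a b) where
  maps := h.maps
  mono i j hij hj := by
    unfold bsym
    split_ifs <;> first | omega | simp [LapAlphabet.rank]
  lap i j hij hj heq := by
    have h1 := h.left i j hij
    have h2 := h.middle i j
    have h3 := h.right i j
    have h4 := h.ab
    unfold bsym at heq ⊢
    split_ifs at heq ⊢ <;> first | omega | (simp [LapAlphabet.eps]; omega)
  turn i hi := by
    obtain ⟨n, hn | hn⟩ := h.turn i hi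
    · exact ⟨n, by rw [hn, bsym_eq_A.2 rfl]; rfl⟩
    · exact ⟨n, by rw [hn, (bsym_eq_B h.ab).2 rfl]; rfl⟩
  start := by
    have := h.ab
    have := h.bN
    simp only [List.mem_cons, List.not_mem_nil, or_false]
    rintro cK (rfl | rfl)
    · exact ⟨a, by omega, hK⟩
    · exact ⟨b, by omega, hK'⟩
  cover i hi := by
    obtain ⟨n, hn | hn⟩ := h.cover i hi
    · exact ⟨_, List.mem_cons_self, a, n, hK, hn⟩
    · exact ⟨_, List.mem_cons_of_mem _ List.mem_cons_self, b, n, hK', hn⟩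

lemma tsym_cases (a b c i : ℕ) :
    (i < a ∧ tsym a b c i = .L) ∨ (i = a ∧ tsym a b c i = .A) ∨
    (a < i ∧ i < b ∧ tsym a b c i = .M) ∨ (i = b ∧ tsym a b c i = .B) ∨
    (b < i ∧ i < c ∧ tsym a b c i = .R) ∨ (i = c ∧ tsym a b c i = .C) ∨
    (c < i ∧ tsym a b c i = .U) := by
  unfold tsym; split_ifs <;> simp <;> omega

lemma TrimodalModel.realizes {N a b c : ℕ} {ν : ℕ → ℕ} (h : TrimodalModel N a b c ν)
    {K K' : ℕ → Sym} (hA : consSeq .A K = itin ν (tsym a b c) a)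
    (hB : consSeq .B K' = itin ν (tsym a b c) b) (hC : consSeq .C K = itin ν (tsym a b c) c) :
    Realizes (trimodal K K') N ν (tsym a b c) where
  maps := h.maps
  mono i j hij hj := by
    rcases tsym_cases a b c i with
      ⟨_, e⟩ | ⟨_, e⟩ | ⟨_, _, e⟩ | ⟨_, e⟩ | ⟨_, _, e⟩ | ⟨_, e⟩ | ⟨_, e⟩ <;>
    rcases tsym_cases a b c j with
      ⟨_, e'⟩ | ⟨_, e'⟩ | ⟨_, _, e'⟩ | ⟨_, e'⟩ | ⟨_, _, e'⟩ | ⟨_, e'⟩ | ⟨_, e'⟩ <;>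
    rw [e, e'] <;>
    first | (left; rfl) | (right; decide) | (exfalso; have := h.ab; have := h.bc; omega)
  lap i j hij hj heq := by
    have h4 := h.ab
    have h5 := h.bc
    rcases tsym_cases a b c i with
        ⟨hi, e⟩ | ⟨hi, e⟩ | ⟨hi, hi', e⟩ | ⟨hi, e⟩ | ⟨hi, hi', e⟩ | ⟨hi, e⟩ | ⟨hi, e⟩ <;>
      rw [e] at heq ⊢ <;>
      rcases tsym_cases a b c j with
        ⟨hj, e'⟩ | ⟨hj, e'⟩ | ⟨hj, hj', e'⟩ | ⟨hj, e'⟩ | ⟨hj, hj', e'⟩ | ⟨hj, e'⟩ | ⟨hj, e'⟩ <;>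
      rw [e'] at heq <;> cases heq
    · exact .inl ⟨rfl, h.lap₁ i j hij hj.le⟩
    · omega
    · exact .inr ⟨rfl, h.lap₂ i j hi.le hij hj'.le⟩
    · omega
    · exact .inl ⟨rfl, h.lap₃ i j hi.le hij hj'.le⟩
    · omega
    · exact .inr ⟨rfl, h.lap₄ i j hi.le hij (by assumption)⟩
  turn i hi := by
    have h4 := h.ab
    have h5 := h.bc
    obtain ⟨n, hn⟩ := h.turn i hi
    refine ⟨n, ?_⟩
    unfold tsym
    split_ifs <;> first | omega | rfl
  start := by
    have := h.ab
    have := h.bc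
    have := h.cN
    simp only [trimodal, List.mem_cons, List.not_mem_nil, or_false]
    rintro cK (rfl | rfl | rfl)
    · exact ⟨a, by omega, hA⟩
    · exact ⟨b, by omega, hB⟩
    · exact ⟨c, by omega, hC⟩
  cover i hi := by
    obtain ⟨n, hn | hn | hn⟩ := h.cover i hi
    · exact ⟨(.A, K), by simp [trimodal], a, n, hA, hn⟩
    · exact ⟨(.B, K'), by simp [trimodal], b, n, hB, hn⟩
    · exact ⟨(.C, K), by simp [trimodal], c, n, hC, hn⟩

/-! ### Enumerating finite invariant sets -/

/-- Numbering the set in increasing order transports `f` to a map of indices. Values of `e` and `ν`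
beyond the cardinality are irrelevant. -/
lemma exists_enumeration {R : Type*} [LinearOrder R] (E : Finset R) (hE : E.Nonempty) (f : R → R)
    (hf : ∀ x ∈ E, f x ∈ E) :
    ∃ (e : ℕ → R) (ν : ℕ → ℕ),
      (∀ i < E.card, e i ∈ E) ∧ (∀ x ∈ E, ∃ i < E.card, e i = x) ∧
      (∀ i < E.card, ∀ j < E.card, e i < e j ↔ i < j) ∧
      (∀ i < E.card, ν i < E.card) ∧ (∀ i < E.card, ∀ n, e (ν^[n] i) = f^[n] (e i)) := by
  obtain ⟨x₀, hx₀⟩ := hE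
  set o := E.orderEmbOfFin rfl
  have hmem : ∀ i, o i ∈ E := E.orderEmbOfFin_mem rfl
  have hsurj : ∀ x ∈ E, ∃ i, o i = x := fun x hx => by
    have : x ∈ Set.range o := by rw [E.range_orderEmbOfFin rfl]; exact hx
    exact this
  let e : ℕ → R := fun i => if h : i < E.card then o ⟨i, h⟩ else x₀
  have he : ∀ i (h : i < E.card), e i = o ⟨i, h⟩ := fun i h => dif_pos h
  have hex : ∀ i, ∃ j, i < E.card → j < E.card ∧ e j = f (e i) := by
    intro i
    by_cases hi : i < E.card
    · obtain ⟨j, hj⟩ := hsurj (f (e i)) (hf _ (by rw [he i hi]; exact hmem _))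
      exact ⟨j, fun _ => ⟨j.2, by rw [he _ j.2]; exact hj⟩⟩
    · exact ⟨0, fun h => absurd h hi⟩
  choose ν hν using hex
  refine ⟨e, ν, fun i hi => by rw [he i hi]; exact hmem _, fun x hx => ?_, fun i hi j hj => ?_,
    fun i hi => (hν i hi).1, fun i hi n => ?_⟩
  · obtain ⟨j, hj⟩ := hsurj x hx
    exact ⟨j, j.2, by rw [he _ j.2]; exact hj⟩
  · rw [he i hi, he j hj, o.lt_iff_lt]
    simp
  · induction n with
    | zero => rfl
    | succ n ih =>
      rw [Function.iterate_succ_apply', Function.iterate_succ_apply',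
        (hν _ (iterate_lt (fun i hi => (hν i hi).1) hi n)).2, ih]

/-! ### Models of kneading data of interval maps -/

/-- All turning points first return to the turning set after exactly `p` steps, permuted by `τ`;
hence the first `p` points of their orbits are distinct and form an invariant set. -/
lemma exists_orbit_finset {R β : Type*} [LinearOrder R] [Fintype β] {f : R → R} {c : β → R}
    {τ : β → β} {p : ℕ} (hp : 0 < p) (hc : Function.Injective c) (hτ : Function.Injective τ)
    (hper : ∀ b, f^[p] (c b) = c (τ b))
    (hret : ∀ b b' n, 0 < n → n < p → f^[n] (c b) ≠ c b') :
    ∃ E : Finset R, E.card = p * Fintype.card β ∧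
      (∀ x, x ∈ E ↔ ∃ n < p, ∃ b, x = f^[n] (c b)) ∧ ∀ x ∈ E, f x ∈ E := by
  classical
  -- Push the equality forward by `p - m` steps: the right side becomes a turning point, while the
  -- left side has made only `p - m + n` steps, too few to return unless `n = m`.
  have hinj : ∀ n < p, ∀ m < p, n ≤ m → ∀ b b', f^[n] (c b) = f^[m] (c b') → n = m ∧ b = b' := by
    intro n hn m hm hnm b b' h
    have h1 : f^[p - m + n] (c b) = c (τ b') := by
      rw [Function.iterate_add_apply, h, ← Function.iterate_add_apply, Nat.sub_add_cancel hm.le,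
        hper]
    rcases hnm.lt_or_eq with hlt | rfl
    · exact absurd h1 (hret _ _ _ (by omega) (by omega))
    · rw [Nat.sub_add_cancel hm.le, hper] at h1
      exact ⟨rfl, hτ (hc h1)⟩
  have hmem : ∀ x, x ∈ (Finset.range p ×ˢ (Finset.univ : Finset β)).image
      (fun q => f^[q.1] (c q.2)) ↔ ∃ n < p, ∃ b, x = f^[n] (c b) := by
    intro x
    simp only [Finset.mem_image, Finset.mem_product, Finset.mem_range, Finset.mem_univ, and_true,
      Prod.exists]
    constructor
    · rintro ⟨n, b, hn, rfl⟩; exact ⟨n, hn, b, rfl⟩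
    · rintro ⟨n, hn, b, rfl⟩; exact ⟨n, b, hn, rfl⟩
  refine ⟨_, ?_, hmem, ?_⟩
  · rw [Finset.card_image_of_injOn]
    · simp
    · rintro ⟨n, b⟩ hn ⟨m, b'⟩ hm h
      simp only [Finset.coe_product, Set.mem_prod, Finset.coe_range, Set.mem_Iio] at hn hm
      rcases le_total n m with hnm | hnm
      · obtain ⟨rfl, rfl⟩ := hinj n hn.1 m hm.1 hnm b b' h; rfl
      · obtain ⟨rfl, rfl⟩ := hinj m hm.1 n hn.1 hnm b' b h.symm; rfl
  · intro x hx
    rw [hmem] at hx ⊢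
    obtain ⟨n, hn, b, rfl⟩ := hx
    rcases Nat.lt_or_ge (n + 1) p with h | h
    · exact ⟨n + 1, h, b, (Function.iterate_succ_apply' f n _).symm⟩
    · obtain rfl : n + 1 = p := by omega
      exact ⟨0, hp, τ b, by rw [← Function.iterate_succ_apply' f n, hper]; rfl⟩

/-- The order of the positions models the word `X`. -/
structure IsUModel (X : List USym) (κ : ℕ) (μ : ℕ → ℕ) : Prop
    extends UnimodalModel X.length κ μ where
  two_le : 2 ≤ X.length
  period : μ^[X.length] κ = κ
  ne_c : ∀ n, n + 1 < X.length → periodic .c X n ≠ .c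
  itin_eq : consSeq .c (periodic .c X) = itin μ (usym κ) κ

lemma addressU_eq_c {c x : ℝ} : addressU c x = .c ↔ x = c := by
  unfold addressU; split_ifs with h1 h2 <;> simp
  · exact h1.ne
  · exact h2
  · exact h2

/-- The letter `c` occurs only at the end of `X`, so the turning orbit has exactly `k` points;
numbered from left to right they inherit monotonicity and addresses from the interval map. -/
lemma IsUnimodalWord.exists_model {X : List USym} (hX : IsUnimodalWord X) :
    ∃ κ μ, IsUModel X κ μ := by
  obtain ⟨⟨w, hw0, hw, rfl⟩, f, c₀, c₁, c₂, hf, hadr⟩ := hX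
  have hw0 : 0 < w.length := List.length_pos_iff.2 hw0
  set X := w ++ [USym.c] with hXdef
  have hlen : X.length = w.length + 1 := by simp [hXdef]
  have hper : f^[X.length] c₁ = c₁ := by
    have := hadr w.length
    rw [periodic_of_lt _ (by omega)] at this
    rw [hlen, ← addressU_eq_c (c := c₁), this]
    simp [hXdef]
  have hne : ∀ n, n + 1 < X.length → periodic .c X n ≠ .c := by
    intro n hn h
    have hn' : n < w.length := by omega
    rw [periodic_of_lt _ (by omega), List.getElem_append_left hn'] at h
    exact hw _ (List.getElem_mem hn') h
  have hret : ∀ n, 0 < n → n < X.length → f^[n] c₁ ≠ c₁ := by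
    intro n h0 hn h
    obtain ⟨m, rfl⟩ : ∃ m, n = m + 1 := ⟨n - 1, by omega⟩
    have := hadr m
    rw [h, addressU_eq_c.2 rfl] at this
    exact hne m hn this.symm
  obtain ⟨E, hcard, hmem, hmaps⟩ := exists_orbit_finset (β := Unit) (c := fun _ => c₁) (τ := id)
    (p := X.length) (by omega) (fun _ _ _ => rfl) Function.injective_id (fun _ => hper)
    (fun _ _ => hret)
  rw [Fintype.card_unit, mul_one] at hcard
  have hc₁ : c₁ ∈ E := (hmem c₁).2 ⟨0, by omega, (), rfl⟩
  obtain ⟨e, ν, heE, hsurj, hlt, hν, hiter⟩ := exists_enumeration E ⟨c₁, hc₁⟩ f hmaps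
  rw [hcard] at heE hsurj hlt hν hiter
  obtain ⟨κ, hκ, heκ⟩ := hsurj c₁ hc₁
  have hinj : ∀ i < X.length, ∀ j < X.length, e i = e j → i = j := by
    intro i hi j hj h
    have h1 := hlt i hi j hj
    have h2 := hlt j hj i hi
    rw [h] at h1 h2
    simp only [lt_self_iff_false, false_iff] at h1 h2
    omega
  have hI : ∀ x ∈ E, x ∈ Set.Icc c₀ c₂ := by
    intro x hx
    obtain ⟨n, -, -, rfl⟩ := (hmem x).1 hx
    exact hf.mapsTo.iterate n ⟨hf.lt₀₁.le, hf.lt₁₂.le⟩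
  have hle : ∀ i < X.length, ∀ j < X.length, i ≤ j → e i ≤ e j := by
    intro i hi j hj h
    rw [← not_lt, hlt j hj i hi]; omega
  have h1 : ∀ i < X.length, e (ν i) = f (e i) := fun i hi => hiter i hi 1
  have hsym : ∀ i < X.length, usym κ i = addressU c₁ (e i) := by
    intro i hi
    have h1 := hlt i hi κ hκ
    have h2 : e i = c₁ ↔ i = κ := ⟨fun h => hinj i hi κ hκ (h.trans heκ.symm), fun h => h ▸ heκ⟩
    rw [heκ] at h1
    simp only [usym, addressU, h1, h2]
  refine ⟨κ, ν, ⟨⟨hκ, hν, ?_, ?_, ?_, ?_⟩, by omega,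
    hinj _ (iterate_lt hν hκ _) _ hκ (by rw [hiter κ hκ, heκ, hper]), hne, ?_⟩⟩
  · intro i j hij hj
    have hj' : j < X.length := by omega
    have hi' : i < X.length := by omega
    rw [← hlt _ (hν i hi') _ (hν j hj'), h1 i hi', h1 j hj']
    exact hf.left ⟨(hI _ (heE i hi')).1, heκ ▸ hle i hi' κ hκ (by omega)⟩
      ⟨(hI _ (heE j hj')).1, heκ ▸ hle j hj' κ hκ (by omega)⟩ ((hlt i hi' j hj').2 hij)
  · intro i j hi hij hj'
    have hi' : i < X.length := by omega
    rw [← hlt _ (hν j hj') _ (hν i hi'), h1 i hi', h1 j hj']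
    exact hf.right ⟨heκ ▸ hle κ hκ i hi' (by omega), (hI _ (heE i hi')).2⟩
      ⟨heκ ▸ hle κ hκ j hj' (by omega), (hI _ (heE j hj')).2⟩ ((hlt i hi' j hj').2 hij)
  · intro i hi
    obtain ⟨n, hn, -, h⟩ := (hmem _).1 (heE i hi)
    refine ⟨X.length - n, hinj _ (iterate_lt hν hi _) _ hκ ?_⟩
    rw [hiter i hi, h, ← Function.iterate_add_apply, Nat.sub_add_cancel hn.le, hper, heκ]
  · intro i hi
    obtain ⟨n, hn, -, h⟩ := (hmem _).1 (heE i hi)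
    refine ⟨n, hinj _ hi _ (iterate_lt hν hκ _) ?_⟩
    rw [hiter κ hκ, h, heκ]
  · funext n
    rw [itin, hsym _ (iterate_lt hν hκ _), hiter κ hκ, heκ]
    cases n with
    | zero => exact (addressU_eq_c.2 rfl).symm
    | succ n => exact (hadr n).symm

lemma conj_lap {x : Sym} (hx : x = .L ∨ x = .M ∨ x = .R) :
    conj x = .L ∨ conj x = .M ∨ conj x = .R := by
  rcases hx with rfl | rfl | rfl <;> simp [conj]

lemma bar_lap {P : List Sym} (hP : ∀ x ∈ P, x = .L ∨ x = .M ∨ x = .R) :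
    ∀ x ∈ bar P, x = .L ∨ x = .M ∨ x = .R := by
  intro x hx
  obtain ⟨y, hy, rfl⟩ := List.mem_map.1 hx
  exact conj_lap (hP y hy)

@[simp] lemma length_bar (P : List Sym) : (bar P).length = P.length := List.length_map _

/-- Are both turning points on one orbit? -/
def SymData.isDoubly : SymData → Bool
  | .pair _ => false
  | .doubly _ => true

lemma SymData.seqA_of_lt (V : SymData) {n : ℕ} (hn : n < V.word.length) :
    V.blocks.seqA n = V.word[n] := by
  cases V with
  | pair P =>
    simp only [word] at hn
    simp only [blocks, BlockData.seqA, word]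
    rw [periodic_of_lt _ (by simp; omega), List.getElem_append_left hn]
  | doubly P =>
    simp only [word] at hn
    simp only [blocks, BlockData.seqA, word, List.append_assoc]
    rw [periodic_of_lt _ (by simp; omega), List.getElem_append_left hn]

lemma SymData.seqA_length (V : SymData) :
    V.blocks.seqA V.word.length = if V.isDoubly then .B else .A := by
  cases V with
  | pair P =>
    simp only [blocks, BlockData.seqA, word]
    rw [periodic_of_lt _ (by simp)]
    simp [isDoubly]
  | doubly P =>
    simp only [blocks, BlockData.seqA, word, List.append_assoc]
    rw [periodic_of_lt _ (by simp)]
    simp [isDoubly]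

lemma idxOf_B {P : List Sym} (hP : ∀ x ∈ P, x = .L ∨ x = .M ∨ x = .R) (Q : List Sym) :
    (P ++ [Sym.B] ++ Q).idxOf Sym.B = P.length := by
  have : Sym.B ∉ P := fun h => by simpa using hP _ h
  rw [List.append_assoc, List.idxOf_append_of_notMem this]
  simp

lemma SymData.seqB_of_lt (V : SymData) (hV : ∀ x ∈ V.word, x = .L ∨ x = .M ∨ x = .R) {n : ℕ}
    (hn : n < V.word.length) : V.blocks.seqB n = conj V.word[n] := by
  cases V with
  | pair P =>
    simp only [word] at hn
    simp only [blocks, BlockData.seqB, word]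
    rw [periodic_of_lt _ (by simp; omega), List.getElem_append_left (by simpa using hn)]
    simp [bar]
  | doubly P =>
    simp only [word] at hn hV
    simp only [blocks, BlockData.seqB, word]
    rw [List.append_assoc _ (bar P), idxOf_B hV, shift_iterate, periodic_of_lt _ (by simp; omega),
      List.getElem_append_right (by simp), List.getElem_append_left (by simp; omega)]
    simp [bar]

lemma SymData.seqB_length (V : SymData) (hV : ∀ x ∈ V.word, x = .L ∨ x = .M ∨ x = .R) :
    V.blocks.seqB V.word.length = if V.isDoubly then .A else .B := by
  cases V with
  | pair P =>
    simp only [blocks, BlockData.seqB, word]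
    rw [periodic_of_lt _ (by simp), List.getElem_append_right (by simp)]
    simp [isDoubly]
  | doubly P =>
    simp only [word] at hV
    simp only [blocks, BlockData.seqB, word]
    rw [List.append_assoc _ (bar P), idxOf_B hV, shift_iterate, periodic_of_lt _ (by simp),
      List.getElem_append_right (by simp), List.getElem_append_right (by simp)]
    simp [isDoubly]

/-- The order of the positions models the symmetric data `V`. -/
structure IsBModel (V : SymData) (a b : ℕ) (ν : ℕ → ℕ) : Prop
    extends BimodalModel (2 * V.p) a b ν where
  lap_word : ∀ x ∈ V.word, x = .L ∨ x = .M ∨ x = .R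
  itinA : consSeq .A V.blocks.seqA = itin ν (bsym a b) a
  itinB : consSeq .B V.blocks.seqB = itin ν (bsym a b) b

lemma addressB_eq_A {c d x : ℝ} : addressB c d x = .A ↔ x = c := by
  unfold addressB; split_ifs with h1 h2 <;> simp
  · exact h1.ne
  all_goals exact h2

lemma addressB_eq_B {c d x : ℝ} (hcd : c < d) : addressB c d x = .B ↔ x = d := by
  unfold addressB; split_ifs with h1 h2 h3 h4 <;> simp
  · exact (h1.trans hcd).ne
  · rw [h2]; exact hcd.ne
  · exact h3.ne
  all_goals exact h4

/-- No letter of `P` is a turning symbol, so both turning orbits first meet a turning point after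
`p` steps: the same point for a pair, the other one for a doubly stable orbit. This gives 2p
distinct points. -/
lemma SymData.InD.exists_model {V : SymData} (hV : V.InD) : ∃ a b ν, IsBModel V a b ν := by
  obtain ⟨hlap, f, c₀, c₁, c₂, c₃, hf, hadA, hadB⟩ := hV
  have h12 := hf.lt₁₂
  let c : Bool → ℝ := fun t => if t then c₂ else c₁
  have hc : Function.Injective c := by
    intro s t h
    cases s <;> cases t <;> simp [c, h12.ne, h12.ne'] at h ⊢
  have hper : ∀ t, f^[V.p] (c t) = c (xor t V.isDoubly) := by
    have hA := hadA V.word.length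
    have hB := hadB V.word.length
    rw [V.seqA_length] at hA
    rw [V.seqB_length hlap] at hB
    intro t
    cases hd : V.isDoubly <;> rw [hd] at hA hB <;> cases t <;>
      simp only [Bool.false_eq_true, if_true, if_false, addressB_eq_A,
        addressB_eq_B h12] at hA hB <;>
      simp [c, p, hA, hB]
  have hret : ∀ t t' n, 0 < n → n < V.p → f^[n] (c t) ≠ c t' := by
    intro t t' n h0 hn h
    obtain ⟨m, rfl⟩ : ∃ m, n = m + 1 := ⟨n - 1, by omega⟩
    have hm : m < V.word.length := by unfold SymData.p at hn; omega
    have hx := hlap _ (List.getElem_mem hm)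
    have hx' := conj_lap hx
    have hA := hadA m
    have hB := hadB m
    rw [V.seqA_of_lt hm] at hA
    rw [V.seqB_of_lt hlap hm] at hB
    have : addressB c₁ c₂ (c t') = .A ∨ addressB c₁ c₂ (c t') = .B := by
      cases t' <;> simp [c, addressB_eq_A, addressB_eq_B h12]
    rw [← h] at this
    cases t
    · simp only [c, Bool.false_eq_true, if_false, hA] at this
      rcases this with h | h <;> rw [h] at hx <;> simp at hx
    · simp only [c, if_true, hB] at this
      rcases this with h | h <;> rw [h] at hx' <;> simp at hx'
  have hp0 : 0 < V.p := Nat.succ_pos _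
  obtain ⟨E, hcard, hmem, hmaps⟩ := exists_orbit_finset hp0 hc
    (τ := fun t => xor t V.isDoubly) (fun s t h => by simpa using h) hper hret
  rw [Fintype.card_bool, mul_comm] at hcard
  have hcE : ∀ t, c t ∈ E := fun t => (hmem _).2 ⟨0, hp0, t, rfl⟩
  obtain ⟨e, ν, heE, hsurj, hlt, hν, hiter⟩ := exists_enumeration E ⟨_, hcE true⟩ f hmaps
  rw [hcard] at heE hsurj hlt hν hiter
  set N := 2 * V.p with hN
  obtain ⟨a, ha, hea⟩ := hsurj c₁ (hcE false)
  obtain ⟨b, hb, heb⟩ := hsurj c₂ (hcE true)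
  have hinj : ∀ i < N, ∀ j < N, e i = e j → i = j := by
    intro i hi j hj h
    have h1 := hlt i hi j hj
    have h2 := hlt j hj i hi
    rw [h] at h1 h2
    simp only [lt_self_iff_false, false_iff] at h1 h2
    omega
  have hab : a < b := by rw [← hlt a ha b hb, hea, heb]; exact h12
  have hI : ∀ x ∈ E, x ∈ Set.Icc c₀ c₃ := by
    intro x hx
    obtain ⟨n, -, t, rfl⟩ := (hmem x).1 hx
    refine hf.mapsTo.iterate n ?_
    have h01 := hf.lt₀₁
    have h23 := hf.lt₂₃
    cases t
    · exact ⟨h01.le, (h12.trans h23).le⟩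
    · exact ⟨(h01.trans h12).le, h23.le⟩
  have hle : ∀ i < N, ∀ j < N, i ≤ j → e i ≤ e j := by
    intro i hi j hj h
    rw [← not_lt, hlt j hj i hi]; omega
  have h1 : ∀ i < N, e (ν i) = f (e i) := fun i hi => hiter i hi 1
  have hsym : ∀ i < N, bsym a b i = addressB c₁ c₂ (e i) := by
    intro i hi
    have h1 := hlt i hi a ha
    have h2 : e i = c₁ ↔ i = a := ⟨fun h => hinj i hi a ha (h.trans hea.symm), fun h => h ▸ hea⟩
    have h3 := hlt i hi b hb
    have h4 : e i = c₂ ↔ i = b := ⟨fun h => hinj i hi b hb (h.trans heb.symm), fun h => h ▸ heb⟩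
    rw [hea] at h1
    rw [heb] at h3
    simp only [bsym, addressB, h1, h2, h3, h4]
  refine ⟨a, b, ν, ⟨⟨hab, hb, hν, ?_, ?_, ?_, ?_, ?_⟩, hlap, ?_, ?_⟩⟩
  · intro i j hij hj
    have hj' : j < N := by omega
    have hi' : i < N := by omega
    rw [← hlt _ (hν i hi') _ (hν j hj'), h1 i hi', h1 j hj']
    exact hf.left ⟨(hI _ (heE i hi')).1, hea ▸ hle i hi' a ha (by omega)⟩
      ⟨(hI _ (heE j hj')).1, hea ▸ hle j hj' a ha (by omega)⟩ ((hlt i hi' j hj').2 hij)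
  · intro i j hi hij hj
    have hj' : j < N := by omega
    have hi' : i < N := by omega
    rw [← hlt _ (hν j hj') _ (hν i hi'), h1 i hi', h1 j hj']
    exact hf.middle ⟨hea ▸ hle a ha i hi' (by omega), heb ▸ hle i hi' b hb (by omega)⟩
      ⟨hea ▸ hle a ha j hj' (by omega), heb ▸ hle j hj' b hb (by omega)⟩ ((hlt i hi' j hj').2 hij)
  · intro i j hi hij hj'
    have hi' : i < N := by omega
    rw [← hlt _ (hν i hi') _ (hν j hj'), h1 i hi', h1 j hj']
    exact hf.right ⟨heb ▸ hle b hb i hi' (by omega), (hI _ (heE i hi')).2⟩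
      ⟨heb ▸ hle b hb j hj' (by omega), (hI _ (heE j hj')).2⟩ ((hlt i hi' j hj').2 hij)
  · intro i hi
    obtain ⟨n, hn, t, h⟩ := (hmem _).1 (heE i hi)
    have hend : e (ν^[V.p - n] i) = c (xor t V.isDoubly) := by
      rw [hiter i hi, h, ← Function.iterate_add_apply, Nat.sub_add_cancel hn.le, hper]
    refine ⟨V.p - n, ?_⟩
    cases hx : xor t V.isDoubly <;> rw [hx] at hend
    · exact .inl (hinj _ (iterate_lt hν hi _) _ ha (by rw [hend, hea]; rfl))
    · exact .inr (hinj _ (iterate_lt hν hi _) _ hb (by rw [hend, heb]; rfl))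
  · intro i hi
    obtain ⟨n, hn, t, h⟩ := (hmem _).1 (heE i hi)
    refine ⟨n, ?_⟩
    cases t
    · exact .inl (hinj _ hi _ (iterate_lt hν ha _) (by rw [hiter a ha, h, hea]; rfl))
    · exact .inr (hinj _ hi _ (iterate_lt hν hb _) (by rw [hiter b hb, h, heb]; rfl))
  · funext n
    rw [itin, hsym _ (iterate_lt hν ha _), hiter a ha, hea]
    cases n with
    | zero => exact (addressB_eq_A.2 rfl).symm
    | succ n => exact (hadA n).symm
  · funext n
    rw [itin, hsym _ (iterate_lt hν hb _), hiter b hb, heb]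
    cases n with
    | zero => exact ((addressB_eq_B h12).2 rfl).symm
    | succ n => exact (hadB n).symm

/-! ### Extremal values of unimodal models -/

namespace UnimodalModel

variable {k κ : ℕ} {μ : ℕ → ℕ}

lemma surj (h : UnimodalModel k κ μ) {y : ℕ} (hy : y < k) : ∃ x < k, μ x = y := by
  obtain ⟨n, rfl⟩ := h.cover y hy
  cases n with
  | zero =>
    obtain ⟨n, hn⟩ := h.turn (μ κ) (h.maps κ h.lt)
    exact ⟨μ^[n] κ, iterate_lt h.maps h.lt n, by
      rwa [← Function.iterate_succ_apply' μ n κ, Function.iterate_succ_apply]⟩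
  | succ n => exact ⟨μ^[n] κ, iterate_lt h.maps h.lt n, (Function.iterate_succ_apply' μ n κ).symm⟩

/-- `μ` is onto, and its largest value can only be taken at the maximum. -/
lemma map_turn (h : UnimodalModel k κ μ) : μ κ = k - 1 := by
  have hκ := h.lt
  have h1 := h.maps κ hκ
  obtain ⟨x, hx, hμ⟩ := h.surj (y := k - 1) (by omega)
  rcases lt_trichotomy x κ with hlt | rfl | hlt
  · have := h.left x κ hlt le_rfl; omega
  · exact hμ
  · have := h.right κ x le_rfl hlt hx; omega

lemma turn_lt (h : UnimodalModel k κ μ) (hk : 2 ≤ k) : κ < k - 1 := by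
  have hκ := h.lt
  by_contra hlt
  have hfix : μ κ = κ := by rw [h.map_turn]; omega
  obtain ⟨n, hn⟩ := h.cover 0 (by omega)
  rw [Function.iterate_fixed hfix] at hn
  omega

/-- The value 0 is taken at one of the two ends. At the left end it would make 0 a fixed point,
whose orbit must meet `κ`; then `κ = 0` and `μ κ = 0`, against `map_turn`. -/
lemma map_last (h : UnimodalModel k κ μ) (hk : 2 ≤ k) : μ (k - 1) = 0 := by
  have hκ := h.turn_lt hk
  obtain ⟨x, hx, hμ⟩ := h.surj (y := 0) (by omega)
  rcases le_total x κ with hle | hle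
  · exfalso
    rcases Nat.eq_zero_or_pos x with rfl | hpos
    · obtain ⟨n, hn⟩ := h.turn 0 hx
      rw [Function.iterate_fixed hμ] at hn
      have := h.map_turn
      rw [← hn, hμ] at this
      omega
    · have := h.left 0 x hpos hle; omega
  · rcases Nat.lt_or_ge x (k - 1) with hlt | hge
    · have := h.right x (k - 1) hle hlt (by omega); omega
    · rwa [show k - 1 = x by omega]

/-- If `κ = 0`, the turning orbit only alternates between the two ends, leaving room for at most two
positions. -/
lemma turn_pos (h : UnimodalModel k κ μ) (hk : 3 ≤ k) : 0 < κ := by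
  by_contra h0
  obtain rfl : κ = 0 := by omega
  obtain ⟨n, hn⟩ := h.cover 1 (by omega)
  have : ∀ n, μ^[n] 0 = 0 ∨ μ^[n] 0 = k - 1 := by
    intro n
    induction n with
    | zero => left; rfl
    | succ n ih =>
      rw [Function.iterate_succ_apply']
      rcases ih with ih | ih <;> rw [ih]
      · exact .inr h.map_turn
      · exact .inl (h.map_last (by omega))
  have := this n
  omega

end UnimodalModel

/-! ### The product model -/

lemma lex_lt {k i s j t : ℕ} (hs : s < k) (ht : t < k) :
    i * k + s < j * k + t ↔ i < j ∨ i = j ∧ s < t := by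
  rcases lt_trichotomy i j with h | rfl | h
  · have : (i + 1) * k ≤ j * k := Nat.mul_le_mul_right k h
    rw [Nat.add_mul] at this
    simp only [h, true_or, iff_true]; omega
  · simp
  · have : (j + 1) * k ≤ i * k := Nat.mul_le_mul_right k h
    rw [Nat.add_mul] at this
    constructor <;> intro <;> omega

lemma lex_le {k i s j t : ℕ} (hs : s < k) (ht : t < k) :
    i * k + s ≤ j * k + t ↔ i < j ∨ i = j ∧ s ≤ t := by
  rw [← not_lt, lex_lt ht hs]; omega

lemma lex_eq {k i s j t : ℕ} (hs : s < k) (ht : t < k) :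
    i * k + s = j * k + t ↔ i = j ∧ s = t := by
  have h1 := lex_le (i := i) (j := j) hs ht
  have h2 := lex_le (i := j) (j := i) ht hs
  omega

lemma exists_lex {k : ℕ} (hk : 0 < k) (x : ℕ) : ∃ i s, s < k ∧ x = i * k + s :=
  ⟨x / k, x % k, Nat.mod_lt _ hk, (Nat.div_add_mod' x k).symm⟩

lemma lex_lt_mul {k i s N : ℕ} (hs : s < k) : i * k + s < N * k ↔ i < N := by
  have := lex_lt (i := i) (j := N) hs (t := 0) (by omega)
  omega

/-- Reversal of `{0, …, k - 1}` if `r` holds. -/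
def rv (k : ℕ) (r : Bool) (s : ℕ) : ℕ := if r then k - 1 - s else s

lemma rv_lt {k s : ℕ} (r : Bool) (hs : s < k) : rv k r s < k := by
  unfold rv; split_ifs <;> omega

lemma rv_rv {k s : ℕ} (r r' : Bool) (hs : s < k) : rv k r (rv k r' s) = rv k (xor r r') s := by
  cases r <;> cases r' <;> simp [rv]; omega

/-- The map between the groups of the product over the point `i`. -/
def fiberMap (k a b : ℕ) (μ : ℕ → ℕ) (rev : Bool) (i s : ℕ) : ℕ :=
  -- Over `a` the base map has a maximum, and a copy of `μ` fits in either direction of the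
  -- argument. The map over `b` is the conjugate of the map over `a` by the reversal, which turns
  -- the maximum into a minimum and exchanges `rev` and `!rev`.
  if i < a then s else if i = a then μ (rv k rev s) else if i < b then k - 1 - s
  else if i = b then k - 1 - μ (rv k (!rev) s) else s

/-- The product map: position `s` of group `i` is the number `i * k + s`. -/
def prodMap (k a b : ℕ) (ν μ : ℕ → ℕ) (rev : Bool) (x : ℕ) : ℕ :=
  ν (x / k) * k + fiberMap k a b μ rev (x / k) (x % k)

lemma prodMap_mk {k a b : ℕ} {ν μ : ℕ → ℕ} {rev : Bool} (i : ℕ) {s : ℕ} (hs : s < k) :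
    prodMap k a b ν μ rev (i * k + s) = ν i * k + fiberMap k a b μ rev i s := by
  have hk : 0 < k := by omega
  have h1 : (i * k + s) / k = i := by
    rw [Nat.add_comm, Nat.add_mul_div_right _ _ hk, Nat.div_eq_of_lt hs, zero_add]
  have h2 : (i * k + s) % k = s := by
    rw [Nat.add_comm, Nat.add_mul_mod_self_right, Nat.mod_eq_of_lt hs]
  rw [prodMap, h1, h2]

section Product

variable {N a b k κ : ℕ} {ν μ : ℕ → ℕ} {rev : Bool}

lemma fiberMap_lt (hU : UnimodalModel k κ μ) (rev : Bool) (i : ℕ) {s : ℕ} (hs : s < k) :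
    fiberMap k a b μ rev i s < k := by
  have := hU.maps _ (rv_lt rev hs)
  unfold fiberMap
  split_ifs <;> omega

lemma fiberMap_turnA (s : ℕ) : fiberMap k a b μ rev a s = μ (rv k rev s) := by
  simp [fiberMap]

lemma fiberMap_turnB (hab : a < b) (s : ℕ) :
    fiberMap k a b μ rev b s = k - 1 - μ (rv k (!rev) s) := by
  simp [fiberMap, hab.not_gt, hab.ne']

/-- Needed to follow orbits of the product backwards: every orbit of the base can be lifted so as to
end at a prescribed position of the last group. -/
lemma fiberMap_surj (hU : UnimodalModel k κ μ) (i : ℕ) {t : ℕ} (ht : t < k) :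
    ∃ s < k, fiberMap k a b μ rev i s = t := by
  unfold fiberMap
  split_ifs
  · exact ⟨t, ht, rfl⟩
  · obtain ⟨x, hx, rfl⟩ := hU.surj ht
    exact ⟨rv k rev x, rv_lt _ hx, by rw [rv_rv _ _ hx]; simp [rv]⟩
  · exact ⟨k - 1 - t, by omega, by omega⟩
  · obtain ⟨x, hx, h⟩ := hU.surj (y := k - 1 - t) (by omega)
    exact ⟨rv k (!rev) x, rv_lt _ hx, by rw [rv_rv _ _ hx]; simp [rv, h]; omega⟩
  · exact ⟨t, ht, rfl⟩

/-- The point over the turning point `A` that corresponds to `y`. -/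
def overA (k a : ℕ) (rev : Bool) (y : ℕ) : ℕ := a * k + rv k rev y

/-- The point over the turning point `B` that corresponds to `y`. -/
def overB (k b : ℕ) (rev : Bool) (y : ℕ) : ℕ := b * k + rv k (!rev) y

lemma prodMap_overA {y : ℕ} (hy : y < k) :
    prodMap k a b ν μ rev (overA k a rev y) = ν a * k + μ y := by
  rw [overA, prodMap_mk _ (rv_lt _ hy), fiberMap_turnA, rv_rv _ _ hy]
  simp [rv]

lemma prodMap_overB (hab : a < b) {y : ℕ} (hy : y < k) :
    prodMap k a b ν μ rev (overB k b rev y) = ν b * k + rv k true (μ y) := by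
  rw [overB, prodMap_mk _ (rv_lt _ hy), fiberMap_turnB hab, rv_rv _ _ hy]
  simp [rv]

/-- For positions in different groups the monotonicity of `ν` decides; within one group that of the
fibre map does, which over `a` is monotone up to the position of `κ`. The other two laps follow the
same scheme. -/
lemma prodMap_left (hV : BimodalModel N a b ν) (hU : UnimodalModel k κ μ) {x y : ℕ} (hxy : x < y)
    (hy : y ≤ overA k a rev κ) : prodMap k a b ν μ rev x < prodMap k a b ν μ rev y := by
  have hκ := hU.lt
  obtain ⟨i, s, hs, rfl⟩ := exists_lex (k := k) (by omega) x
  obtain ⟨j, t, ht, rfl⟩ := exists_lex (k := k) (by omega) y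
  rw [overA, lex_le ht (rv_lt _ hκ)] at hy
  rw [lex_lt hs ht] at hxy
  rw [prodMap_mk _ hs, prodMap_mk _ ht, lex_lt (fiberMap_lt hU _ _ hs) (fiberMap_lt hU _ _ ht)]
  rcases hxy with hij | ⟨rfl, hst⟩
  · exact .inl (hV.left i j hij (by omega))
  · refine .inr ⟨rfl, ?_⟩
    rcases hy with hlt | ⟨rfl, hle⟩
    · simpa [fiberMap, hlt] using hst
    · rw [fiberMap_turnA, fiberMap_turnA]
      cases rev
      · exact hU.left _ _ hst hle
      · simp only [rv, if_true] at hle ⊢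
        exact hU.right _ _ (by omega) (by omega) (by omega)

lemma prodMap_middle (hV : BimodalModel N a b ν) (hU : UnimodalModel k κ μ) {x y : ℕ}
    (hx : overA k a rev κ ≤ x) (hxy : x < y) (hy : y ≤ overB k b rev κ) :
    prodMap k a b ν μ rev y < prodMap k a b ν μ rev x := by
  have hκ := hU.lt
  have hab := hV.ab
  obtain ⟨i, s, hs, rfl⟩ := exists_lex (k := k) (by omega) x
  obtain ⟨j, t, ht, rfl⟩ := exists_lex (k := k) (by omega) y
  rw [overA, lex_le (rv_lt _ hκ) hs] at hx
  rw [overB, lex_le ht (rv_lt _ hκ)] at hy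
  rw [lex_lt hs ht] at hxy
  rw [prodMap_mk _ hs, prodMap_mk _ ht, lex_lt (fiberMap_lt hU _ _ ht) (fiberMap_lt hU _ _ hs)]
  rcases hxy with hij | ⟨rfl, hst⟩
  · exact .inl (hV.middle i j (by omega) hij (by omega))
  · refine .inr ⟨rfl, ?_⟩
    rcases hx with hlt | ⟨rfl, hle⟩
    · rcases hy with hlt' | ⟨rfl, hle'⟩
      · simp only [fiberMap, hlt.not_gt, hlt.ne', hlt', if_true, if_false]; omega
      · have h1 := hU.maps _ (rv_lt (!rev) hs)
        have h2 := hU.maps _ (rv_lt (!rev) ht)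
        rw [fiberMap_turnB hab, fiberMap_turnB hab]
        suffices μ (rv k (!rev) s) < μ (rv k (!rev) t) by omega
        cases rev
        · simp only [rv, Bool.not_false, if_true] at hle' ⊢
          exact hU.right _ _ (by omega) (by omega) (by omega)
        · exact hU.left _ _ hst hle'
    · rw [fiberMap_turnA, fiberMap_turnA]
      cases rev
      · exact hU.right _ _ hle hst ht
      · simp only [rv, if_true] at hle ⊢
        exact hU.left _ _ (by omega) (by omega)

lemma prodMap_right (hV : BimodalModel N a b ν) (hU : UnimodalModel k κ μ) {x y : ℕ}
    (hx : overB k b rev κ ≤ x) (hxy : x < y) (hy : y < N * k) :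
    prodMap k a b ν μ rev x < prodMap k a b ν μ rev y := by
  have hκ := hU.lt
  have hab := hV.ab
  obtain ⟨i, s, hs, rfl⟩ := exists_lex (k := k) (by omega) x
  obtain ⟨j, t, ht, rfl⟩ := exists_lex (k := k) (by omega) y
  rw [lex_lt_mul ht] at hy
  rw [overB, lex_le (rv_lt _ hκ) hs] at hx
  rw [lex_lt hs ht] at hxy
  rw [prodMap_mk _ hs, prodMap_mk _ ht, lex_lt (fiberMap_lt hU _ _ hs) (fiberMap_lt hU _ _ ht)]
  rcases hxy with hij | ⟨rfl, hst⟩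
  · exact .inl (hV.right i j (by omega) hij hy)
  · refine .inr ⟨rfl, ?_⟩
    rcases hx with hlt | ⟨rfl, hle⟩
    · simpa [fiberMap, hlt.not_gt, hlt.ne', (hab.trans hlt).not_gt, (hab.trans hlt).ne'] using hst
    · have h1 := hU.maps _ (rv_lt (!rev) hs)
      have h2 := hU.maps _ (rv_lt (!rev) ht)
      rw [fiberMap_turnB hab, fiberMap_turnB hab]
      suffices μ (rv k (!rev) t) < μ (rv k (!rev) s) by omega
      cases rev
      · simp only [rv, Bool.not_false, if_true] at hle ⊢
        exact hU.left _ _ (by omega) (by omega)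
      · exact hU.right _ _ hle hst ht

/-- Points of the product that do not lie over turning points inherit the symbol. -/
lemma bsym_of_lap (hκ : κ < k) {i s : ℕ} (hs : s < k) (ha : i ≠ a) (hb : i ≠ b) :
    bsym (overA k a rev κ) (overB k b rev κ) (i * k + s) = bsym a b i := by
  unfold bsym overA overB
  simp only [lex_lt hs (rv_lt _ hκ), lex_eq hs (rv_lt _ hκ), ha, hb, false_and, or_false]

/-- The coordinate `y` lies on the same side of `κ` as the point of the new turning point, unless
the group is reversed. This is the source of the parity in `slotA` and `slotB`. -/
lemma bsym_overA (hab : a < b) (hκ : κ < k) {y : ℕ} (hy : y < k) :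
    bsym (overA k a rev κ) (overB k b rev κ) (overA k a rev y) = slotA rev (usym κ y) := by
  unfold bsym
  simp only [overA, overB, lex_lt (rv_lt _ hy) (rv_lt _ hκ), lex_eq (rv_lt _ hy) (rv_lt _ hκ),
    hab, hab.ne, true_and, true_or, lt_irrefl, false_or, if_true]
  unfold usym
  cases rev <;> simp only [rv] <;> split_ifs <;> simp_all [slotA] <;> omega

lemma bsym_overB (hab : a < b) (hκ : κ < k) {y : ℕ} (hy : y < k) :
    bsym (overA k a rev κ) (overB k b rev κ) (overB k b rev y) = slotB rev (usym κ y) := by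
  unfold bsym
  simp only [overA, overB, lex_lt (rv_lt _ hy) (rv_lt _ hκ), lex_eq (rv_lt _ hy) (rv_lt _ hκ),
    hab.ne', hab.not_gt, true_and, false_and, or_self, lt_irrefl, false_or, if_false]
  unfold usym
  cases rev <;> simp only [rv] <;> split_ifs <;> simp_all [slotB] <;> omega

lemma oddM_cons (x : Sym) (P : List Sym) : oddM (x :: P) = xor (decide (x = .M)) (oddM P) := by
  unfold oddM
  rw [List.count_cons]
  by_cases h : x = .M
  · simp only [h, beq_self_eq_true, if_true, decide_true, Bool.true_xor]
    rw [← decide_not]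
    congr 1
    simp only [eq_iff_iff]; omega
  · simp [h]

lemma oddM_bar (P : List Sym) : oddM (bar P) = oddM P := by
  induction P with
  | nil => rfl
  | cons x P ih =>
    change oddM (conj x :: bar P) = _
    rw [oddM_cons, oddM_cons, ih]
    cases x <;> rfl

/-- Following a word without turning points, the positions in the groups are kept or reversed
according to the parity of the word. -/
lemma prodMap_run (hV : BimodalModel N a b ν) (hκ : κ < k) (P : List Sym)
    (hP : ∀ x ∈ P, x = .L ∨ x = .M ∨ x = .R) :
    ∀ i s, s < k → (∀ n (h : n < P.length), bsym a b (ν^[n] i) = P[n]) →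
      (prodMap k a b ν μ rev)^[P.length] (i * k + s) = ν^[P.length] i * k + rv k (oddM P) s ∧
      itin (prodMap k a b ν μ rev) (bsym (overA k a rev κ) (overB k b rev κ)) (i * k + s) =
        appendSeq P (itin (prodMap k a b ν μ rev) (bsym (overA k a rev κ) (overB k b rev κ))
          (ν^[P.length] i * k + rv k (oddM P) s)) := by
  induction P with
  | nil => intro i s _ _; simp [rv, oddM]
  | cons x P ih =>
    intro i s hs hi
    have hab := hV.ab
    have h0 : bsym a b i = x := hi 0 (by simp)
    have hx := hP x List.mem_cons_self
    have ha : i ≠ a := fun h => by rw [bsym_eq_A.2 h] at h0; simp [← h0] at hx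
    have hb : i ≠ b := fun h => by rw [(bsym_eq_B hab).2 h] at h0; simp [← h0] at hx
    have hstep : prodMap k a b ν μ rev (i * k + s) = ν i * k + rv k (decide (x = .M)) s := by
      rw [prodMap_mk _ hs, ← h0]
      congr 1
      unfold fiberMap bsym
      split_ifs <;> first | omega | simp [rv]
    obtain ⟨h1, h2⟩ := ih (fun y hy => hP y (List.mem_cons_of_mem _ hy)) (ν i)
      (rv k (decide (x = .M)) s) (rv_lt _ hs) (fun n hn => hi (n + 1) (by simpa using hn))
    rw [rv_rv _ _ hs, Bool.xor_comm, ← oddM_cons] at h1 h2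
    constructor
    · rw [List.length_cons, Function.iterate_succ_apply, hstep, h1, Function.iterate_succ_apply]
    · rw [itin_eq_consSeq, hstep, h2, bsym_of_lap hκ hs ha hb, h0]
      rfl

end Product

/-- The sign of `V`: `true` stands for reversed. -/
def SymData.rev (V : SymData) : Bool := xor (oddM V.word) V.isDoubly

/-! ### Return maps to the fibres over the turning points -/

section Product

variable {V : SymData} {a b k κ : ℕ} {ν μ : ℕ → ℕ}

/-- The product of the models of `V` and of a unimodal word. -/
def SymData.prodMap (V : SymData) (k a b : ℕ) (ν μ : ℕ → ℕ) : ℕ → ℕ :=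
  SymBimodal.prodMap k a b ν μ V.rev

/-- Symbols of the points of the product. -/
def SymData.prodSym (V : SymData) (k a b κ : ℕ) : ℕ → Sym :=
  bsym (overA k a V.rev κ) (overB k b V.rev κ)

lemma IsBModel.iterate_p_A (hV : IsBModel V a b ν) :
    ν^[V.p] a = if V.isDoubly then b else a := by
  have h : V.blocks.seqA V.word.length = bsym a b (ν^[V.p] a) := congrFun hV.itinA V.p
  rw [V.seqA_length] at h
  cases hd : V.isDoubly <;> rw [hd] at h
  · exact bsym_eq_A.1 h.symm
  · exact (bsym_eq_B hV.ab).1 h.symm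

lemma IsBModel.iterate_p_B (hV : IsBModel V a b ν) :
    ν^[V.p] b = if V.isDoubly then a else b := by
  have h : V.blocks.seqB V.word.length = bsym a b (ν^[V.p] b) := congrFun hV.itinB V.p
  rw [V.seqB_length hV.lap_word] at h
  cases hd : V.isDoubly <;> rw [hd] at h
  · exact (bsym_eq_B hV.ab).1 h.symm
  · exact bsym_eq_A.1 h.symm

/-- One step applies `μ` to the coordinate, and the remaining steps along `P` only keep or reverse
the group. The second part records the symbols read during one return; `step_overB` is the conjugate
statement. -/
lemma IsBModel.step_overA (hV : IsBModel V a b ν) (hU : UnimodalModel k κ μ) {y : ℕ} (hy : y < k) :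
    (V.prodMap k a b ν μ)^[V.p] (overA k a V.rev y) =
        (if V.isDoubly then overB k b V.rev (μ y) else overA k a V.rev (μ y)) ∧
      itin (V.prodMap k a b ν μ) (V.prodSym k a b κ) (V.prodMap k a b ν μ (overA k a V.rev y)) =
        appendSeq V.word (itin (V.prodMap k a b ν μ) (V.prodSym k a b κ)
          (if V.isDoubly then overB k b V.rev (μ y) else overA k a V.rev (μ y))) := by
  have hμ := hU.maps y hy
  have hrun := prodMap_run (μ := μ) (rev := V.rev) hV.toBimodalModel hU.lt V.word hV.lap_word (ν a)
    (μ y) hμ (fun n hn => by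
      rw [← V.seqA_of_lt hn]; exact (congrFun hV.itinA (n + 1)).symm)
  -- The reversal accumulated along `P` must be the one built into the coordinates of the fibre
  -- reached, namely `rev` over `a` and `!rev` over `b`. This condition is what determines `V.rev`.
  have hend : ν^[V.word.length] (ν a) * k + rv k (oddM V.word) (μ y) =
      if V.isDoubly then overB k b V.rev (μ y) else overA k a V.rev (μ y) := by
    rw [← Function.iterate_succ_apply, show V.word.length.succ = V.p from rfl, hV.iterate_p_A]
    cases hd : V.isDoubly <;> simp [overA, overB, SymData.rev, hd]
  rw [hend] at hrun
  simp only [SymData.prodMap, SymData.prodSym, SymData.p]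
  rw [Function.iterate_succ_apply, prodMap_overA hy]
  exact hrun

lemma IsBModel.step_overB (hV : IsBModel V a b ν) (hU : UnimodalModel k κ μ) {y : ℕ} (hy : y < k) :
    (V.prodMap k a b ν μ)^[V.p] (overB k b V.rev y) =
        (if V.isDoubly then overA k a V.rev (μ y) else overB k b V.rev (μ y)) ∧
      itin (V.prodMap k a b ν μ) (V.prodSym k a b κ) (V.prodMap k a b ν μ (overB k b V.rev y)) =
        appendSeq (bar V.word) (itin (V.prodMap k a b ν μ) (V.prodSym k a b κ)
          (if V.isDoubly then overA k a V.rev (μ y) else overB k b V.rev (μ y))) := by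
  have hμ := hU.maps y hy
  have hrun := prodMap_run (μ := μ) (rev := V.rev) hV.toBimodalModel hU.lt (bar V.word)
    (bar_lap hV.lap_word) (ν b) (rv k true (μ y)) (rv_lt _ hμ) (fun n hn => by
      rw [length_bar] at hn
      have := V.seqB_of_lt hV.lap_word hn
      simp only [bar, List.getElem_map]
      rw [← this]; exact (congrFun hV.itinB (n + 1)).symm)
  have hend : ν^[V.word.length] (ν b) * k + rv k (oddM V.word) (rv k true (μ y)) =
      if V.isDoubly then overA k a V.rev (μ y) else overB k b V.rev (μ y) := by
    rw [← Function.iterate_succ_apply, show V.word.length.succ = V.p from rfl, hV.iterate_p_B,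
      rv_rv _ _ hμ]
    cases hd : V.isDoubly <;> simp [overA, overB, SymData.rev, hd]
  rw [length_bar, oddM_bar, hend] at hrun
  simp only [SymData.prodMap, SymData.prodSym, SymData.p]
  rw [Function.iterate_succ_apply, prodMap_overB hV.ab hy]
  exact hrun

/-- `y` is in the forward orbit of `x`. -/
def Reaches (f : ℕ → ℕ) (x y : ℕ) : Prop := ∃ n, f^[n] x = y

lemma Reaches.refl (f : ℕ → ℕ) (x : ℕ) : Reaches f x x := ⟨0, rfl⟩

lemma Reaches.trans {f : ℕ → ℕ} {x y z : ℕ} (h : Reaches f x y) (h' : Reaches f y z) :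
    Reaches f x z := by
  obtain ⟨n, rfl⟩ := h
  obtain ⟨m, rfl⟩ := h'
  exact ⟨m + n, Function.iterate_add_apply f m n x⟩

/-- Each return applies `μ` to the coordinate. Which of the two fibres is reached depends on the
type of `V`, but is not needed. -/
lemma IsBModel.reaches_next (hV : IsBModel V a b ν) (hU : UnimodalModel k κ μ) {y x : ℕ}
    (hy : y < k) (hx : x = overA k a V.rev y ∨ x = overB k b V.rev y) (n : ℕ) :
    ∃ x', (x' = overA k a V.rev (μ^[n] y) ∨ x' = overB k b V.rev (μ^[n] y)) ∧
      Reaches (V.prodMap k a b ν μ) x x' := by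
  induction n with
  | zero => exact ⟨x, hx, .refl _ _⟩
  | succ n ih =>
    obtain ⟨x', hx', hr⟩ := ih
    have hA := (hV.step_overA hU (iterate_lt hU.maps hy n)).1
    have hB := (hV.step_overB hU (iterate_lt hU.maps hy n)).1
    rw [Function.iterate_succ_apply']
    refine ⟨(V.prodMap k a b ν μ)^[V.p] x', ?_, hr.trans ⟨_, rfl⟩⟩
    rcases hx' with rfl | rfl
    · rw [hA]; split_ifs <;> simp
    · rw [hB]; split_ifs <;> simp

/-- Returns permute the two fibres, so a point with coordinate `μ^[n] κ` can be traced back, return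
by return, to coordinate `κ` over one of the turning points. -/
lemma IsBModel.reached (hV : IsBModel V a b ν) (hU : UnimodalModel k κ μ) (n : ℕ) :
    ∀ x, (x = overA k a V.rev (μ^[n] κ) ∨ x = overB k b V.rev (μ^[n] κ)) →
      Reaches (V.prodMap k a b ν μ) (overA k a V.rev κ) x ∨
      Reaches (V.prodMap k a b ν μ) (overB k b V.rev κ) x := by
  induction n with
  | zero =>
    rintro x (rfl | rfl)
    · exact .inl (.refl _ _)
    · exact .inr (.refl _ _)
  | succ n ih =>
    have hA := (hV.step_overA hU (iterate_lt hU.maps hU.lt n)).1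
    have hB := (hV.step_overB hU (iterate_lt hU.maps hU.lt n)).1
    rw [Function.iterate_succ_apply']
    have key : ∀ x, (x = overA k a V.rev (μ (μ^[n] κ)) ∨ x = overB k b V.rev (μ (μ^[n] κ))) →
        ∃ x', (x' = overA k a V.rev (μ^[n] κ) ∨ x' = overB k b V.rev (μ^[n] κ)) ∧
          (V.prodMap k a b ν μ)^[V.p] x' = x := by
      cases hd : V.isDoubly <;> simp only [hd, if_true, if_false, Bool.false_eq_true] at hA hB
      · rintro x (rfl | rfl)
        · exact ⟨_, .inl rfl, hA⟩
        · exact ⟨_, .inr rfl, hB⟩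
      · rintro x (rfl | rfl)
        · exact ⟨_, .inr rfl, hB⟩
        · exact ⟨_, .inl rfl, hA⟩
    intro x hx
    obtain ⟨x', hx', hr⟩ := key x hx
    exact (ih x' hx').imp (fun h => h.trans ⟨_, hr⟩) (fun h => h.trans ⟨_, hr⟩)

lemma prodMap_iterate_div (hU : UnimodalModel k κ μ) {rev : Bool} (n i : ℕ) {s : ℕ} (hs : s < k) :
    ∃ t < k, (prodMap k a b ν μ rev)^[n] (i * k + s) = ν^[n] i * k + t := by
  induction n with
  | zero => exact ⟨s, hs, rfl⟩
  | succ n ih =>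
    obtain ⟨t, ht, h⟩ := ih
    rw [Function.iterate_succ_apply', Function.iterate_succ_apply', h, prodMap_mk _ ht]
    exact ⟨_, fiberMap_lt hU _ _ ht, rfl⟩

lemma prodMap_iterate_surj (hU : UnimodalModel k κ μ) {rev : Bool} (n i : ℕ) {t : ℕ} (ht : t < k) :
    ∃ s < k, (prodMap k a b ν μ rev)^[n] (i * k + s) = ν^[n] i * k + t := by
  induction n generalizing t with
  | zero => exact ⟨t, ht, rfl⟩
  | succ n ih =>
    obtain ⟨t', ht', h'⟩ := fiberMap_surj (a := a) (b := b) (rev := rev) hU (ν^[n] i) ht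
    obtain ⟨s, hs, h⟩ := ih ht'
    refine ⟨s, hs, ?_⟩
    rw [Function.iterate_succ_apply', Function.iterate_succ_apply', h, prodMap_mk _ ht', h']

lemma exists_rv {s : ℕ} (r : Bool) (hs : s < k) : ∃ y < k, rv k r y = s :=
  ⟨rv k r s, rv_lt _ hs, by rw [rv_rv _ _ hs]; simp [rv]⟩

/-- For `turn`, an orbit first enters a fibre over `a` or `b` because `ν` does, and then its returns
run along `μ` until they meet `κ`. For `cover`, the same is done backwards, with surjective fibre
maps. -/
lemma IsBModel.prod_model (hV : IsBModel V a b ν) (hU : UnimodalModel k κ μ) :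
    BimodalModel (2 * V.p * k) (overA k a V.rev κ) (overB k b V.rev κ) (V.prodMap k a b ν μ) where
  ab := (lex_lt (rv_lt _ hU.lt) (rv_lt _ hU.lt)).2 (.inl hV.ab)
  bN := (lex_lt_mul (rv_lt _ hU.lt)).2 hV.bN
  maps x hx := by
    have hκ := hU.lt
    obtain ⟨i, s, hs, rfl⟩ := exists_lex (k := k) (by omega) x
    rw [lex_lt_mul hs] at hx
    rw [SymData.prodMap, prodMap_mk _ hs, lex_lt_mul (fiberMap_lt hU _ _ hs)]
    exact hV.maps i hx
  left _ _ hxy hy := prodMap_left hV.toBimodalModel hU hxy hy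
  middle _ _ hx hxy hy := prodMap_middle hV.toBimodalModel hU hx hxy hy
  right _ _ hx hxy hy := prodMap_right hV.toBimodalModel hU hx hxy hy
  turn x hx := by
    have hκ := hU.lt
    obtain ⟨i, s, hs, rfl⟩ := exists_lex (k := k) (by omega) x
    rw [lex_lt_mul hs] at hx
    obtain ⟨n, hn⟩ := hV.turn i hx
    obtain ⟨t, ht, h⟩ := prodMap_iterate_div (a := a) (b := b) (ν := ν) hU (rev := V.rev) n i hs
    have : ∃ y < k, ν^[n] i * k + t = overA k a V.rev y ∨ ν^[n] i * k + t = overB k b V.rev y := by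
      rcases hn with hn | hn <;> rw [hn]
      · obtain ⟨y, hy, rfl⟩ := exists_rv V.rev ht
        exact ⟨y, hy, .inl rfl⟩
      · obtain ⟨y, hy, rfl⟩ := exists_rv (!V.rev) ht
        exact ⟨y, hy, .inr rfl⟩
    obtain ⟨y, hy, hxy⟩ := this
    obtain ⟨m, hm⟩ := hU.turn y hy
    obtain ⟨x', hx', hr⟩ := hV.reaches_next hU hy hxy m
    obtain ⟨q, hq⟩ := Reaches.trans ⟨n, h⟩ hr
    rw [hm] at hx'
    exact ⟨q, hx'.imp (fun e => hq.trans e) (fun e => hq.trans e)⟩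
  cover x hx := by
    have hκ := hU.lt
    obtain ⟨i, t, ht, rfl⟩ := exists_lex (k := k) (by omega) x
    rw [lex_lt_mul ht] at hx
    obtain ⟨n, hn⟩ := hV.cover i hx
    have : ∃ y < k, ∃ z, (z = overA k a V.rev y ∨ z = overB k b V.rev y) ∧
        Reaches (V.prodMap k a b ν μ) z (i * k + t) := by
      rcases hn with rfl | rfl
      · obtain ⟨s, hs, h⟩ := prodMap_iterate_surj (a := a) (b := b) (ν := ν) hU (rev := V.rev) n a ht
        obtain ⟨y, hy, rfl⟩ := exists_rv V.rev hs
        exact ⟨y, hy, _, .inl rfl, n, h⟩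
      · obtain ⟨s, hs, h⟩ := prodMap_iterate_surj (a := a) (b := b) (ν := ν) hU (rev := V.rev) n b ht
        obtain ⟨y, hy, rfl⟩ := exists_rv (!V.rev) hs
        exact ⟨y, hy, _, .inr rfl, n, h⟩
    obtain ⟨y, hy, z, hz, hr⟩ := this
    obtain ⟨m, rfl⟩ := hU.cover y hy
    rcases hV.reached hU m z hz with h | h
    · obtain ⟨q, hq⟩ := h.trans hr
      exact ⟨q, .inl hq.symm⟩
    · obtain ⟨q, hq⟩ := h.trans hr
      exact ⟨q, .inr hq.symm⟩

end Product

/-! ### Words of the star product -/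

lemma appendSeq_iterate {α : Type} {T : ℕ → ℕ → α} {F : ℕ → List α}
    (h : ∀ m, T m = appendSeq (F m) (T (m + 1))) (n : ℕ) :
    T 0 = appendSeq ((List.range n).flatMap F) (T n) := by
  induction n with
  | zero => rfl
  | succ n ih =>
    rw [List.range_succ, List.flatMap_append, appendSeq_append, ih, List.flatMap_singleton, ← h]

/-- Used with `T m` the itinerary after `m` returns (or pairs of returns) and `F m` the word read
during the next: when the returns close up, the itinerary is periodic. -/
lemma eq_periodic_flatMap_range {α : Type} {T : ℕ → ℕ → α} {F : ℕ → List α} (d : α)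
    (h : ∀ m, T m = appendSeq (F m) (T (m + 1))) {n : ℕ} (hn : 0 < n) (hF : F 0 ≠ [])
    (hT : T n = T 0) : T 0 = periodic d ((List.range n).flatMap F) := by
  apply eq_periodic
  · intro h0
    rw [List.flatMap_eq_nil_iff] at h0
    exact hF (h0 0 (by simpa using hn))
  · conv_lhs => rw [appendSeq_iterate h n, hT]

lemma rotate_map_range {α : Type} {h : ℕ → α} {n : ℕ} (hper : Function.Periodic h n) (m : ℕ) :
    ((List.range n).map h).rotate m = (List.range n).map fun i => h (i + m) := by
  apply List.ext_getElem (by simp)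
  intro i h1 h2
  rw [List.getElem_rotate]
  simp [hper.map_mod_nat]

lemma translate_map_range (h : ℕ → USym) (n : ℕ) :
    translate ((List.range (2 * n)).map h) =
      (List.range n).map fun i => pairCode (h (2 * i)) (h (2 * i + 1)) := by
  induction n generalizing h with
  | zero => rfl
  | succ n ih =>
    rw [show 2 * (n + 1) = 2 * n + 1 + 1 by ring, List.range_succ_eq_map, List.range_succ_eq_map,
      List.range_succ_eq_map]
    simp only [List.map_cons, List.map_map, translate]
    have := ih (fun i => h (i + 2))
    congr 1

lemma map_range_append_self {α : Type} {h : ℕ → α} {n : ℕ} (hper : Function.Periodic h n) :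
    (List.range n).map h ++ (List.range n).map h = (List.range (2 * n)).map h := by
  rw [two_mul, List.range_add, List.map_append, List.map_map]
  congr 1
  apply List.map_congr_left
  intro i _
  simp only [Function.comp]
  rw [Nat.add_comm, hper]

namespace IsUModel

variable {X : List USym} {κ : ℕ} {μ : ℕ → ℕ}

lemma periodic_apply (h : IsUModel X κ μ) (n : ℕ) :
    periodic .c X n = usym κ (μ^[n + 1] κ) := congrFun h.itin_eq (n + 1)

lemma periodic_periodic (X : List USym) : Function.Periodic (periodic .c X) X.length :=
  periodic_add_length USym.c X

lemma iterate_add_length (h : IsUModel X κ μ) (n : ℕ) : μ^[n + X.length] κ = μ^[n] κ := by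
  rw [Function.iterate_add_apply, h.period]

lemma translate_append_self (X : List USym) :
    translate (X ++ X) =
      (List.range X.length).map fun i =>
        pairCode (periodic .c X (2 * i)) (periodic .c X (2 * i + 1)) := by
  rw [← translate_map_range, ← map_range_append_self (periodic_periodic X),
    ← list_eq_map_range_periodic]

lemma translate_even {n : ℕ} (hn : X.length = 2 * n) :
    translate X =
      (List.range n).map fun i =>
        pairCode (periodic .c X (2 * i)) (periodic .c X (2 * i + 1)) := by
  rw [← translate_map_range, ← hn, ← list_eq_map_range_periodic]

lemma translate_rotate {n : ℕ} (hn : X.length = 2 * n) :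
    translate (X.rotate 1) =
      (List.range n).map fun i =>
        pairCode (periodic .c X (2 * i + 1)) (periodic .c X (2 * i + 2)) := by
  have : X.rotate 1 = (List.range X.length).map fun i => periodic .c X (i + 1) := by
    rw [← rotate_map_range (periodic_periodic X), ← list_eq_map_range_periodic]
  rw [this, hn, translate_map_range]

/-- The symbol after `c` is `r`. -/
lemma usym_map_turn (h : IsUModel X κ μ) {y : ℕ} (hy : usym κ y = .c) : usym κ (μ y) = .r := by
  rw [usym_eq_c] at hy
  rw [hy, usym_eq_r, h.map_turn]
  exact h.turn_lt h.two_le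

end IsUModel

/-- A translated pair stands for one passage over `B` followed by one over `A`. The negation appears
because doubly stable data are reversed exactly for even `P`; the hypothesis is needed because
`pairCode` sends every pair starting with `c` to `B`. -/
lemma slots_pairCode (o : Bool) {x y : USym} (h : x = .c → y = .r) :
    slots o (pairCode x y) = (slotB (!o) x, slotA (!o) y) := by
  cases x <;> cases y <;> cases o <;> simp_all [slots, pairCode, slotA, slotB]

/-- On a doubly stable orbit the second kneading sequence is a shift of the first. -/
lemma itin_idxOf {ν : ℕ → ℕ} {sy : ℕ → Sym} {a b : ℕ} (hab : a ≠ b)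
    (hB : ∀ i, sy i = .B ↔ i = b) {w : List Sym} (hw : w ≠ [])
    (hA : consSeq .A (periodic .A w) = itin ν sy a) (hr : Reaches ν a b) :
    consSeq .B (shift^[w.idxOf .B + 1] (periodic .A w)) = itin ν sy b := by
  have hsh : periodic .A w = itin ν sy (ν a) := by
    rw [← shift_itin, ← hA, shift_consSeq]
  have hmem : Sym.B ∈ w := by
    obtain ⟨n, hn⟩ := hr
    cases n with
    | zero => exact absurd hn hab
    | succ n =>
      have := congrFun hsh n
      rw [itin, ← Function.iterate_succ_apply, hn, (hB b).2 rfl] at this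
      exact this ▸ periodic_mem hw _ n
  have hlt : w.idxOf .B < w.length := List.idxOf_lt_length_of_mem hmem
  have hb : ν^[w.idxOf .B] (ν a) = b := by
    have h1 := congrFun hsh (w.idxOf .B)
    rw [periodic_of_lt _ hlt, List.getElem_idxOf] at h1
    exact (hB _).1 h1.symm
  rw [hsh, shift_iterate_itin, Function.iterate_succ_apply', hb, itin_eq_consSeq ν _ b,
    (hB b).2 rfl]

section Star

variable {V : SymData} {X : List USym} {a b κ : ℕ} {ν μ : ℕ → ℕ}

lemma markovB_of_itin (hV : IsBModel V a b ν) (hX : IsUModel X κ μ) {S : BlockData}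
    (hA : S.seqA = itin (V.prodMap X.length a b ν μ) (V.prodSym X.length a b κ)
      (V.prodMap X.length a b ν μ (overA X.length a V.rev κ)))
    (hB : S.seqB = itin (V.prodMap X.length a b ν μ) (V.prodSym X.length a b κ)
      (V.prodMap X.length a b ν μ (overB X.length b V.rev κ))) :
    S.markovB = matOf (2 * V.p * X.length) (V.prodMap X.length a b ν μ) := by
  have hm := hV.prod_model hX.toUnimodalModel
  refine (hm.realizes ?_ ?_).markov_eq
  · rw [hA, itin_eq_consSeq _ _ (overA _ _ _ _), bsym_eq_A.2 rfl]; rfl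
  · rw [hB, itin_eq_consSeq _ _ (overB _ _ _ _), (bsym_eq_B hm.ab).2 rfl]; rfl

lemma itin_overA (hV : IsBModel V a b ν) (hX : IsUModel X κ μ) {y : ℕ} (hy : y < X.length) :
    itin (V.prodMap X.length a b ν μ) (V.prodSym X.length a b κ) (overA X.length a V.rev y) =
      consSeq (slotA V.rev (usym κ y))
        (itin (V.prodMap X.length a b ν μ) (V.prodSym X.length a b κ)
          (V.prodMap X.length a b ν μ (overA X.length a V.rev y))) := by
  rw [itin_eq_consSeq, SymData.prodSym, bsym_overA hV.ab hX.lt hy]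

lemma itin_overB (hV : IsBModel V a b ν) (hX : IsUModel X κ μ) {y : ℕ} (hy : y < X.length) :
    itin (V.prodMap X.length a b ν μ) (V.prodSym X.length a b κ) (overB X.length b V.rev y) =
      consSeq (slotB V.rev (usym κ y))
        (itin (V.prodMap X.length a b ν μ) (V.prodSym X.length a b κ)
          (V.prodMap X.length a b ν μ (overB X.length b V.rev y))) := by
  rw [itin_eq_consSeq, SymData.prodSym, bsym_overB hV.ab hX.lt hy]

/-- For a pair each fibre returns to itself, so one return reads `P` or its conjugate and one slot
letter, and `k` returns close up. -/
lemma markovB_pair {P : List Sym} (hV : IsBModel (.pair P) a b ν) (hX : IsUModel X κ μ) :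
    (BlockData.pair (X.flatMap fun x => P ++ [slotA (oddM P) x])
      (X.flatMap fun x => bar P ++ [slotB (oddM (bar P)) x])).markovB =
    matOf (2 * (SymData.pair P).p * X.length) ((SymData.pair P).prodMap X.length a b ν μ) := by
  have hlt := iterate_lt hX.maps hX.lt
  have hpos : 0 < X.length := by have := hX.two_le; omega
  have hrev : (SymData.pair P).rev = oddM P := by simp [SymData.rev, SymData.word, SymData.isDoubly]
  apply markovB_of_itin hV hX
  · have := eq_periodic_flatMap_range (d := Sym.A)
      (T := fun m => itin ((SymData.pair P).prodMap X.length a b ν μ)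
        ((SymData.pair P).prodSym X.length a b κ) ((SymData.pair P).prodMap X.length a b ν μ
        (overA X.length a (SymData.pair P).rev (μ^[m] κ))))
      (F := fun m => P ++ [slotA (oddM P) (periodic .c X m)]) (fun m => by
        have h1 := (hV.step_overA hX.toUnimodalModel (hlt m)).2
        simp only [SymData.isDoubly, Bool.false_eq_true, if_false] at h1
        rw [← Function.iterate_succ_apply' μ m, itin_overA hV hX (hlt (m + 1)), hrev] at h1
        simp only [hrev, appendSeq_append, hX.periodic_apply]
        exact h1) hpos (by simp) (by simp [hX.period])
    simp only [Function.iterate_zero, id] at this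
    rw [this, BlockData.seqA]
    conv_lhs => rw [list_eq_map_range_periodic .c X, List.flatMap_map]
  · have := eq_periodic_flatMap_range (d := Sym.B)
      (T := fun m => itin ((SymData.pair P).prodMap X.length a b ν μ)
        ((SymData.pair P).prodSym X.length a b κ) ((SymData.pair P).prodMap X.length a b ν μ
        (overB X.length b (SymData.pair P).rev (μ^[m] κ))))
      (F := fun m => bar P ++ [slotB (oddM P) (periodic .c X m)]) (fun m => by
        have h1 := (hV.step_overB hX.toUnimodalModel (hlt m)).2
        simp only [SymData.isDoubly, Bool.false_eq_true, if_false] at h1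
        rw [← Function.iterate_succ_apply' μ m, itin_overB hV hX (hlt (m + 1)), hrev] at h1
        simp only [hrev, appendSeq_append, hX.periodic_apply]
        exact h1) hpos (by simp) (by simp [hX.period])
    simp only [Function.iterate_zero, id] at this
    rw [this, BlockData.seqB, oddM_bar]
    conv_lhs => rw [list_eq_map_range_periodic .c X, List.flatMap_map]

variable {P : List Sym}

lemma rev_doubly (P : List Sym) : (SymData.doubly P).rev = !oddM P := by
  simp [SymData.rev, SymData.word, SymData.isDoubly]

/-- The sequence of `A` in a product with doubly stable data. -/
lemma itinA_doubly (hV : IsBModel (.doubly P) a b ν) (hX : IsUModel X κ μ) {n : ℕ} (hn : 0 < n)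
    (hper : μ^[2 * n] κ = κ) :
    periodic .A (starWord P ((List.range n).map fun i =>
      pairCode (periodic .c X (2 * i)) (periodic .c X (2 * i + 1)))) =
    itin ((SymData.doubly P).prodMap X.length a b ν μ) ((SymData.doubly P).prodSym X.length a b κ)
      ((SymData.doubly P).prodMap X.length a b ν μ (overA X.length a (SymData.doubly P).rev κ)) := by
  have hlt := iterate_lt hX.maps hX.lt
  have := eq_periodic_flatMap_range (d := Sym.A)
    (T := fun m => itin ((SymData.doubly P).prodMap X.length a b ν μ)
      ((SymData.doubly P).prodSym X.length a b κ) ((SymData.doubly P).prodMap X.length a b ν μ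
      (overA X.length a (SymData.doubly P).rev (μ^[2 * m] κ))))
    (F := fun m => P ++ [slotB (!oddM P) (periodic .c X (2 * m))] ++ bar P ++
      [slotA (!oddM P) (periodic .c X (2 * m + 1))]) (fun m => by
      have h1 := (hV.step_overA hX.toUnimodalModel (hlt (2 * m))).2
      have h2 := (hV.step_overB hX.toUnimodalModel (hlt (2 * m + 1))).2
      simp only [SymData.isDoubly, if_true] at h1 h2
      rw [← Function.iterate_succ_apply' μ (2 * m), itin_overB hV hX (hlt (2 * m + 1)), h2,
        ← Function.iterate_succ_apply' μ (2 * m + 1), itin_overA hV hX (hlt (2 * m + 1 + 1)),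
        rev_doubly] at h1
      simp only [rev_doubly, appendSeq_append, hX.periodic_apply]
      exact h1) hn (by simp) (by simp [hper])
  simp only [Nat.mul_zero, Function.iterate_zero, id] at this
  rw [this, starWord, List.flatMap_map]
  congr 2
  funext m
  rw [slots_pairCode]
  intro h
  rw [hX.periodic_apply] at h ⊢
  rw [Function.iterate_succ_apply']
  exact hX.usym_map_turn h

/-- Returns alternate between the fibres. For odd `k` the coordinate comes back to `κ` over the
other turning point, so both lie on one orbit, which closes after 2k returns, read as `k` pairs. -/
lemma markovB_doubly_minus (hV : IsBModel (.doubly P) a b ν) (hX : IsUModel X κ μ)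
    (hodd : Odd X.length) :
    (BlockData.doubly (starWord P (translate (X ++ X)))).markovB =
    matOf (2 * (SymData.doubly P).p * X.length) ((SymData.doubly P).prodMap X.length a b ν μ) := by
  have hlt := iterate_lt hX.maps hX.lt
  have hpos : 0 < X.length := by have := hX.two_le; omega
  have hA := itinA_doubly hV hX hpos
    (by rw [two_mul, hX.iterate_add_length, hX.period])
  rw [← IsUModel.translate_append_self] at hA
  have hm := hV.prod_model hX.toUnimodalModel
  have hne : starWord P (translate (X ++ X)) ≠ [] := by
    rw [IsUModel.translate_append_self, starWord, List.flatMap_map]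
    intro h0
    rw [List.flatMap_eq_nil_iff] at h0
    simpa using h0 0 (by simpa using hpos)
  have hreach : ∀ n, Reaches ((SymData.doubly P).prodMap X.length a b ν μ)
      (overA X.length a (SymData.doubly P).rev κ)
      (overB X.length b (SymData.doubly P).rev (μ^[2 * n + 1] κ)) := by
    intro n
    induction n with
    | zero => exact ⟨_, (hV.step_overA hX.toUnimodalModel hX.lt).1⟩
    | succ n ih =>
      have h1 := (hV.step_overB hX.toUnimodalModel (hlt (2 * n + 1))).1
      have h2 := (hV.step_overA hX.toUnimodalModel (hlt (2 * n + 1 + 1))).1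
      simp only [SymData.isDoubly, if_true] at h1 h2
      rw [← Function.iterate_succ_apply' μ] at h1 h2
      exact (ih.trans ⟨_, h1⟩).trans ⟨_, h2⟩
  obtain ⟨n, hn⟩ := hodd
  have hr := hreach n
  rw [← hn, hX.period] at hr
  refine markovB_of_itin (S := .doubly _) hV hX hA ?_
  have hA' : consSeq .A (periodic .A (starWord P (translate (X ++ X)))) =
      itin ((SymData.doubly P).prodMap X.length a b ν μ) ((SymData.doubly P).prodSym X.length a b κ)
        (overA X.length a (SymData.doubly P).rev κ) := by
    rw [hA, itin_overA hV hX hX.lt, usym_eq_c.2 rfl]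
    rfl
  have hB := itin_idxOf hm.ab.ne (fun _ => bsym_eq_B hm.ab) hne hA' hr
  rw [← shift_itin]
  exact congrArg shift hB

/-- For even `k` the coordinate comes back to `κ` over the same turning point, so there are two
orbits. The second one is read from the turning position itself; the final rotation in the
definition removes that leading letter. -/
lemma markovB_doubly_plus (hV : IsBModel (.doubly P) a b ν) (hX : IsUModel X κ μ)
    (heven : Even X.length) :
    (BlockData.pair (starWord P (translate X)) ((starWord' P ((translate (X.rotate 1)).rotate
      ((translate (X.rotate 1)).length - 1))).rotate 1)).markovB =
    matOf (2 * (SymData.doubly P).p * X.length) ((SymData.doubly P).prodMap X.length a b ν μ) := by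
  have hlt := iterate_lt hX.maps hX.lt
  have htwo := hX.two_le
  obtain ⟨n, hn⟩ := heven
  rw [← two_mul] at hn
  have hpos : 0 < n := by omega
  have hA := itinA_doubly hV hX hpos (by rw [← hn, hX.period])
  rw [← IsUModel.translate_even hn] at hA
  refine markovB_of_itin (S := .pair _ _) hV hX hA ?_
  have hH := eq_periodic_flatMap_range (d := Sym.B)
    (T := fun m => itin ((SymData.doubly P).prodMap X.length a b ν μ)
      ((SymData.doubly P).prodSym X.length a b κ)
      (overB X.length b (SymData.doubly P).rev (μ^[2 * m] κ)))
    (F := fun m => [slotB (!oddM P) (usym κ (μ^[2 * m] κ))] ++ bar P ++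
      [slotA (!oddM P) (periodic .c X (2 * m))] ++ P) (fun m => by
      have h1 := (hV.step_overB hX.toUnimodalModel (hlt (2 * m))).2
      have h2 := (hV.step_overA hX.toUnimodalModel (hlt (2 * m + 1))).2
      simp only [SymData.isDoubly, if_true] at h1 h2
      have h3 := itin_overB hV hX (hlt (2 * m))
      rw [h1, ← Function.iterate_succ_apply' μ (2 * m), itin_overA hV hX (hlt (2 * m + 1)), h2,
        ← Function.iterate_succ_apply' μ (2 * m + 1), rev_doubly] at h3
      simp only [rev_doubly, appendSeq_append, hX.periodic_apply]
      exact h3) hpos (by simp) (by simp [← hn, hX.period])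
  simp only [Nat.mul_zero, Function.iterate_zero, id] at hH
  have hword : starWord' P ((translate (X.rotate 1)).rotate ((translate (X.rotate 1)).length - 1)) =
      (List.range n).flatMap fun m => [slotB (!oddM P) (usym κ (μ^[2 * m] κ))] ++ bar P ++
        [slotA (!oddM P) (periodic .c X (2 * m))] ++ P := by
    have hper : Function.Periodic (fun i => pairCode (periodic .c X (2 * i + 1))
        (periodic .c X (2 * i + 2))) n := by
      intro i
      have h1 := periodic_add_length USym.c X (2 * i + 1)
      have h2 := periodic_add_length USym.c X (2 * i + 2)
      rw [hn] at h1 h2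
      simp only
      rw [show 2 * (i + n) + 1 = 2 * i + 1 + 2 * n by ring,
        show 2 * (i + n) + 2 = 2 * i + 2 + 2 * n by ring, h1, h2]
    rw [IsUModel.translate_rotate hn, List.length_map, List.length_range, rotate_map_range hper,
      starWord', List.flatMap_map]
    congr 1
    funext m
    -- The rotation by `n - 1` brings the last pair, which consists of `c` and the first letter of
    -- `X`, to the front. Adding one period `k = 2n` avoids the index -1.
    have e1 : periodic .c X (2 * (m + (n - 1)) + 1) = usym κ (μ^[2 * m] κ) := by
      rw [hX.periodic_apply, show 2 * (m + (n - 1)) + 1 + 1 = 2 * m + X.length by omega,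
        hX.iterate_add_length]
    have e2 : periodic .c X (2 * (m + (n - 1)) + 2) = periodic .c X (2 * m) := by
      rw [show 2 * (m + (n - 1)) + 2 = 2 * m + X.length by omega, periodic_add_length]
    rw [e1, e2, slots_pairCode]
    intro h
    rw [hX.periodic_apply, Function.iterate_succ_apply']
    exact hX.usym_map_turn h
  rw [← shift_itin, hH, BlockData.seqB, ← hword, periodic_rotate_one Sym.B Sym.B]
  rw [hword]
  intro h0
  rw [List.flatMap_eq_nil_iff] at h0
  simpa using h0 0 (by simpa using hpos)

/-- The transition matrix of the star product is the one of the product model. -/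
theorem markovB_star (hV : IsBModel V a b ν) (hX : IsUModel X κ μ) {W : Factor} (hW : W.Over X)
    {S : BlockData} (hS : star V W = some S) :
    S.markovB = matOf (2 * V.p * X.length) (V.prodMap X.length a b ν μ) := by
  cases V with
  | pair P =>
    cases hW with
    | twin =>
      simp only [star, Option.some.injEq] at hS
      rw [← hS]; exact markovB_pair hV hX
    | minus _ => simp [star] at hS
    | plus _ => simp [star] at hS
  | doubly P =>
    cases hW with
    | twin => simp [star] at hS
    | minus h =>
      simp only [star, Option.some.injEq] at hS
      rw [← hS]; exact markovB_doubly_minus hV hX h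
    | plus h =>
      simp only [star, Option.some.injEq] at hS
      rw [← hS]; exact markovB_doubly_plus hV hX h

end Star

/-! ### The block matrix is the matrix of the product model -/

section Block

variable {N a b k κ : ℕ} {ν μ : ℕ → ℕ} {rev : Bool} {π : BlockPattern}

lemma sum_btw_left (hU : UnimodalModel k κ μ) (t : ℕ) {n : ℕ} (hn : n ≤ κ) :
    ∑ s ∈ Finset.range n, (if Btw (μ s) (μ (s + 1)) t then 1 else 0) =
      if μ 0 ≤ t ∧ t < μ n then 1 else 0 := by
  induction n with
  | zero => rw [Finset.sum_range_zero, if_neg]; omega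
  | succ n ih =>
    rw [Finset.sum_range_succ, ih (by omega)]
    have h1 := hU.left n (n + 1) (by omega) hn
    have h2 : n = 0 ∨ μ 0 < μ n := by
      rcases Nat.eq_zero_or_pos n with h | h
      · exact .inl h
      · exact .inr (hU.left 0 n h (by omega))
    have h3 : μ 0 ≤ μ n := by rcases h2 with rfl | h <;> omega
    split_ifs <;> unfold Btw at * <;> omega

/-- Consecutive intervals of one lap have adjacent images, so each lap contributes at most one to a
column: the left lap covers `t` if `μ 0 ≤ t`, the right lap up to `n` if `μ n ≤ t`. -/
lemma sum_btw (hU : UnimodalModel k κ μ) {t : ℕ} (ht : t < k - 1) {n : ℕ} (hκn : κ ≤ n)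
    (hn : n < k) :
    ∑ s ∈ Finset.range n, (if Btw (μ s) (μ (s + 1)) t then 1 else 0) =
      (if μ 0 ≤ t then 1 else 0) + if μ n ≤ t then 1 else 0 := by
  have hκ := hU.map_turn
  induction n, hκn using Nat.le_induction with
  | base =>
    rw [sum_btw_left hU t le_rfl]
    split_ifs <;> omega
  | succ n hκn ih =>
    rw [Finset.sum_range_succ, ih (by omega)]
    have h1 := hU.right n (n + 1) hκn (by omega) hn
    split_ifs <;> unfold Btw at * <;> omega

/-- The right lap descends from `k - 1` to 0 and covers every column once; the left lap adds a
second 1 from `μ 0` on. So the matrix shows the value `μ 0`. -/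
lemma single_matOf (hU : UnimodalModel k κ μ) (hk : 2 ≤ k) {t : ℕ} (ht : t < k - 1) :
    single (matOf k μ) t = true ↔ t < μ 0 := by
  have h1 : ∑ s ∈ Finset.range (k - 1), entry (matOf k μ) s t =
      ∑ s ∈ Finset.range (k - 1), (if Btw (μ s) (μ (s + 1)) t then 1 else 0) := by
    apply Finset.sum_congr rfl
    intro s hs
    rw [Finset.mem_range] at hs
    rw [entry_matOf hU.maps]
    simp [show s + 1 < k by omega]
  have hκ := hU.turn_lt hk
  unfold single
  rw [decide_eq_true_iff]
  change ∑ s ∈ Finset.range (k - 1), entry (matOf k μ) s t = 1 ↔ _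
  rw [h1, sum_btw hU ht hκ.le (by omega), hU.map_last hk]
  split_ifs <;> omega

lemma entry_blockProduct (A B : SqMat) (π : BlockPattern) {i s j t : ℕ} (hs : s < B.1 + 1)
    (ht : t < B.1 + 1) (hx : i * (B.1 + 1) + s < (A.1 + 1) * (B.1 + 1) - 1)
    (hy : j * (B.1 + 1) + t < (A.1 + 1) * (B.1 + 1) - 1) :
    entry (blockProduct A π B) (i * (B.1 + 1) + s) (j * (B.1 + 1) + t) =
      if s < B.1 then if t < B.1 ∧ j = π.next i then innerBlock π B i s t else 0
      else if t < B.1 then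
        if (if j = 0 then 0 else entry A i (j - 1)) = entry A i j then
          (if j = 0 then 0 else entry A i (j - 1))
        else if (j = π.next i ∧ contEntry π B i true t) ∨
          (j = π.next (i + 1) ∧ contEntry π B (i + 1) false t) then 1 else 0
      else entry A i j := by
  have hd : ∀ i s, s < B.1 + 1 → (i * (B.1 + 1) + s) / (B.1 + 1) = i := fun i s hs => by
    rw [Nat.add_comm, Nat.add_mul_div_right _ _ (Nat.succ_pos _), Nat.div_eq_of_lt hs, zero_add]
  have hm : ∀ i s, s < B.1 + 1 → (i * (B.1 + 1) + s) % (B.1 + 1) = s := fun i s hs => by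
    rw [Nat.add_comm, Nat.add_mul_mod_self_right, Nat.mod_eq_of_lt hs]
  refine (dif_pos ⟨hx, hy⟩).trans ?_
  simp only [blockProduct, Matrix.of_apply, hd _ _ hs, hd _ _ ht, hm _ _ hs, hm _ _ ht]

lemma BimodalModel.ne_succ (hV : BimodalModel N a b ν) {i : ℕ} (hi : i + 1 < N) :
    ν i ≠ ν (i + 1) := by
  rcases Nat.lt_or_ge i a with h | h
  · exact (hV.left i (i + 1) (by omega) h).ne
  rcases Nat.lt_or_ge i b with h' | h'
  · exact (hV.middle i (i + 1) h (by omega) h').ne'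
  · exact (hV.right i (i + 1) h' (by omega) hi).ne

lemma innerBlock_eq (hab : a < b) (hU : UnimodalModel k κ μ) {i : ℕ}
    (hsym : π.sym i = bsym a b i) {s t : ℕ} (hs : s + 1 < k) (ht : t + 1 < k) :
    innerBlock π (matOf k μ) i s t =
      if Btw (fiberMap k a b μ π.rev i s) (fiberMap k a b μ π.rev i (s + 1)) t then 1 else 0 := by
  have hB : (matOf k μ).1 = k - 1 := rfl
  unfold innerBlock
  rw [hsym, hB]
  rcases lt_trichotomy i a with hi | rfl | hi
  · simp only [bsym_eq_L.2 hi, fiberMap, hi, if_true]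
    refine if_congr ?_ rfl rfl
    unfold Btw; omega
  · simp only [bsym_eq_A.2, entry_matOf hU.maps, fiberMap_turnA]
    refine if_congr ?_ rfl rfl
    cases π.rev
    · simp [rv, hs]
    · simp only [rv, if_true]
      rw [show k - 1 - 1 - s + 1 = k - 1 - s by omega, show k - 1 - (s + 1) = k - 1 - 1 - s by omega]
      unfold Btw; omega
  rcases lt_trichotomy i b with hi' | rfl | hi'
  · have : bsym a b i = .M := by simp [bsym, hi.not_gt, hi.ne', hi']
    simp only [this, fiberMap, hi.not_gt, hi.ne', hi', if_true, if_false]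
    refine if_congr ?_ rfl rfl
    unfold Btw; omega
  · simp only [(bsym_eq_B hab).2, entry_matOf hU.maps, fiberMap_turnB hab]
    refine if_congr ?_ rfl rfl
    have h1 := hU.maps _ (rv_lt (!π.rev) (show s < k by omega))
    have h2 := hU.maps _ (rv_lt (!π.rev) (show s + 1 < k by omega))
    cases hr : π.rev <;> simp only [hr, rv, Bool.not_false, Bool.not_true, if_true, if_false,
      Bool.false_eq_true] at h1 h2 ⊢
    · rw [show k - 1 - 1 - s + 1 = k - 1 - s by omega,
        show k - 1 - (s + 1) = k - 1 - 1 - s by omega] at *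
      unfold Btw; omega
    · unfold Btw; omega
  · simp only [(bsym_eq_R hab).2 hi', fiberMap, hi.not_gt, hi.ne', hi'.not_gt, hi'.ne', if_false]
    refine if_congr ?_ rfl rfl
    unfold Btw; omega

/-- The interval behind group `i` begins at the last position of the group. Over a lap this position
maps to the end of group `ν i` facing `ν (i + 1)`, so nothing of that group is covered. Over a
turning point its coordinate is `k - 1`, with `μ (k - 1) = 0` and the same conclusion, or 0, and
then the part cut off by (the reflection of) `μ 0` is covered. -/
lemma contEntry_right (hV : BimodalModel N a b ν) (hU : UnimodalModel k κ μ) (hk : 2 ≤ k) {i : ℕ}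
    (hi : i + 1 < N) (hsym : π.sym i = bsym a b i) {t : ℕ} (ht : t + 1 < k) :
    contEntry π (matOf k μ) i true t = true ↔
      (ν i < ν (i + 1) ∧ fiberMap k a b μ π.rev i (k - 1) ≤ t) ∨
      (ν (i + 1) < ν i ∧ t < fiberMap k a b μ π.rev i (k - 1)) := by
  have hB : (matOf k μ).1 = k - 1 := rfl
  have hab := hV.ab
  have h0 := hU.maps 0 (by omega)
  have hlast := hU.map_last hk
  unfold contEntry
  rw [hsym, hB]
  rcases lt_trichotomy i a with hia | rfl | hia
  · have := hV.left i (i + 1) (by omega) hia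
    simp only [bsym_eq_L.2 hia, fiberMap, hia, if_true, Bool.false_eq_true, false_iff]
    omega
  · have := hV.middle i (i + 1) le_rfl (by omega) hab
    simp only [bsym_eq_A.2, fiberMap_turnA, Bool.and_eq_true, beq_iff_eq,
      single_matOf hU hk (show t < k - 1 by omega)]
    cases π.rev <;> simp [rv, hlast] <;> omega
  rcases lt_trichotomy i b with hib | rfl | hib
  · have := hV.middle i (i + 1) hia.le (by omega) hib
    have hM : bsym a b i = .M := by simp [bsym, hia.not_gt, hia.ne', hib]
    simp only [hM, fiberMap, hia.not_gt, hia.ne', hib, if_true, if_false, Bool.false_eq_true,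
      false_iff]
    omega
  · have := hV.right i (i + 1) le_rfl (by omega) hi
    simp only [(bsym_eq_B hab).2, fiberMap_turnB hab, Bool.and_eq_true, beq_iff_eq,
      single_matOf hU hk (show k - 1 - 1 - t < k - 1 by omega)]
    cases π.rev <;> simp [rv, hlast] <;> omega
  · have := hV.right i (i + 1) hib.le (by omega) hi
    simp only [(bsym_eq_R hab).2 hib, fiberMap, hia.not_gt, hia.ne', hib.not_gt, hib.ne', if_false,
      Bool.false_eq_true, false_iff]
    omega

/-- The mirror image: the interval ends at position 0 of group `i + 1`, whose coordinate over a
turning point is 0 or `k - 1` in the opposite cases. -/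
lemma contEntry_left (hV : BimodalModel N a b ν) (hU : UnimodalModel k κ μ) (hk : 2 ≤ k) {i : ℕ}
    (hi : i + 1 < N) (hsym : π.sym (i + 1) = bsym a b (i + 1)) {t : ℕ} (ht : t + 1 < k) :
    contEntry π (matOf k μ) (i + 1) false t = true ↔
      (ν i < ν (i + 1) ∧ t < fiberMap k a b μ π.rev (i + 1) 0) ∨
      (ν (i + 1) < ν i ∧ fiberMap k a b μ π.rev (i + 1) 0 ≤ t) := by
  have hB : (matOf k μ).1 = k - 1 := rfl
  have hab := hV.ab
  have h0 := hU.maps 0 (by omega)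
  have hlast := hU.map_last hk
  unfold contEntry
  rw [hsym, hB]
  rcases lt_trichotomy (i + 1) a with hia | hia | hia
  · have := hV.left i (i + 1) (by omega) hia.le
    simp only [bsym_eq_L.2 hia, fiberMap, hia, if_true, Bool.false_eq_true, false_iff]
    omega
  · have := hV.left i (i + 1) (by omega) hia.le
    rw [hia] at this ⊢
    simp only [bsym_eq_A.2, fiberMap_turnA, Bool.and_eq_true, beq_iff_eq,
      single_matOf hU hk (show t < k - 1 by omega)]
    cases π.rev <;> simp [rv, hlast] <;> omega
  rcases lt_trichotomy (i + 1) b with hib | hib | hib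
  · have := hV.middle i (i + 1) (by omega) (by omega) hib.le
    have hM : bsym a b (i + 1) = .M := by simp [bsym, hia.not_gt, hia.ne', hib]
    simp only [hM, fiberMap, hia.not_gt, hia.ne', hib, if_true, if_false, Bool.false_eq_true,
      false_iff]
    omega
  · have := hV.middle i (i + 1) (by omega) (by omega) hib.le
    rw [hib] at this ⊢
    simp only [(bsym_eq_B hab).2, fiberMap_turnB hab, Bool.and_eq_true, beq_iff_eq,
      single_matOf hU hk (show k - 1 - 1 - t < k - 1 by omega)]
    cases π.rev <;> simp [rv, hlast] <;> omega
  · have := hV.right i (i + 1) (by omega) (by omega) hi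
    simp only [(bsym_eq_R hab).2 hib, fiberMap, hia.not_gt, hia.ne', hib.not_gt, hib.ne', if_false,
      Bool.false_eq_true, false_iff]
    omega

theorem blockProduct_matOf (hV : BimodalModel N a b ν) (hU : UnimodalModel k κ μ) (hk : 2 ≤ k)
    (hnext : ∀ i < N, π.next i = ν i) (hsym : ∀ i < N, π.sym i = bsym a b i) :
    blockProduct (matOf N ν) π (matOf k μ) = matOf (N * k) (prodMap k a b ν μ π.rev) := by
  have hab := hV.ab
  have hbN := hV.bN
  have hN : (matOf N ν).1 + 1 = N := by simp only [matOf]; omega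
  have hB : (matOf k μ).1 + 1 = k := by simp only [matOf]; omega
  have hB' : (matOf k μ).1 = k - 1 := rfl
  have hsize : (blockProduct (matOf N ν) π (matOf k μ)).1 = N * k - 1 := by
    simp only [blockProduct, hN, hB]
  have hmaps : ∀ x < N * k, prodMap k a b ν μ π.rev x < N * k := by
    intro x hx
    obtain ⟨i, s, hs, rfl⟩ := exists_lex (k := k) (by omega) x
    rw [lex_lt_mul hs] at hx
    rw [prodMap_mk _ hs, lex_lt_mul (fiberMap_lt hU _ _ hs)]
    exact hV.maps i hx
  apply sqMat_ext hsize
  rw [hsize]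
  intro x hx y hy
  obtain ⟨i, s, hs, rfl⟩ := exists_lex (k := k) (by omega) x
  obtain ⟨j, t, ht, rfl⟩ := exists_lex (k := k) (by omega) y
  have hiN : i < N := (lex_lt_mul hs).1 (by omega)
  have key := entry_blockProduct (matOf N ν) (matOf k μ) π (i := i) (s := s) (j := j) (t := t)
  rw [hN, hB, hB'] at key
  rw [key hs ht hx hy, entry_matOf hmaps]
  have hx1 : i * k + s + 1 < N * k := by omega
  simp only [hx1, true_and]
  have hgs := fiberMap_lt (a := a) (b := b) hU π.rev i hs
  by_cases hs' : s < k - 1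
  · have hs1 : s + 1 < k := by omega
    have hgs1 := fiberMap_lt (a := a) (b := b) hU π.rev i hs1
    -- Both ends of an inner interval map into group `ν i`, so only columns of that group can be
    -- covered; `t = k - 1` is impossible since fibre values are at most `k - 1`.
    have hbt : Btw (prodMap k a b ν μ π.rev (i * k + s)) (prodMap k a b ν μ π.rev (i * k + s + 1))
        (j * k + t) ↔ (t < k - 1 ∧ j = π.next i) ∧
          Btw (fiberMap k a b μ π.rev i s) (fiberMap k a b μ π.rev i (s + 1)) t := by
      rw [hnext i hiN, Nat.add_assoc, prodMap_mk _ hs, prodMap_mk _ hs1]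
      unfold Btw
      rw [lex_le hgs ht, lex_lt ht hgs1, lex_le hgs1 ht, lex_lt ht hgs]
      omega
    rw [if_pos hs']
    by_cases hc : t < k - 1 ∧ j = π.next i
    · rw [if_pos hc, innerBlock_eq hab hU (hsym i hiN) hs1 (by omega)]
      exact if_congr (by rw [hbt]; simp only [hc, true_and]) rfl rfl
    · rw [if_neg hc, if_neg fun h => hc (hbt.1 h).1]
  · obtain rfl : s = k - 1 := by omega
    have hxe : i * k + (k - 1) + 1 = (i + 1) * k + 0 := by rw [Nat.add_mul]; omega
    have h0k : 0 < k := by omega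
    have hi1 : i + 1 < N := (lex_lt_mul h0k).1 (by rw [← hxe]; exact hx1)
    have hg0 := fiberMap_lt (a := a) (b := b) hU π.rev (i + 1) h0k
    have hne := hV.ne_succ hi1
    rw [if_neg hs', hxe, prodMap_mk _ hs, prodMap_mk _ h0k]
    have hbt : Btw (ν i * k + fiberMap k a b μ π.rev i (k - 1))
        (ν (i + 1) * k + fiberMap k a b μ π.rev (i + 1) 0) (j * k + t) ↔
        ((ν i < j ∨ ν i = j ∧ fiberMap k a b μ π.rev i (k - 1) ≤ t) ∧
          (j < ν (i + 1) ∨ j = ν (i + 1) ∧ t < fiberMap k a b μ π.rev (i + 1) 0)) ∨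
        ((ν (i + 1) < j ∨ ν (i + 1) = j ∧ fiberMap k a b μ π.rev (i + 1) 0 ≤ t) ∧
          (j < ν i ∨ j = ν i ∧ t < fiberMap k a b μ π.rev i (k - 1))) := by
      unfold Btw
      rw [lex_le hgs ht, lex_lt ht hg0, lex_le hg0 ht, lex_lt ht hgs]
    simp only [hbt, entry_matOf hV.maps, hi1, true_and]
    by_cases ht' : t < k - 1
    · rw [if_pos ht']
      have hR := contEntry_right hV hU hk hi1 (hsym i hiN) (t := t) (by omega)
      have hL := contEntry_left hV hU hk hi1 (hsym _ hi1) (t := t) (by omega)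
      simp only [hnext i hiN, hnext _ hi1, hR, hL]
      generalize fiberMap k a b μ π.rev i (k - 1) = g at *
      generalize fiberMap k a b μ π.rev (i + 1) 0 = g' at *
      clear hR hL hbt key hmaps
      -- The outer entries on the two sides of group `j` differ exactly when an end of the image
      -- lies in that group; elsewhere the group is covered entirely or not at all.
      by_cases hj : j = ν i ∨ j = ν (i + 1)
      · rw [if_neg]
        · refine if_congr ?_ rfl rfl
          omega
        · intro h
          split_ifs at h <;> unfold Btw at * <;> omega
      · rw [if_pos]
        · split_ifs <;> unfold Btw at * <;> omega
        · split_ifs <;> unfold Btw at * <;> omega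
    -- Here `t = k - 1`: the column is the gap behind group `j`. It is above all but the last
    -- position of the group, so the fibre values drop out and only `ν` decides.
    · rw [if_neg ht']
      refine if_congr ?_ rfl rfl
      unfold Btw
      omega

end Block

/-! ### Trimodal data of second factors -/

section Trimodal

variable {X : List USym} {k κ : ℕ} {μ : ℕ → ℕ}

lemma UnimodalModel.inj (h : UnimodalModel k κ μ) {i j : ℕ} (hi : i < k) (hj : j < k)
    (hij : μ i = μ j) : i = j := by
  have := Finset.injOn_of_surjOn_of_card_le (s := Finset.range k) (t := Finset.range k) μ
    (fun x hx => by simpa using h.maps x (by simpa using hx))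
    (fun y hy => by
      obtain ⟨x, hx, h⟩ := h.surj (y := y) (by simpa using hy)
      exact ⟨x, by simpa using hx, h⟩) le_rfl
  exact this (by simpa using hi) (by simpa using hj) hij

/-- The place of the preimage of the turning point on the left lap. -/
lemma UnimodalModel.exists_left_preimage (h : UnimodalModel k κ μ) (hk : 2 ≤ k) :
    ∃ α : ℝ, α < κ ∧ ∀ i < κ, ((i : ℝ) < α ↔ μ i < κ) ∧ ((i : ℝ) = α ↔ μ i = κ) := by
  by_cases hex : ∃ i < κ, μ i = κ
  · obtain ⟨j, hj, hμ⟩ := hex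
    refine ⟨j, by exact_mod_cast hj, fun i hi => ?_⟩
    have h1 := h.left i j
    have h2 := h.left j i
    rw [Nat.cast_lt, Nat.cast_inj]
    rcases lt_trichotomy i j with hij | rfl | hij <;> omega
  · have hlt := h.turn_lt hk
    have htop := h.map_turn
    -- No position on the left maps to `κ`, so any real number separating those mapped below from
    -- those mapped above serves. The upper set contains `κ` itself, which yields `α < κ`.
    obtain ⟨α, h1, h2⟩ := Order.exists_between_finsets
      (((Finset.range κ).filter (fun i => μ i < κ)).image (Nat.cast : ℕ → ℝ))
      (((Finset.range (κ + 1)).filter (fun i => κ < μ i)).image (Nat.cast : ℕ → ℝ)) (by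
        simp only [Finset.mem_image, Finset.mem_filter, Finset.mem_range, forall_exists_index,
          and_imp]
        rintro _ i hi hμi rfl _ j hj hμj rfl
        rw [Nat.cast_lt]
        by_contra hij
        rcases Nat.lt_or_ge j i with hlt | hge
        · have := h.left j i hlt hi.le; omega
        · obtain rfl : i = j := by omega
          omega)
    refine ⟨α, h2 _ (Finset.mem_image_of_mem _ (by simp; omega)), fun i hi => ?_⟩
    rcases lt_trichotomy (μ i) κ with hlt | heq | hgt
    · have := h1 i (Finset.mem_image_of_mem _ (by simp; omega))
      simp [hlt, hlt.ne, this, this.ne]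
    · exact absurd ⟨i, hi, heq⟩ hex
    · have := h2 i (Finset.mem_image_of_mem _ (by simp; omega))
      simp [hgt.not_gt, hgt.ne', this.ne', this.not_gt]

/-- The place of the preimage of the turning point on the right lap. -/
lemma UnimodalModel.exists_right_preimage (h : UnimodalModel k κ μ) (hk : 2 ≤ k) :
    ∃ γ : ℝ, κ < γ ∧ ∀ i, κ < i → i < k → (γ < i ↔ μ i < κ) ∧ ((i : ℝ) = γ ↔ μ i = κ) := by
  by_cases hex : ∃ i, κ < i ∧ i < k ∧ μ i = κ
  · obtain ⟨j, hj, hjk, hμ⟩ := hex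
    refine ⟨j, by exact_mod_cast hj, fun i hi hik => ?_⟩
    have h1 := h.right i j
    have h2 := h.right j i
    rw [Nat.cast_lt, Nat.cast_inj]
    rcases lt_trichotomy i j with hij | rfl | hij <;> omega
  · have hlt := h.turn_lt hk
    have htop := h.map_turn
    obtain ⟨γ, h1, h2⟩ := Order.exists_between_finsets
      (((Finset.range k).filter (fun i => κ ≤ i ∧ κ < μ i)).image (Nat.cast : ℕ → ℝ))
      (((Finset.range k).filter (fun i => κ ≤ i ∧ μ i < κ)).image (Nat.cast : ℕ → ℝ)) (by
        simp only [Finset.mem_image, Finset.mem_filter, Finset.mem_range, forall_exists_index,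
          and_imp]
        rintro _ i hi hκi hμi rfl _ j hj hκj hμj rfl
        rw [Nat.cast_lt]
        by_contra hij
        rcases Nat.lt_or_ge j i with hlt | hge
        · have := h.right j i hκj hlt hi; omega
        · obtain rfl : i = j := by omega
          omega)
    refine ⟨γ, h1 _ (Finset.mem_image_of_mem _ (by simp; omega)), fun i hi hik => ?_⟩
    rcases lt_trichotomy (μ i) κ with hlt | heq | hgt
    · have := h2 i (Finset.mem_image_of_mem _ (by simp; omega))
      simp [hlt, hlt.ne, this, this.ne']
    · exact absurd ⟨i, hi, hik, heq⟩ hex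
    · have := h1 i (Finset.mem_image_of_mem _ (by simp; omega))
      simp [hgt.not_gt, hgt.ne', this.not_gt, this.ne]

/-- Grouping letters in twos means passing to the second iterate. Its maxima are the two preimages
`α`, `γ` of the turning point, its minimum is `κ`, and a pair of unimodal letters is the address of
a point with respect to these. The reals give room for the preimage that is not on the orbit, before
everything is renumbered. -/
lemma IsUModel.exists_trimodal (hX : IsUModel X κ μ) :
    ∃ a b c ν, TrimodalModel (X.length + 1) a b c ν ∧ (3 ≤ X.length → c < X.length) ∧
      (∀ n, itin ν (tsym a b c) a (n + 1) =
        pairCode (periodic .c X (2 * n)) (periodic .c X (2 * n + 1))) ∧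
      (∀ n, itin ν (tsym a b c) b (n + 1) =
        pairCode (periodic .c X (2 * n + 1)) (periodic .c X (2 * n + 2))) ∧
      (Odd X.length → Reaches ν a b) := by
  classical
  have hk := hX.two_le
  have hU := hX.toUnimodalModel
  have hκk := hU.lt
  have hltlast := hU.turn_lt hk
  have htop := hU.map_turn
  set k := X.length with hkdef
  obtain ⟨α, hα, hαi⟩ := hU.exists_left_preimage hk
  obtain ⟨γ, hγ, hγi⟩ := hU.exists_right_preimage hk
  -- `h1` is the first iterate, extended to the inserted point, and `f` the second iterate. The
  -- value of `h1` away from the set `E` below is irrelevant.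
  let h1 : ℝ → ℕ := fun y => if y = α ∨ y = γ then κ else μ ⌊y⌋₊
  let f : ℝ → ℝ := fun y => μ (h1 y)
  set E : Finset ℝ := insert α (insert γ ((Finset.range k).image (Nat.cast : ℕ → ℝ))) with hE
  have hmem : ∀ y, y ∈ E ↔ y = α ∨ y = γ ∨ ∃ i < k, y = (i : ℝ) := by
    intro y
    simp only [hE, Finset.mem_insert, Finset.mem_image, Finset.mem_range, eq_comm]
  have h1α : h1 α = κ := by simp [h1]
  have h1γ : h1 γ = κ := by simp [h1]
  have h1i : ∀ i < k, h1 i = μ i := by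
    intro i hi
    simp only [h1, Nat.floor_natCast]
    split_ifs with hc
    · rcases hc with hc | hc
      · have : i < κ := by exact_mod_cast hc ▸ hα
        exact ((hαi i this).2.1 hc).symm
      · have : κ < i := by exact_mod_cast hc ▸ hγ
        exact ((hγi i this hi).2.1 hc).symm
    · rfl
  have hαγ : α < γ := hα.trans hγ
  have hpre : ∀ i < k, μ i = κ → (i : ℝ) = α ∨ (i : ℝ) = γ := by
    intro i hi hμ
    rcases lt_trichotomy i κ with hlt | rfl | hlt
    · exact .inl ((hαi i hlt).2.2 hμ)
    · omega
    · exact .inr ((hγi i hlt hi).2.2 hμ)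
  -- `κ` has exactly one preimage on the orbit, so exactly one of `α` and `γ` is a new point.
  have hcard : E.card = k + 1 := by
    have hO : ((Finset.range k).image (Nat.cast : ℕ → ℝ)).card = k := by
      rw [Finset.card_image_of_injective _ Nat.cast_injective, Finset.card_range]
    obtain ⟨i₀, hi₀, hμ₀⟩ := hU.surj hκk
    have huniq : ∀ i < k, ((i : ℝ) = α ∨ (i : ℝ) = γ) → i = i₀ := by
      intro i hi hc
      apply hU.inj hi hi₀
      rw [hμ₀, ← h1i i hi]
      rcases hc with hc | hc <;> rw [hc]
      · exact h1α
      · exact h1γ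
    rcases hpre i₀ hi₀ hμ₀ with hc | hc
    · have hγO : γ ∉ (Finset.range k).image (Nat.cast : ℕ → ℝ) := by
        simp only [Finset.mem_image, Finset.mem_range, not_exists, not_and]
        intro i hi hiγ
        rw [huniq i hi (.inr hiγ), hc] at hiγ
        exact hαγ.ne hiγ
      rw [hE, Finset.insert_eq_self.2, Finset.card_insert_of_notMem hγO, hO]
      rw [← hc]
      simp [hi₀]
    · have hαO : α ∉ (Finset.range k).image (Nat.cast : ℕ → ℝ) := by
        simp only [Finset.mem_image, Finset.mem_range, not_exists, not_and]
        intro i hi hiα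
        rw [huniq i hi (.inl hiα), hc] at hiα
        exact hαγ.ne' hiα
      have hγO : γ ∈ (Finset.range k).image (Nat.cast : ℕ → ℝ) := by
        rw [← hc]; simp [hi₀]
      rw [hE, Finset.insert_eq_self.2 hγO, Finset.card_insert_of_notMem hαO, hO]
  have h1lt : ∀ y ∈ E, h1 y < k := by
    intro y hy
    rcases (hmem y).1 hy with rfl | rfl | ⟨i, hi, rfl⟩
    · rw [h1α]; exact hκk
    · rw [h1γ]; exact hκk
    · rw [h1i i hi]; exact hU.maps i hi
  have hfE : ∀ y ∈ E, f y ∈ E := fun y hy =>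
    (hmem _).2 (.inr (.inr ⟨_, hU.maps _ (h1lt y hy), rfl⟩))
  -- position of the values of `h1` relative to the turning point
  have hleft : ∀ y ∈ E, y ≤ κ → (y < α ↔ h1 y < κ) ∧ (y = α ↔ h1 y = κ) := by
    intro y hy hyκ
    rcases (hmem y).1 hy with rfl | rfl | ⟨i, hi, rfl⟩
    · simp [h1α]
    · exact absurd hyκ hγ.not_ge
    · rw [h1i i hi]
      have hle : i ≤ κ := by exact_mod_cast hyκ
      rcases hle.lt_or_eq with hlt | rfl
      · exact hαi i hlt
      · rw [htop]
        simp only [hα.not_gt, hα.ne', false_iff]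
        omega
  have hright : ∀ y ∈ E, κ ≤ y → (γ < y ↔ h1 y < κ) ∧ (y = γ ↔ h1 y = κ) := by
    intro y hy hyκ
    rcases (hmem y).1 hy with rfl | rfl | ⟨i, hi, rfl⟩
    · exact absurd hyκ hα.not_ge
    · simp [h1γ]
    · rw [h1i i hi]
      have hle : κ ≤ i := by exact_mod_cast hyκ
      rcases hle.lt_or_eq with hlt | rfl
      · exact hγi i hlt hi
      · rw [htop]
        simp only [hγ.not_gt, hγ.ne, false_iff]
        omega
  have hκE : (κ : ℝ) ∈ E := (hmem _).2 (.inr (.inr ⟨κ, hκk, rfl⟩))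
  have hαE : α ∈ E := (hmem _).2 (.inl rfl)
  have hγE : γ ∈ E := (hmem _).2 (.inr (.inl rfl))
  have hup : ∀ y ∈ E, ∀ y' ∈ E, y < y' → y' ≤ κ → h1 y < h1 y' := by
    intro y hy y' hy' hlt hle
    have hl := hleft y hy (hlt.le.trans hle)
    have hl' := hleft y' hy' hle
    rcases lt_trichotomy (h1 y') κ with hc | hc | hc
    · rcases lt_trichotomy (h1 y) κ with hd | hd | hd
      · rcases (hmem y).1 hy with rfl | rfl | ⟨i, hi, rfl⟩
        · omega
        · omega
        rcases (hmem y').1 hy' with rfl | rfl | ⟨j, hj, rfl⟩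
        · omega
        · omega
        rw [h1i i hi, h1i j hj]
        exact hU.left i j (by exact_mod_cast hlt) (by exact_mod_cast hle)
      · exact absurd (hlt.trans (hl'.1.2 hc)) (hl.2.2 hd).not_lt
      · have h2 : y < α := hlt.trans (hl'.1.2 hc)
        have := hl.1.1 h2
        omega
    · have h2 : y < α := hlt.trans_eq (hl'.2.2 hc)
      have := hl.1.1 h2
      omega
    · rcases Nat.lt_or_ge κ (h1 y) with hd | hd
      · rcases (hmem y).1 hy with rfl | rfl | ⟨i, hi, rfl⟩
        · omega
        · omega
        rcases (hmem y').1 hy' with rfl | rfl | ⟨j, hj, rfl⟩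
        · omega
        · omega
        rw [h1i i hi, h1i j hj]
        exact hU.left i j (by exact_mod_cast hlt) (by exact_mod_cast hle)
      · omega
  have hdown : ∀ y ∈ E, ∀ y' ∈ E, κ ≤ y → y < y' → h1 y' < h1 y := by
    intro y hy y' hy' hle hlt
    have hl := hright y hy hle
    have hl' := hright y' hy' (hle.trans hlt.le)
    have hnat : h1 y ≠ κ → h1 y' ≠ κ → h1 y' < h1 y := by
      intro hd hc
      rcases (hmem y).1 hy with rfl | rfl | ⟨i, hi, rfl⟩
      · omega
      · omega
      rcases (hmem y').1 hy' with rfl | rfl | ⟨j, hj, rfl⟩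
      · omega
      · omega
      rw [h1i i hi, h1i j hj]
      exact hU.right i j (by exact_mod_cast hle) (by exact_mod_cast hlt) hj
    rcases eq_or_ne (h1 y) κ with hd | hd
    · have h2 : γ < y' := (hl.2.2 hd).symm.trans_lt hlt
      have := hl'.1.1 h2
      omega
    rcases eq_or_ne (h1 y') κ with hc | hc
    · have h2 : ¬ γ < y := (hlt.trans_eq (hl'.2.2 hc)).not_gt
      have := mt hl.1.2 h2
      omega
    · exact hnat hd hc
  obtain ⟨e, ν, heE, hsurj, hlt, hν, hiter⟩ := exists_enumeration E ⟨_, hκE⟩ f hfE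
  rw [hcard] at heE hsurj hlt hν hiter
  obtain ⟨a, ha, hea⟩ := hsurj α hαE
  obtain ⟨b, hb, heb⟩ := hsurj κ hκE
  obtain ⟨c, hc, hec⟩ := hsurj γ hγE
  have hinj : ∀ i < k + 1, ∀ j < k + 1, e i = e j → i = j := by
    intro i hi j hj h
    have h1 := hlt i hi j hj
    have h2 := hlt j hj i hi
    rw [h] at h1 h2
    simp only [lt_self_iff_false, false_iff] at h1 h2
    omega
  have hle : ∀ i < k + 1, ∀ j < k + 1, i ≤ j → e i ≤ e j := by
    intro i hi j hj h
    rw [← not_lt, hlt j hj i hi]; omega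
  have hab : a < b := by rw [← hlt a ha b hb, hea, heb]; exact hα
  have hbc : b < c := by rw [← hlt b hb c hc, heb, hec]; exact hγ
  have heν : ∀ i < k + 1, e (ν i) = μ (h1 (e i)) := fun i hi => hiter i hi 1
  have hνlt : ∀ i < k + 1, ∀ j < k + 1, (ν i < ν j ↔ μ (h1 (e i)) < μ (h1 (e j))) := by
    intro i hi j hj
    rw [← hlt _ (hν i hi) _ (hν j hj), heν i hi, heν j hj, Nat.cast_lt]
  have hsym : ∀ i < k + 1, ∀ j < k, e i = j →
      tsym a b c i = pairCode (usym κ j) (usym κ (μ j)) := by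
    intro i hi j hj hij
    have ea := hlt i hi a ha
    have eb := hlt i hi b hb
    have ec := hlt i hi c hc
    have ea' : i = a ↔ e i = α := ⟨fun h => h ▸ hea, fun h => hinj i hi a ha (h.trans hea.symm)⟩
    have ec' : i = c ↔ e i = γ := ⟨fun h => h ▸ hec, fun h => hinj i hi c hc (h.trans hec.symm)⟩
    rw [hea, hij] at ea
    rw [heb, hij, Nat.cast_lt] at eb
    rw [hec, hij] at ec
    have eb' : i = b ↔ j = κ := by
      constructor
      · rintro rfl; rw [heb] at hij; exact_mod_cast hij.symm
      · rintro rfl; exact hinj i hi b hb (hij.trans heb.symm)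
    rw [hij] at ea' ec'
    have hjE : (j : ℝ) ∈ E := (hmem _).2 (.inr (.inr ⟨j, hj, rfl⟩))
    rcases lt_trichotomy j κ with hjκ | hjκ | hjκ
    · have hl := hαi j hjκ
      have e1 : i < a ↔ μ j < κ := ea.symm.trans hl.1
      have e2 : i = a ↔ μ j = κ := ea'.trans hl.2
      have e3 : i < b := eb.1 hjκ
      simp only [tsym, usym, e1, e2, e3, hjκ, if_true]
      split_ifs <;> rfl
    · have e1 : i = b := eb'.2 hjκ
      rw [(tsym_eq_B hab).2 e1, usym_eq_c.2 hjκ]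
      rfl
    · have hl := hγi j hjκ hj
      have e2 : i = c ↔ μ j = κ := ec'.trans hl.2
      have e3 : ¬ i < b := fun h => by have := eb.2 h; omega
      have e4 : i ≠ b := fun h => by have := eb'.1 h; omega
      have e1 : i < c ↔ κ < μ j := by
        rw [← ec, ← not_le, le_iff_lt_or_eq, hl.1, eq_comm, hl.2]
        omega
      simp only [tsym, usym, e1, e2, e3, e4, show ¬ i < a by omega, show i ≠ a by omega,
        hjκ.not_gt, hjκ.ne', if_false]
      rcases lt_trichotomy (μ j) κ with h | h | h
      · simp [h, h.not_gt, h.ne, pairCode]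
      · simp [h, pairCode]
      · simp [h, h.not_gt, h.ne', pairCode]
  have hfnat : ∀ n, ∀ j < k, f^[n] (j : ℝ) = (μ^[2 * n] j : ℕ) := by
    intro n
    induction n with
    | zero => intro j _; simp
    | succ n ih =>
      intro j hj
      rw [Function.iterate_succ_apply', ih j hj]
      change ((μ (h1 _) : ℕ) : ℝ) = _
      rw [h1i _ (iterate_lt hU.maps hj _), ← Function.iterate_succ_apply' μ,
        ← Function.iterate_succ_apply' μ, show (2 * n).succ.succ = 2 * (n + 1) by omega]
  have hfα : ∀ n, f^[n + 1] α = (μ^[2 * n + 1] κ : ℕ) := by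
    intro n
    rw [Function.iterate_succ_apply, show f α = ((μ κ : ℕ) : ℝ) by simp only [f, h1α],
      hfnat n _ (hU.maps κ hκk), ← Function.iterate_succ_apply]
  have hμlt := iterate_lt hU.maps hκk
  refine ⟨a, b, c, ν, ⟨hab, hbc, hc, hν, ?_, ?_, ?_, ?_, ?_, ?_, ?_⟩, ?_, ?_, ?_, ?_⟩
  · intro i j hij hj
    have hi' : i < k + 1 := by omega
    have hj' : j < k + 1 := by omega
    have hje : e j ≤ α := hea ▸ hle j hj' a ha hj
    have := hleft (e j) (heE j hj') (hje.trans hα.le)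
    rw [hνlt i hi' j hj']
    refine hU.left _ _ (hup _ (heE i hi') _ (heE j hj') ((hlt i hi' j hj').2 hij)
      (hje.trans hα.le)) ?_
    rcases hje.lt_or_eq with h | h
    · exact (this.1.1 h).le
    · exact (this.2.1 h).le
  · intro i j hi hij hj
    have hi' : i < k + 1 := by omega
    have hj' : j < k + 1 := by omega
    have hie : α ≤ e i := hea ▸ hle a ha i hi' hi
    have hje : e j ≤ κ := heb ▸ hle j hj' b hb hj
    have hlt' := (hlt i hi' j hj').2 hij
    have := hleft (e i) (heE i hi') (hlt'.le.trans hje)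
    rw [hνlt j hj' i hi']
    exact hU.right _ _ (not_lt.1 (mt this.1.2 hie.not_gt))
      (hup _ (heE i hi') _ (heE j hj') hlt' hje) (h1lt _ (heE j hj'))
  · intro i j hi hij hj
    have hi' : i < k + 1 := by omega
    have hj' : j < k + 1 := by omega
    have hie : κ ≤ e i := heb ▸ hle b hb i hi' hi
    have hje : e j ≤ γ := hec ▸ hle j hj' c hc hj
    have hlt' := (hlt i hi' j hj').2 hij
    have := hright (e j) (heE j hj') (hie.trans hlt'.le)
    rw [hνlt i hi' j hj']
    exact hU.right _ _ (not_lt.1 (mt this.1.2 hje.not_gt))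
      (hdown _ (heE i hi') _ (heE j hj') hie hlt') (h1lt _ (heE i hi'))
  · intro i j hi hij hj'
    have hi' : i < k + 1 := by omega
    have hie : γ ≤ e i := hec ▸ hle c hc i hi' hi
    have hlt' := (hlt i hi' j hj').2 hij
    have := hright (e i) (heE i hi') (hγ.le.trans hie)
    rw [hνlt j hj' i hi']
    refine hU.left _ _ (hdown _ (heE i hi') _ (heE j hj') (hγ.le.trans hie) hlt') ?_
    rcases hie.lt_or_eq with h | h
    · exact (this.1.1 h).le
    · exact (this.2.1 h.symm).le
  · apply hinj _ (hν a ha) _ (hν c hc)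
    rw [heν a ha, heν c hc, hea, hec, h1α, h1γ]
  -- `f` advances by two steps of `μ`: an even time to `κ` ends at `κ`, an odd time ends one step
  -- before it, at `α` or `γ`.
  · have key : ∀ n, ∀ j < k, μ^[n] j = κ → ∃ m, f^[m] (j : ℝ) = α ∨ f^[m] (j : ℝ) = κ ∨
        f^[m] (j : ℝ) = γ := by
      intro n
      induction n using Nat.twoStepInduction with
      | zero => intro j _ hj; exact ⟨0, .inr (.inl (congrArg (Nat.cast : ℕ → ℝ) hj))⟩
      | one =>
        intro j hjk hj
        rcases hpre j hjk hj with h | h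
        · exact ⟨0, .inl h⟩
        · exact ⟨0, .inr (.inr h)⟩
      | more n ih _ =>
        intro j hjk hj
        obtain ⟨m, hm⟩ := ih (μ (μ j)) (hU.maps _ (hU.maps _ hjk)) hj
        refine ⟨m + 1, ?_⟩
        rw [Function.iterate_succ_apply, show f j = ((μ (μ j) : ℕ) : ℝ) by simp only [f, h1i j hjk]]
        exact hm
    intro i hi
    have hfin : ∀ m, (f^[m] (e i) = α ∨ f^[m] (e i) = κ ∨ f^[m] (e i) = γ) →
        (ν^[m] i = a ∨ ν^[m] i = b ∨ ν^[m] i = c) := by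
      intro m hm
      rw [← hiter i hi m] at hm
      have hmlt := iterate_lt hν hi m
      exact hm.imp (fun h => hinj _ hmlt _ ha (h.trans hea.symm)) (Or.imp
        (fun h => hinj _ hmlt _ hb (h.trans heb.symm))
        (fun h => hinj _ hmlt _ hc (h.trans hec.symm)))
    rcases (hmem _).1 (heE i hi) with h | h | ⟨j, hj, h⟩
    · exact ⟨0, hfin 0 (.inl h)⟩
    · exact ⟨0, hfin 0 (.inr (.inr h))⟩
    · obtain ⟨n, hn⟩ := hU.turn j hj
      obtain ⟨m, hm⟩ := key n j hj hn
      rw [← h] at hm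
      exact ⟨m, hfin m hm⟩
  · intro i hi
    rcases (hmem _).1 (heE i hi) with h | h | ⟨j, hj, h⟩
    · exact ⟨0, .inl (hinj i hi a ha (h.trans hea.symm))⟩
    · exact ⟨0, .inr (.inr (hinj i hi c hc (h.trans hec.symm)))⟩
    · obtain ⟨n, hn⟩ := hU.cover j hj
      rcases Nat.even_or_odd' n with ⟨m, rfl | rfl⟩
      · refine ⟨m, .inr (.inl (hinj i hi _ (iterate_lt hν hb _) ?_))⟩
        rw [hiter b hb, heb, hfnat m κ hκk, h, hn]
      · refine ⟨m + 1, .inl (hinj i hi _ (iterate_lt hν ha _) ?_)⟩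
        rw [hiter a ha, hea, hfα, h, hn]
  -- Since `μ (k - 1) = 0 < κ`, the point `k - 1` lies beyond `γ`. So the last lap contains an
  -- interval, whose direction is then known.
  · intro hk3
    have hpos := hU.turn_pos hk3
    have hlast := hU.map_last hk
    have hγlt : γ < ((k - 1 : ℕ) : ℝ) :=
      (hγi (k - 1) (by omega) (by omega)).1.2 (by omega)
    obtain ⟨i, hi, hei⟩ := hsurj ((k - 1 : ℕ) : ℝ)
      ((hmem _).2 (.inr (.inr ⟨k - 1, by omega, rfl⟩)))
    rw [← hei, ← hec, hlt c hc i hi] at hγlt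
    omega
  · intro n
    rw [itin, hsym _ (iterate_lt hν ha _) _ (hμlt (2 * n + 1)) (by rw [hiter a ha, hea, hfα]),
      hX.periodic_apply, hX.periodic_apply, ← Function.iterate_succ_apply' μ]
  · intro n
    rw [itin, hsym _ (iterate_lt hν hb _) _ (hμlt (2 * (n + 1)))
      (by rw [hiter b hb, heb, hfnat _ _ hκk]), hX.periodic_apply, hX.periodic_apply,
      ← Function.iterate_succ_apply' μ]
    rfl
  · rintro ⟨m, hm⟩
    refine ⟨m + 1, hinj _ (iterate_lt hν ha _) b hb ?_⟩
    rw [hiter a ha, hea, hfα, heb, ← hm, hX.period]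

end Trimodal

/-! ### Data are determined by their transition matrices -/

/-- Each row gives only an unordered pair of neighbouring values. Once the last pair is ordered,
every further pair shares a known value with its right neighbour, and `ν` unrolls from right to
left. -/
lemma map_eq_of_matOf_eq {N : ℕ} {ν ν' : ℕ → ℕ} (h : ∀ i < N, ν i < N) (h' : ∀ i < N, ν' i < N)
    (hne : ∀ i, i + 1 < N → ν i ≠ ν (i + 1)) (hne' : ∀ i, i + 1 < N → ν' i ≠ ν' (i + 1))
    (hN : 2 ≤ N) (heq : matOf N ν = matOf N ν')
    (hlast : ν (N - 2) < ν (N - 1) ↔ ν' (N - 2) < ν' (N - 1)) : ∀ i < N, ν i = ν' i := by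
  have key : ∀ m < N, ν (N - 1 - m) = ν' (N - 1 - m) := by
    intro m
    induction m with
    | zero =>
      intro _
      have h1 := hne (N - 2) (by omega)
      have h2 := hne' (N - 2) (by omega)
      have h3 := pair_eq_of_matOf_eq h h' heq (i := N - 2) (by omega) h2
      rw [show N - 2 + 1 = N - 1 by omega] at h1 h2 h3
      simp only [Nat.sub_zero]
      omega
    | succ m ih =>
      intro hm
      have hi := ih (by omega)
      have h1 := hne (N - 1 - (m + 1)) (by omega)
      have h2 := hne' (N - 1 - (m + 1)) (by omega)
      have h3 := pair_eq_of_matOf_eq h h' heq (i := N - 1 - (m + 1)) (by omega) h2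
      rw [show N - 1 - (m + 1) + 1 = N - 1 - m by omega] at h1 h2 h3
      omega
  intro i hi
  have := key (N - 1 - i) (by omega)
  rwa [show N - 1 - (N - 1 - i) = i by omega] at this

lemma itin_congr {α : Type} {N : ℕ} {ν ν' : ℕ → ℕ} (h : ∀ i < N, ν i < N)
    (heq : ∀ i < N, ν i = ν' i) (sy : ℕ → α) {i : ℕ} (hi : i < N) : itin ν sy i = itin ν' sy i := by
  funext n
  have : ν^[n] i = ν'^[n] i := by
    induction n with
    | zero => rfl
    | succ n ih =>
      rw [Function.iterate_succ_apply', Function.iterate_succ_apply', ← ih,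
        heq _ (iterate_lt h hi n)]
  rw [itin, itin, this]

lemma matOf_size_eq {N N' : ℕ} {ν ν' : ℕ → ℕ} (hN : 0 < N) (hN' : 0 < N')
    (h : matOf N ν = matOf N' ν') : N = N' := by
  have : N - 1 = N' - 1 := congrArg Sigma.fst h
  omega

/-! ### Turning points of trimodal maps -/

section TrimodalUnique

variable {N a b c : ℕ} {ν : ℕ → ℕ}

lemma TrimodalModel.ne_succ (h : TrimodalModel N a b c ν) {i : ℕ} (hi : i + 1 < N) :
    ν i ≠ ν (i + 1) := by
  rcases Nat.lt_or_ge i a with h1 | h1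
  · exact (h.lap₁ i (i + 1) (by omega) h1).ne
  rcases Nat.lt_or_ge i b with h2 | h2
  · exact (h.lap₂ i (i + 1) h1 (by omega) h2).ne'
  rcases Nat.lt_or_ge i c with h3 | h3
  · exact (h.lap₃ i (i + 1) h2 (by omega) h3).ne
  · exact Ne.symm (h.lap₄ i (i + 1) h3 (by omega) hi).ne

/-- The maxima are exactly the outer turning points. -/
lemma TrimodalModel.lt_top (h : TrimodalModel N a b c ν) {i : ℕ} (hi : i < N) (ha : i ≠ a)
    (hc : i ≠ c) : ν i < ν a := by
  have hab := h.ab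
  have hbc := h.bc
  rcases Nat.lt_or_ge i a with h1 | h1
  · exact h.lap₁ i a h1 le_rfl
  rcases Nat.lt_or_ge b i with h2 | h2
  · rw [h.top]
    rcases Nat.lt_or_ge i c with h3 | h3
    · exact h.lap₃ i c h2.le h3 le_rfl
    · exact h.lap₄ c i le_rfl (by omega) hi
  · exact h.lap₂ a i le_rfl (by omega) h2

/-- The outer turning points are the only places of the maximal value, and between them the inner
one is where descent changes to ascent. -/
lemma TrimodalModel.unique {a' b' c' : ℕ} {ν' : ℕ → ℕ} (h : TrimodalModel N a b c ν)
    (h' : TrimodalModel N a' b' c' ν') (heq : ∀ i < N, ν i = ν' i) :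
    a = a' ∧ b = b' ∧ c = c' := by
  have hab := h.ab
  have hbc := h.bc
  have hcN := h.cN
  have hab' := h'.ab
  have hbc' := h'.bc
  have hcN' := h'.cN
  have e1 := heq a (by omega)
  have e2 := heq c (by omega)
  have e3 := heq a' (by omega)
  have e4 := heq c' (by omega)
  have t := h.top
  have t' := h'.top
  have l1 := h'.lt_top (i := a) (by omega)
  have l2 := h'.lt_top (i := c) (by omega)
  have l3 := h.lt_top (i := a') (by omega)
  have l4 := h.lt_top (i := c') (by omega)
  have haa : a = a' := by omega
  have hcc : c = c' := by omega
  subst haa hcc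
  refine ⟨rfl, ?_, rfl⟩
  have e5 := heq b (by omega)
  have e6 := heq b' (by omega)
  rcases lt_trichotomy b b' with hlt | rfl | hlt
  · have := h.lap₃ b b' le_rfl hlt (by omega)
    have := h'.lap₂ b b' (by omega) hlt le_rfl
    omega
  · rfl
  · have := h'.lap₃ b' b le_rfl hlt (by omega)
    have := h.lap₂ b' b (by omega) hlt le_rfl
    omega

end TrimodalUnique

lemma pairCode_left {x y x' y' : USym} (h : pairCode x y = pairCode x' y') : x = x' := by
  cases x <;> cases y <;> cases x' <;> cases y' <;> simp_all [pairCode]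

lemma pairCode_right {x y x' y' : USym} (h : pairCode x y = pairCode x' y') (hx : x ≠ .c) :
    y = y' := by
  cases x <;> cases y <;> cases x' <;> cases y' <;> simp_all [pairCode]

lemma periodic_map_range {α : Type} (d : α) {h : ℕ → α} {n : ℕ} (hn : 0 < n)
    (hper : Function.Periodic h n) : periodic d ((List.range n).map h) = h := by
  funext m
  have : m % n < n := Nat.mod_lt _ hn
  rw [periodic, List.length_map, List.length_range, List.getD_eq_getElem _ _ (by simpa using this)]
  simp [hper.map_mod_nat]

/-! ### Recovering the unimodal word from a second factor -/

section Factors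

variable {X X' : List USym} {κ κ' : ℕ} {μ μ' : ℕ → ℕ}

lemma IsUModel.markovU_eq (hX : IsUModel X κ μ) : markovU X = matOf X.length μ :=
  (hX.realizes hX.itin_eq).markov_eq

/-- Second factors of trimodal type have trimodal models. -/
lemma Factor.Over.exists_trimodal (hX : IsUModel X κ μ) {W : Factor} (hW : W.Over X) :
    W = .twin X ∨ ∃ a b c ν, TrimodalModel (X.length + 1) a b c ν ∧
      (3 ≤ X.length → c < X.length) ∧
      (∀ n, itin ν (tsym a b c) a (n + 1) =
        pairCode (periodic .c X (2 * n)) (periodic .c X (2 * n + 1))) ∧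
      W.markovW = .inr (matOf (X.length + 1) ν) := by
  have htwo := hX.two_le
  obtain ⟨a, b, c, ν, hT, hc, hA, hB, hr⟩ := hX.exists_trimodal
  have hab := hT.ab
  have hbc := hT.bc
  have symA : tsym a b c a = .A := by simp [tsym]
  have symB : tsym a b c b = .B := (tsym_eq_B hab).2 rfl
  have symC : tsym a b c c = .C := by
    simp [tsym, hbc.not_gt, hbc.ne', (hab.trans hbc).not_gt, (hab.trans hbc).ne']
  have toA : ∀ K, (∀ n, K n = pairCode (periodic .c X (2 * n)) (periodic .c X (2 * n + 1))) →
      consSeq .A K = itin ν (tsym a b c) a ∧ consSeq .C K = itin ν (tsym a b c) c := by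
    intro K hK
    have h1 : K = itin ν (tsym a b c) (ν a) := by
      funext n; rw [hK, ← hA]; rfl
    rw [itin_eq_consSeq ν _ a, itin_eq_consSeq ν _ c, ← hT.top, ← h1, symA, symC]
    exact ⟨rfl, rfl⟩
  cases hW with
  | twin => exact .inl rfl
  | minus hodd =>
    refine .inr ⟨a, b, c, ν, hT, hc, hA, ?_⟩
    have hper : Function.Periodic (fun i => pairCode (periodic .c X (2 * i))
        (periodic .c X (2 * i + 1))) X.length := by
      intro i
      have h1 : ∀ m, periodic .c X (m + 2 * X.length) = periodic .c X m := fun m => by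
        rw [two_mul, ← Nat.add_assoc, periodic_add_length, periodic_add_length]
      simp only
      rw [show 2 * (i + X.length) + 1 = 2 * i + 1 + 2 * X.length by ring,
        show 2 * (i + X.length) = 2 * i + 2 * X.length by ring, h1, h1]
    have hK : periodic .A (translate (X ++ X)) = fun n =>
        pairCode (periodic .c X (2 * n)) (periodic .c X (2 * n + 1)) := by
      rw [IsUModel.translate_append_self]
      exact periodic_map_range _ (by omega) hper
    have hne : translate (X ++ X) ≠ [] := by
      rw [IsUModel.translate_append_self, ← List.length_pos_iff]
      simp; omega
    obtain ⟨hKA, hKC⟩ := toA _ (congrFun hK)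
    have hKB := itin_idxOf hab.ne (fun _ => tsym_eq_B hab) hne hKA (hr hodd)
    exact congrArg Sum.inr (hT.realizes hKA hKB hKC).markov_eq
  | plus heven =>
    refine .inr ⟨a, b, c, ν, hT, hc, hA, ?_⟩
    obtain ⟨n, hn⟩ := heven
    rw [← two_mul] at hn
    have h1 : ∀ m, periodic .c X (m + 2 * n) = periodic .c X m := fun m => by
      rw [← hn, periodic_add_length]
    have hK : periodic .A (translate X) = fun n =>
        pairCode (periodic .c X (2 * n)) (periodic .c X (2 * n + 1)) := by
      rw [IsUModel.translate_even hn]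
      refine periodic_map_range _ (by omega) fun i => ?_
      rw [show 2 * (i + n) + 1 = 2 * i + 1 + 2 * n by ring,
        show 2 * (i + n) = 2 * i + 2 * n by ring, h1, h1]
    have hK' : periodic .B (translate (X.rotate 1)) = fun n =>
        pairCode (periodic .c X (2 * n + 1)) (periodic .c X (2 * n + 2)) := by
      rw [IsUModel.translate_rotate hn]
      refine periodic_map_range _ (by omega) fun i => ?_
      rw [show 2 * (i + n) + 1 = 2 * i + 1 + 2 * n by ring,
        show 2 * (i + n) + 2 = 2 * i + 2 + 2 * n by ring, h1, h1]
    obtain ⟨hKA, hKC⟩ := toA _ (congrFun hK)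
    have hKB : consSeq .B (periodic .B (translate (X.rotate 1))) = itin ν (tsym a b c) b := by
      rw [itin_eq_consSeq ν _ b, symB, hK']
      congr 1
      funext n
      rw [← hB]; rfl
    exact congrArg Sum.inr (hT.realizes hKA hKB hKC).markov_eq

lemma IsUModel.ext (hX : IsUModel X κ μ) (hX' : IsUModel X' κ' μ') (hlen : X.length = X'.length)
    (h : ∀ n, n + 1 < X.length → periodic .c X n = periodic .c X' n) : X = X' := by
  have htwo := hX.two_le
  have last : ∀ {X κ μ}, IsUModel X κ μ → periodic .c X (X.length - 1) = .c := by
    intro X κ μ hX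
    have := hX.two_le
    rw [hX.periodic_apply, show X.length - 1 + 1 = X.length by omega, hX.period, usym_eq_c.2 rfl]
  rw [list_eq_map_range_periodic .c X, list_eq_map_range_periodic .c X', ← hlen]
  apply List.map_congr_left
  intro n hn
  rw [List.mem_range] at hn
  rcases Nat.lt_or_ge (n + 1) X.length with hlt | hge
  · exact h n hlt
  · obtain rfl : n = X.length - 1 := by omega
    rw [last hX]
    conv_rhs => rw [hlen, last hX']

/-- A twin factor carries the unimodal matrix itself. Otherwise the matrix determines the trimodal
map, hence the itinerary of `A`, and decoding its pairs gives the letters of `X` in front of the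
final `c`. -/
lemma markovU_eq_of_markovW_eq (hX : IsUModel X κ μ) (hX' : IsUModel X' κ' μ') {W W' : Factor}
    (hW : W.Over X) (hW' : W'.Over X') (h : W.markovW = W'.markovW) : markovU X = markovU X' := by
  have htwo := hX.two_le
  rcases hW.exists_trimodal hX with rfl | ⟨a, b, c, ν, hT, hc, hA, hM⟩
  · rcases hW'.exists_trimodal hX' with rfl | ⟨a', b', c', ν', hT', hc', hA', hM'⟩
    · simp only [Factor.markovW, Sum.inl.injEq, Prod.mk.injEq] at h
      exact h.1
    · rw [hM'] at h
      cases h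
  rcases hW'.exists_trimodal hX' with rfl | ⟨a', b', c', ν', hT', hc', hA', hM'⟩
  · rw [hM] at h
    cases h
  rw [hM, hM', Sum.inr.injEq] at h
  have hlen : X.length = X'.length := by
    have := matOf_size_eq (by omega) (by omega) h
    omega
  congr 1
  apply hX.ext hX' hlen
  have first : ∀ {X κ μ}, IsUModel X κ μ → periodic .c X 0 = .r := by
    intro X κ μ hX
    rw [hX.periodic_apply]
    exact hX.usym_map_turn (usym_eq_c.2 rfl)
  rcases Nat.lt_or_ge X.length 3 with hlt | hge
  -- For `k = 2` the last lap need not contain an interval, so the matrix argument is not available;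
  -- but the only word is `rc`.
  · intro n hn
    obtain rfl : n = 0 := by omega
    rw [first hX, first hX']
  · rw [← hlen] at hT' hc' h
    have hc := hc hge
    have hc' := hc' hge
    have hν := map_eq_of_matOf_eq hT.maps hT'.maps (fun i hi => hT.ne_succ hi)
      (fun i hi => hT'.ne_succ hi) (by omega) h (by
        have h1 := hT.lap₄ (X.length - 1) X.length (by omega) (by omega) (by omega)
        have h2 := hT'.lap₄ (X.length - 1) X.length (by omega) (by omega) (by omega)
        rw [show X.length + 1 - 2 = X.length - 1 by omega, Nat.add_sub_cancel]
        omega)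
    obtain ⟨rfl, rfl, rfl⟩ := hT.unique hT' hν
    have hab := hT.ab
    have hbc := hT.bc
    have hit := itin_congr hT.maps hν (tsym a b c) (i := a) (by omega)
    have hpc : ∀ n, pairCode (periodic .c X (2 * n)) (periodic .c X (2 * n + 1)) =
        pairCode (periodic .c X' (2 * n)) (periodic .c X' (2 * n + 1)) := fun n => by
      rw [← hA, ← hA', hit]
    intro n hn
    rcases Nat.even_or_odd' n with ⟨m, rfl | rfl⟩
    · exact pairCode_left (hpc m)
    · exact pairCode_right (hpc m) (hX.ne_c _ (by omega))

end Factors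

/-! ### Recovering symmetric data from the transition matrix -/

section Bimodal

variable {V V' : SymData} {a b a' b' : ℕ} {ν ν' : ℕ → ℕ}

lemma IsBModel.markovV_eq (hV : IsBModel V a b ν) : V.markovV = matOf (2 * V.p) ν :=
  (hV.realizes hV.itinA hV.itinB).markov_eq

lemma SymData.seq_letters (V : SymData) (n : ℕ) {x : Sym} (hx : x = .L ∨ x = .R)
    (h : V.blocks.seqA n = x ∨ V.blocks.seqB n = x) : x ∈ V.word ∨ conj x ∈ V.word := by
  have hbar : ∀ P, x ∈ bar P → conj x ∈ P := by
    intro P hP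
    obtain ⟨y, hy, rfl⟩ := List.mem_map.1 hP
    have : conj (conj y) = y := by cases y <;> rfl
    rwa [this]
  have hA : x ≠ .A := by rcases hx with rfl | rfl <;> simp
  have hB : x ≠ .B := by rcases hx with rfl | rfl <;> simp
  cases V with
  | pair P =>
    simp only [blocks, BlockData.seqA, BlockData.seqB, word] at h ⊢
    rcases h with h | h
    · have := periodic_mem (w := P ++ [Sym.A]) (by simp) .A n
      rw [h] at this
      simp only [List.mem_append, List.mem_singleton, hA, or_false] at this
      exact .inl this
    · have := periodic_mem (w := bar P ++ [Sym.B]) (by simp) .B n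
      rw [h] at this
      simp only [List.mem_append, List.mem_singleton, hB, or_false] at this
      exact .inr (hbar P this)
  | doubly P =>
    have key : ∀ m, periodic .A (P ++ [.B] ++ bar P ++ [.A]) m = x → x ∈ P ∨ conj x ∈ P := by
      intro m hm
      have := periodic_mem (w := P ++ [Sym.B] ++ bar P ++ [Sym.A]) (by simp) .A m
      rw [hm] at this
      simp only [List.mem_append, List.mem_singleton, hA, hB, or_false] at this
      exact this.imp_right (hbar P)
    simp only [blocks, BlockData.seqA, BlockData.seqB, word] at h ⊢
    rcases h with h | h
    · exact key _ h
    · rw [shift_iterate] at h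
      exact key _ h

/-- Beyond the turning point `B` there are further points, unless `V` has only two points. -/
lemma IsBModel.turn_lt (hV : IsBModel V a b ν) (hp : 0 < V.word.length) : b < 2 * V.p - 1 := by
  have hab := hV.ab
  have hbN := hV.bN
  by_contra hge
  have hnoR : ∀ i < 2 * V.p, bsym a b i ≠ .R := fun i hi h => by
    rw [bsym_eq_R hab] at h; omega
  have seqA : ∀ n, V.blocks.seqA n = bsym a b (ν^[n + 1] a) := fun n => congrFun hV.itinA (n + 1)
  have seqB : ∀ n, V.blocks.seqB n = bsym a b (ν^[n + 1] b) := fun n => congrFun hV.itinB (n + 1)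
  have ltA := iterate_lt hV.maps (hab.trans hbN)
  have ltB := iterate_lt hV.maps hbN
  -- If `b` were the last position, the symbol `R` would never occur. By symmetry an `L` in the word
  -- is an `R` on the other orbit, so `L` is excluded as well.
  have hR : Sym.R ∉ V.word := by
    intro h
    obtain ⟨n, hn, hx⟩ := List.getElem_of_mem h
    exact hnoR _ (ltA (n + 1)) (by rw [← seqA, V.seqA_of_lt hn, hx])
  have hL : Sym.L ∉ V.word := by
    intro h
    obtain ⟨n, hn, hx⟩ := List.getElem_of_mem h
    exact hnoR _ (ltB (n + 1)) (by rw [← seqB, V.seqB_of_lt hV.lap_word hn, hx]; rfl)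
  have ha : a = 0 := by
    by_contra ha
    have h0 : bsym a b 0 = .L := bsym_eq_L.2 (by omega)
    have : ∃ n, V.blocks.seqA n = .L ∨ V.blocks.seqB n = .L := by
      obtain ⟨n, hn⟩ := hV.cover 0 (by omega)
      cases n with
      | zero => simp only [Function.iterate_zero, id] at hn; omega
      | succ n =>
        refine ⟨n, hn.imp (fun h => ?_) (fun h => ?_)⟩
        · rw [seqA, ← h, h0]
        · rw [seqB, ← h, h0]
    obtain ⟨n, hn⟩ := this
    exact (V.seq_letters n (.inl rfl) hn).elim hL hR
  -- Now `a = 0` and `b` is the last position, so `ν` decreases throughout and loses at least one at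
  -- each step. This forces `ν a = b`, making the first letter of `P` a turning symbol.
  have hanti : ∀ i ≤ b, i + ν i ≤ ν a := by
    intro i
    induction i with
    | zero => intro _; rw [ha]; omega
    | succ i ih =>
      intro hi
      have := hV.middle i (i + 1) (by omega) (by omega) hi
      have := ih (by omega)
      omega
  have h1 := hanti b le_rfl
  have h2 := hV.maps a (by omega)
  have h3 : bsym a b (ν a) = .B := (bsym_eq_B hab).2 (by omega)
  have h4 := seqA 0
  rw [V.seqA_of_lt hp] at h4
  have h5 := hV.lap_word _ (List.getElem_mem hp)
  rw [h4, show ν^[0 + 1] a = ν a from rfl, h3] at h5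
  simp at h5

/-- Both turning points would be fixed, although the map decreases between them. -/
lemma IsBModel.not_pair_nil (hV : IsBModel (.pair []) a b ν) : False := by
  have h1 : ν a = a := hV.iterate_p_A
  have h2 : ν b = b := hV.iterate_p_B
  have := hV.middle a b le_rfl hV.ab le_rfl
  have := hV.ab
  omega

/-- The decreasing intervals are exactly those between `a` and `b`. -/
lemma BimodalModel.turn_unique {n : ℕ} (hV : BimodalModel n a b ν) (hV' : BimodalModel n a' b' ν')
    (heq : ∀ i < n, ν i = ν' i) : a = a' ∧ b = b' := by
  have hab := hV.ab
  have hbn := hV.bN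
  have hab' := hV'.ab
  have hbn' := hV'.bN
  have key : ∀ {a b : ℕ} {ν : ℕ → ℕ}, BimodalModel n a b ν →
      ∀ i, i + 1 < n → (a ≤ i ∧ i < b ↔ ν (i + 1) < ν i) := by
    intro a b ν h i hi
    have h1 := h.left i (i + 1) (by omega)
    have h2 := h.middle i (i + 1)
    have h3 := h.right i (i + 1)
    omega
  have hiff : ∀ i, i + 1 < n → (a ≤ i ∧ i < b ↔ a' ≤ i ∧ i < b') := by
    intro i hi
    rw [key hV i hi, key hV' i hi, heq i (by omega), heq (i + 1) hi]
  have h1 := hiff a (by omega)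
  have h2 := hiff a' (by omega)
  have h3 := hiff (b - 1) (by omega)
  have h4 := hiff (b' - 1) (by omega)
  omega

/-- The last lap of a bimodal map increases, which orders the last pair and so determines `ν`, the
turning points and the itinerary of `A`. Its first `p` letters give `P` and, by the turning symbol
at the end, the type of `V`. -/
lemma IsBModel.unique (hV : IsBModel V a b ν) (hV' : IsBModel V' a' b' ν')
    (h : V.markovV = V'.markovV) : V = V' := by
  rw [hV.markovV_eq, hV'.markovV_eq] at h
  have hp : V.p = V'.p := by
    have h1 : 0 < V.p := Nat.succ_pos _
    have h2 : 0 < V'.p := Nat.succ_pos _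
    have := matOf_size_eq (by omega) (by omega) h
    omega
  have hlen : V.word.length = V'.word.length := by simpa [SymData.p] using hp
  suffices V.isDoubly = V'.isDoubly ∧ V.word = V'.word by
    obtain ⟨h1, h2⟩ := this
    cases V <;> cases V' <;> simp_all [SymData.isDoubly, SymData.word]
  -- For `p = 1` the last lap may be a single point, but then only the doubly stable orbit with
  -- empty `P` exists.
  rcases Nat.eq_zero_or_pos V.word.length with h0 | h0
  · have nil : ∀ {V : SymData} {a b : ℕ} {ν : ℕ → ℕ}, IsBModel V a b ν → V.word.length = 0 →
        V.isDoubly = true ∧ V.word = [] := by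
      intro V a b ν hV h0
      rw [List.length_eq_zero_iff] at h0
      refine ⟨?_, h0⟩
      cases V with
      | pair P =>
        obtain rfl : P = [] := h0
        exact hV.not_pair_nil.elim
      | doubly P => rfl
    have h1 := nil hV h0
    have h2 := nil hV' (by omega)
    rw [h1.1, h1.2, h2.1, h2.2]
    exact ⟨rfl, rfl⟩
  · have hb := hV.turn_lt h0
    have hb' := hV'.turn_lt (by omega)
    have hM := hV.toBimodalModel
    have hM' := hV'.toBimodalModel
    rw [← hp] at hM' h hb'
    have hν := map_eq_of_matOf_eq hM.maps hM'.maps (fun i hi => hM.ne_succ hi)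
      (fun i hi => hM'.ne_succ hi) (by omega) h (by
        have h1 := hM.right (2 * V.p - 2) (2 * V.p - 1) (by omega) (by omega) (by omega)
        have h2 := hM'.right (2 * V.p - 2) (2 * V.p - 1) (by omega) (by omega) (by omega)
        omega)
    obtain ⟨rfl, rfl⟩ := hM.turn_unique hM' hν
    have hit := itin_congr hM.maps hν (bsym a b) (hM.ab.trans hM.bN)
    rw [← hV.itinA, ← hV'.itinA] at hit
    have hseq : V.blocks.seqA = V'.blocks.seqA := congrArg shift hit
    constructor
    · have h1 := V.seqA_length
      rw [hseq, hlen, V'.seqA_length] at h1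
      cases hd : V.isDoubly <;> cases hd' : V'.isDoubly <;> simp_all
    · apply List.ext_getElem hlen
      intro n h1 h2
      rw [← V.seqA_of_lt h1, ← V'.seqA_of_lt h2, hseq]

lemma IsBModel.isPattern (hV : IsBModel V a b ν) : V.IsPattern ⟨ν, bsym a b, V.rev⟩ := by
  have hR := hV.realizes hV.itinA hV.itinB
  constructor
  · intro z hz
    rw [hR.points_eq] at hz
    obtain ⟨i, hi, rfl⟩ := hz
    rw [shift_itin, hR.pos_itin hi, hR.pos_itin (hR.maps i hi)]
    exact ⟨rfl, rfl⟩
  · cases V <;> simp [SymData.rev, SymData.word, SymData.isDoubly]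

end Bimodal

/-! ### The matrix product -/

open Classical in
/-- The block pattern read off a transition matrix. -/
noncomputable def patternOf (A : SqMat) : BlockPattern :=
  if h : ∃ (π : BlockPattern) (V : SymData) (a b : ℕ) (ν : ℕ → ℕ), IsBModel V a b ν ∧
      V.markovV = A ∧ π = ⟨ν, bsym a b, V.rev⟩ then h.choose
  else ⟨id, fun _ => .M, false⟩

/-- The chosen preimage of the matrix is `V` itself by uniqueness; the chosen model may be any model
of `V`. -/
lemma patternOf_markovV {V : SymData} (hV : V.InD) :
    ∃ a b ν, IsBModel V a b ν ∧ patternOf V.markovV = ⟨ν, bsym a b, V.rev⟩ := by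
  obtain ⟨a, b, ν, hM⟩ := hV.exists_model
  have h : ∃ (π : BlockPattern) (V' : SymData) (a b : ℕ) (ν : ℕ → ℕ), IsBModel V' a b ν ∧
      V'.markovV = V.markovV ∧ π = ⟨ν, bsym a b, V'.rev⟩ := ⟨_, V, a, b, ν, hM, rfl, rfl⟩
  rw [patternOf, dif_pos h]
  obtain ⟨V', a', b', ν', hM', heq, hπ⟩ := h.choose_spec
  obtain rfl : V' = V := hM'.unique hM heq
  exact ⟨a', b', ν', hM', hπ⟩

open Classical in
/-- The unimodal matrix read off the matrix of a second factor. -/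
noncomputable def coreOf (B : FactorMat) : SqMat :=
  if h : ∃ X, IsUnimodalWord X ∧ ∃ W : Factor, W.Over X ∧ W.markovW = B then markovU h.choose
  else ⟨0, 0⟩

/-- The chosen word need not come from the same factor `W`, but equal factor matrices force equal
unimodal matrices. -/
lemma coreOf_markovW {X : List USym} (hX : IsUnimodalWord X) {W : Factor} (hW : W.Over X) :
    coreOf W.markovW = markovU X := by
  have h : ∃ X, IsUnimodalWord X ∧ ∃ W' : Factor, W'.Over X ∧ W'.markovW = W.markovW :=
    ⟨X, hX, W, hW, rfl⟩
  rw [coreOf, dif_pos h]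
  obtain ⟨hX', W', hW', heq⟩ := h.choose_spec
  obtain ⟨κ, μ, hM⟩ := hX.exists_model
  obtain ⟨κ', μ', hM'⟩ := hX'.exists_model
  exact markovU_eq_of_markovW_eq hM' hM hW' hW heq

lemma Factor.Over.k_eq {X : List USym} {W : Factor} (hW : W.Over X) : W.k = X.length := by
  cases hW with
  | twin => rfl
  | minus _ => simp [Factor.k, IsUModel.translate_append_self]
  | plus h =>
    obtain ⟨n, hn⟩ := h
    rw [← two_mul] at hn
    simp only [Factor.k, IsUModel.translate_even hn, IsUModel.translate_rotate hn, List.length_map,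
      List.length_range]
    omega

end SymBimodal

open SymBimodal in
theorem theorem2 :
    ∃ (otimes : SqMat → FactorMat → SqMat)
      (pattern : SqMat → BlockPattern) (core : FactorMat → SqMat),
      -- the product is the block matrix with pattern read off `A` and inner blocks read off `B`
      (∀ A B, otimes A B = blockProduct A (pattern A) (core B)) ∧
      -- the pattern of `A_V` is the block pattern of `V`
      (∀ V : SymData, V.InD → V.IsPattern (pattern V.markovV) ∧ V.markovV.1 = 2 * V.p - 1) ∧
      -- the inner blocks are given by the unimodal matrix behind `A_W`
      (∀ X, IsUnimodalWord X → ∀ W : Factor, W.Over X →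
        core W.markovW = markovU X ∧ (markovU X).1 = W.k - 1) ∧
      -- `A_{V ⋆ W} = A_V ⊗ A_W`, of size `2 p k - 1`
      (∀ V : SymData, V.InD → ∀ X, IsUnimodalWord X → ∀ W : Factor, W.Over X →
        ∀ S, star V W = some S →
          S.markovB = otimes V.markovV W.markovW ∧ S.markovB.1 = 2 * V.p * W.k - 1) := by
  refine ⟨fun A B => blockProduct A (patternOf A) (coreOf B), patternOf, coreOf, fun _ _ => rfl,
    fun V hV => ?_, fun X hX W hW => ?_, fun V hV X hX W hW S hS => ?_⟩
  · obtain ⟨a, b, ν, hM, hπ⟩ := patternOf_markovV hV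
    refine ⟨hπ ▸ hM.isPattern, ?_⟩
    rw [hM.markovV_eq]
    rfl
  · obtain ⟨κ, μ, hM⟩ := hX.exists_model
    refine ⟨coreOf_markovW hX hW, ?_⟩
    rw [hM.markovU_eq, hW.k_eq]
    rfl
  · obtain ⟨a, b, ν, hM, hπ⟩ := patternOf_markovV hV
    obtain ⟨κ, μ, hU⟩ := hX.exists_model
    have hstar := markovB_star hM hU hW hS
    constructor
    · change _ = blockProduct _ _ _
      rw [hstar, coreOf_markovW hX hW, hπ, hM.markovV_eq, hU.markovU_eq]
      exact (blockProduct_matOf hM.toBimodalModel hU.toUnimodalModel hU.two_le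
        (π := ⟨ν, bsym a b, V.rev⟩) (fun _ _ => rfl) (fun _ _ => rfl)).symm
    · rw [hstar, hW.k_eq]
      rfl
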